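/- For a knot $K$ in $S^3$ let $u(K)$ be its unknotting number, i.e. the least number of crossing changes, interspersed with isotopy, that transform a diagram of $K$ into a diagram of the unknot, and let $\sigma(K)$ be its signature. Let $3_1$ be the trefoil and $10_6$ the knot with this name in Rolfsen's table (the two-bridge knot with Conway notation $5\,3\,2$). Then $u(3_1)=1$ and $u(10_6)\in\{2,3\}$. Moreover, mirror images of $3_1$ and $10_6$ can be chosen so that their connected sum $K_3=3_1\#10_6$ satisfies $|\sigma(K_3)|=2$, and for every such choice $u(K_3)\le 3$. -/

import Mathlib

/-!
Oriented knots in the 3-sphere, given by oriented knot diagrams on the 2-sphere. A diagram is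
recorded by its signed Gauss code: walk once along the knot and write down the visits to the
crossings, each with the name of the crossing, whether one passes over or under, and the sign of
the crossing.
-/

/-- One passage of the knot through a crossing. -/
structure Visit where
  /-- the name of the crossing -/
  crossing : ℕ
  /-- whether this passage is the upper one -/
  upper : Bool
  /-- whether the crossing is positive (right-handed) -/
  positive : Bool
deriving DecidableEq

namespace Visit

/-- The other passage through the same crossing. -/
def opp (v : Visit) : Visit := ⟨v.crossing, !v.upper, v.positive⟩

/-- Whether, seen along the passage `v`, the other strand crosses from right to left. At a positive
crossing the lower strand crosses the upper one from right to left, and the upper strand crosses the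
lower one from left to right; at a negative crossing it is the other way round. -/
def fromRight (v : Visit) : Bool := v.upper == v.positive

/-- Rename the crossings. -/
def relabel (f : ℕ → ℕ) (v : Visit) : Visit := ⟨f v.crossing, v.upper, v.positive⟩

/-- Exchange the two strands of a crossing (its sign changes too). -/
def exchange (v : Visit) : Visit := ⟨v.crossing, !v.upper, !v.positive⟩

/-- Exchange the two strands at the crossing named `c` and leave the other crossings alone. -/
def exchangeAt (c : ℕ) (v : Visit) : Visit := if v.crossing = c then v.exchange else v

/-- The operations on visits that leave the projection of the knot as it is. -/
structure Compatible (g : Visit → Visit) : Prop where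
  inj : Function.Injective g
  opp : ∀ v, g v.opp = (g v).opp
  fromRight : ∀ v, (g v).fromRight = v.fromRight
  crossing : ∀ v w, (g v).crossing = (g w).crossing → v.crossing = w.crossing
  positive : ∀ v w, v.crossing = w.crossing → v.positive = w.positive →
    (g v).positive = (g w).positive

theorem compatible_relabel {f : ℕ → ℕ} (hf : Function.Injective f) : Compatible (relabel f) where
  inj := by
    rintro ⟨a, b, c⟩ ⟨a', b', c'⟩ h
    simp only [relabel, mk.injEq] at h ⊢
    exact ⟨hf h.1, h.2⟩
  opp _ := rfl
  fromRight _ := rfl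
  crossing _ _ h := hf h
  positive _ _ _ h := h

theorem compatible_exchange : Compatible exchange where
  inj := by
    rintro ⟨a, b, c⟩ ⟨a', b', c'⟩ h
    simpa [exchange] using h
  opp _ := rfl
  fromRight := by rintro ⟨a, _ | _, _ | _⟩ <;> rfl
  crossing _ _ h := h
  positive _ _ _ h := by simp [exchange, h]

theorem compatible_exchangeAt (c : ℕ) : Compatible (exchangeAt c) where
  inj := by
    rintro ⟨a, b, d⟩ ⟨a', b', d'⟩ h
    simp only [exchangeAt, exchange] at h
    split_ifs at h <;> simp_all
  opp v := by
    by_cases h : v.crossing = c <;> simp [exchangeAt, Visit.opp, exchange, h]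
  fromRight := by
    intro v
    simp only [exchangeAt]
    split_ifs
    · exact compatible_exchange.fromRight v
    · rfl
  crossing v w h := by
    simp only [exchangeAt, exchange] at h
    split_ifs at h <;> simp_all
  positive v w h h' := by
    simp only [exchangeAt, exchange, h]
    split_ifs <;> simp [h']

end Visit

/-- A signed Gauss code: each crossing that occurs is visited exactly twice, once over and once
under, and both visits carry the same sign. -/
structure GaussCode where
  /-- the visits, in the order in which the knot makes them, from some base point on -/
  visits : List Visit
  nodup : visits.Nodup
  opp_mem : ∀ v ∈ visits, v.opp ∈ visits
  sign_eq : ∀ v ∈ visits, ∀ w ∈ visits, v.crossing = w.crossing → v.positive = w.positive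

namespace GaussCode

/-- The visits of the code. A point `v` also stands for the edge of the diagram that leaves the
crossing at the visit `v` and runs to the next visit. -/
abbrev Point (C : GaussCode) : Type := {v : Visit // v ∈ C.visits}

/-- The other visit to the same crossing. -/
def opp (C : GaussCode) (v : C.Point) : C.Point := ⟨v.1.opp, C.opp_mem v.1 v.2⟩

/-- The cyclic permutation that sends each visit to the next one along the knot. -/
def next (C : GaussCode) : Equiv.Perm C.Point :=
  C.visits.formPerm.subtypePerm fun _ => List.formPerm_mem_iff_mem

/-- The visit before `v` along the knot; as an edge, the edge that arrives at `v`. -/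
def prev (C : GaussCode) (v : C.Point) : C.Point := C.next.symm v

/-- A dart `(v, b)` leaves the crossing at the visit `v`, forwards along the knot if `b` is true and
backwards if it is false. `faceStep` follows the dart to the visit at its end and there turns
left; so its orbits are the faces, each seen on the left of its boundary darts. -/
def faceStep (C : GaussCode) (d : C.Point × Bool) : C.Point × Bool :=
  let w := if d.2 then C.next d.1 else C.prev d.1
  (C.opp w, w.1.fromRight == d.2)

/-- The faces of the code: the darts modulo `faceStep`. -/
def Face (C : GaussCode) : Type := Quot fun d e : C.Point × Bool => e = C.faceStep d

/-- A code with `n > 0` crossings (and `2 * n` visits) defines a connected graph with `n` vertices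
and `2 * n` edges on the closed oriented surface obtained by gluing discs to its faces. If that
surface has genus `g`, there are `n + 2 - 2 * g` faces; so it is the sphere iff there are at least
`n + 2` faces. The empty code is the diagram of a circle without crossings. -/
def Planar (C : GaussCode) : Prop :=
  C.visits = [] ∨ C.visits.length + 4 ≤ 2 * Nat.card C.Face

instance (C : GaussCode) : Finite C.Face :=
  inferInstanceAs (Finite (Quot fun d e : C.Point × Bool => e = C.faceStep d))

theorem card_le_card_face {C : GaussCode} {X : Type} (F : C.Point × Bool → X)
    (hF : ∀ d, F (C.faceStep d) = F d) (hs : Function.Surjective F) :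
    Nat.card X ≤ Nat.card C.Face := by
  refine Nat.card_le_card_of_surjective
    (Quot.lift F (by rintro a b rfl; exact (hF a).symm) : C.Face → X) ?_
  intro x
  obtain ⟨d, rfl⟩ := hs x
  exact ⟨Quot.mk _ d, rfl⟩

theorem planar_of_labels {C : GaussCode} {n : ℕ} (F : C.Point × Bool → Fin n)
    (hn : C.visits.length + 4 ≤ 2 * n) (hF : ∀ d, F (C.faceStep d) = F d)
    (hs : Function.Surjective F) : C.Planar := by
  right
  have := card_le_card_face F hF hs
  rw [Nat.card_fin] at this
  omega

/-- Apply an operation that leaves the projection as it is to all visits. -/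
def map (C : GaussCode) (g : Visit → Visit) (hg : Visit.Compatible g) : GaussCode where
  visits := C.visits.map g
  nodup := C.nodup.map hg.inj
  opp_mem := by
    intro v hv
    obtain ⟨w, hw, rfl⟩ := List.mem_map.1 hv
    rw [← hg.opp]
    exact List.mem_map_of_mem (C.opp_mem w hw)
  sign_eq := by
    intro v hv w hw h
    obtain ⟨v, _, rfl⟩ := List.mem_map.1 hv
    obtain ⟨w, _, rfl⟩ := List.mem_map.1 hw
    have := hg.crossing v w h
    exact hg.positive v w this (C.sign_eq v ‹_› w ‹_› this)

theorem formPerm_map {g : Visit → Visit} (hg : Function.Injective g) {l : List Visit}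
    (hl : l.Nodup) {v : Visit} (hv : v ∈ l) :
    (l.map g).formPerm (g v) = g (l.formPerm v) := by
  obtain ⟨i, hi, rfl⟩ := List.getElem_of_mem hv
  have h := List.formPerm_apply_getElem (l.map g) (hl.map hg) i (by simpa using hi)
  rw [List.formPerm_apply_getElem l hl i hi]
  simpa using h

/-- The point of the new code that comes from a point of the old one. -/
def mapPoint (C : GaussCode) (g : Visit → Visit) (hg : Visit.Compatible g) (v : C.Point) :
    (C.map g hg).Point := ⟨g v.1, List.mem_map_of_mem v.2⟩

theorem mapPoint_next (C : GaussCode) (g : Visit → Visit) (hg : Visit.Compatible g)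
    (v : C.Point) :
    (C.map g hg).next (C.mapPoint g hg v) = C.mapPoint g hg (C.next v) :=
  Subtype.ext (formPerm_map hg.inj C.nodup v.2)

theorem mapPoint_prev (C : GaussCode) (g : Visit → Visit) (hg : Visit.Compatible g)
    (v : C.Point) :
    (C.map g hg).prev (C.mapPoint g hg v) = C.mapPoint g hg (C.prev v) := by
  unfold prev
  rw [Equiv.symm_apply_eq, mapPoint_next, Equiv.apply_symm_apply]

theorem mapPoint_bijective (C : GaussCode) (g : Visit → Visit) (hg : Visit.Compatible g) :
    Function.Bijective (C.mapPoint g hg) := by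
  constructor
  · intro v w h
    exact Subtype.ext (hg.inj (congrArg Subtype.val h))
  · rintro ⟨v, hv⟩
    obtain ⟨w, hw, rfl⟩ := List.mem_map.1 hv
    exact ⟨⟨w, hw⟩, rfl⟩

theorem planar_map {C : GaussCode} (h : C.Planar) (g : Visit → Visit)
    (hg : Visit.Compatible g) : (C.map g hg).Planar := by
  rcases h with h | h
  · left; simp [map, h]
  right
  have hn : (C.map g hg).visits.length = C.visits.length := by simp [map]
  rw [hn]
  refine h.trans (Nat.mul_le_mul_left 2 ?_)
  let e := Equiv.ofBijective _ (C.mapPoint_bijective g hg)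
  have key : ∀ d : C.Point × Bool,
      (C.map g hg).faceStep (e d.1, d.2) = (e (C.faceStep d).1, (C.faceStep d).2) := by
    rintro ⟨v, b⟩
    have h1 := C.mapPoint_next g hg v
    have h2 := C.mapPoint_prev g hg v
    have h3 : ∀ w : C.Point, (C.map g hg).opp (C.mapPoint g hg w) = C.mapPoint g hg (C.opp w) :=
      fun w => Subtype.ext (hg.opp w.1).symm
    have h4 : ∀ w : C.Point, (C.mapPoint g hg w).1.fromRight = w.1.fromRight :=
      fun w => hg.fromRight w.1
    cases b <;> simp [faceStep, e, h1, h2, h3, h4]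
  refine card_le_card_face
    (fun d => (Quot.mk _ (e.symm d.1, d.2) : C.Face)) ?_ ?_
  · rintro ⟨w, b⟩
    obtain ⟨v, rfl⟩ := e.surjective w
    have := key (v, b)
    simp only at this
    rw [this]
    simp only [Equiv.symm_apply_apply]
    exact (Quot.sound (r := fun d e : C.Point × Bool => e = C.faceStep d) rfl).symm
  · intro f
    obtain ⟨⟨v, b⟩, rfl⟩ := Quot.exists_rep f
    exact ⟨(e v, b), by simp only [Equiv.symm_apply_apply]; rfl⟩

theorem formPerm_last {l : List Visit} (h : l.Nodup) (hl : l ≠ []) :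
    l.formPerm (l.getLast hl) = l.head hl := by
  have hp : 0 < l.length := List.length_pos_iff.2 hl
  have h2 := List.formPerm_apply_getElem l h (l.length - 1) (by omega)
  have e2 : (l.length - 1 + 1) % l.length = 0 := by rw [Nat.sub_add_cancel hp, Nat.mod_self]
  simp only [e2] at h2
  rw [List.getLast_eq_getElem, h2, List.head_eq_getElem]

theorem formPerm_append {l m : List Visit} (h : (l ++ m).Nodup) (hl : l ≠ []) (hm : m ≠ [])
    {v : Visit} (hv : v ∈ l) :
    (l ++ m).formPerm v = l.formPerm v ∨
      (v = l.getLast hl ∧ (l ++ m).formPerm v = m.head hm) := by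
  obtain ⟨i, hi, rfl⟩ := List.getElem_of_mem hv
  have hl' : l.Nodup := (List.nodup_append.1 h).1
  have hm' : 0 < m.length := List.length_pos_iff.2 hm
  have h1 := List.formPerm_apply_getElem (l ++ m) h i (by simp; omega)
  have h2 := List.formPerm_apply_getElem l hl' i hi
  rw [List.getElem_append_left hi] at h1
  rw [h1, h2]
  by_cases hc : i + 1 < l.length
  · left
    have e1 : (i + 1) % (l ++ m).length = i + 1 := Nat.mod_eq_of_lt (by simp; omega)
    have e2 : (i + 1) % l.length = i + 1 := Nat.mod_eq_of_lt hc
    simp only [e1, e2]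
    exact List.getElem_append_left hc
  · right
    have hc' : i + 1 = l.length := by omega
    have e1 : (i + 1) % (l ++ m).length = l.length := by
      rw [Nat.mod_eq_of_lt (by simp; omega), hc']
    refine ⟨?_, ?_⟩
    · rw [List.getLast_eq_getElem]
      congr 1; omega
    · simp only [e1]
      rw [List.getElem_append_right (le_refl _), List.head_eq_getElem]
      congr 1; omega

theorem formPerm_append_inv {l m : List Visit} (h : (l ++ m).Nodup) (hl : l ≠ [])
    (hm : m ≠ []) {v : Visit} (hv : v ∈ l) :
    (l ++ m).formPerm⁻¹ v = l.formPerm⁻¹ v ∨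
      (v = l.head hl ∧ (l ++ m).formPerm⁻¹ v = m.getLast hm) := by
  have hr : (m.reverse ++ l.reverse).Nodup := by
    rw [← List.reverse_append]; exact List.nodup_reverse.2 h
  have hr' : (l.reverse ++ m.reverse).Nodup := List.nodup_append_comm.1 hr
  have e : (l ++ m).formPerm⁻¹ = (l.reverse ++ m.reverse).formPerm := by
    rw [← List.formPerm_reverse, List.reverse_append]
    exact List.formPerm_eq_of_isRotated hr List.isRotated_append
  rw [e, ← List.formPerm_reverse]
  have := formPerm_append hr' (by simpa using hl) (by simpa using hm)
    (List.mem_reverse.2 hv)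
  simpa using this

/-- Identify two elements of a type. -/
def Glue (A : Type) (a b : A) : Type := Quot fun x y : A => x = a ∧ y = b

instance (A : Type) [Finite A] (a b : A) : Finite (Glue A a b) :=
  inferInstanceAs (Finite (Quot fun x y : A => x = a ∧ y = b))

theorem card_glue (A : Type) [Finite A] (a b : A) : Nat.card A ≤ Nat.card (Glue A a b) + 1 := by
  classical
  have : Fintype A := Fintype.ofFinite A
  have h1 : Nat.card {x : A // x ≠ b} = Nat.card A - 1 := by
    rw [Nat.card_eq_fintype_card, Nat.card_eq_fintype_card, Fintype.card_subtype_compl]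
    simp
  have h2 : Nat.card {x : A // x ≠ b} ≤ Nat.card (Glue A a b) := by
    refine Nat.card_le_card_of_injective
      (fun x : {x : A // x ≠ b} => (Quot.mk _ x.1 : Glue A a b)) ?_
    let r : Glue A a b → A := Quot.lift (fun x => if x = b then a else x) (by
      rintro x y ⟨rfl, rfl⟩
      simp)
    intro x y hxy
    have := congrArg r hxy
    simp only [r, x.2, y.2, if_false] at this
    exact Subtype.ext this
  omega

/-- Two codes without a common crossing, one after the other. -/
def append (C D : GaussCode)
    (h : ∀ v ∈ C.visits, ∀ w ∈ D.visits, v.crossing ≠ w.crossing) : GaussCode where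
  visits := C.visits ++ D.visits
  nodup := List.nodup_append.2 ⟨C.nodup, D.nodup, fun a ha b hb e => h a ha b hb (by rw [e])⟩
  opp_mem := by
    intro v hv
    rcases List.mem_append.1 hv with hv | hv
    · exact List.mem_append_left _ (C.opp_mem v hv)
    · exact List.mem_append_right _ (D.opp_mem v hv)
  sign_eq := by
    intro v hv w hw e
    rcases List.mem_append.1 hv with hv | hv <;> rcases List.mem_append.1 hw with hw | hw
    · exact C.sign_eq v hv w hw e
    · exact absurd e (h v hv w hw)
    · exact absurd e.symm (h w hw v hv)
    · exact D.sign_eq v hv w hw e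

theorem planar_append {C D : GaussCode} (hC : C.Planar) (hD : D.Planar)
    (h : ∀ v ∈ C.visits, ∀ w ∈ D.visits, v.crossing ≠ w.crossing) :
    (C.append D h).Planar := by
  classical
  have same : ∀ A B : GaussCode, A.visits = B.visits → A.Planar → B.Planar := by
    rintro ⟨_, _, _, _⟩ ⟨_, _, _, _⟩ rfl hp
    exact hp
  rcases hC with hC | hC
  · exact same D _ (by simp [append, hC]) hD
  rcases hD with hD | hD
  · exact same C _ (by simp [append, hD]) (Or.inr hC)
  by_cases nC : C.visits = []
  · exact same D _ (by simp [append, nC]) (Or.inr hD)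
  by_cases nD : D.visits = []
  · exact same C _ (by simp [append, nD]) (Or.inr hC)
  right
  set S := C.append D h with hS
  have hnd : (C.visits ++ D.visits).Nodup := S.nodup
  have hnd' : (D.visits ++ C.visits).Nodup := List.nodup_append_comm.1 hnd
  have hperm : (C.visits ++ D.visits).formPerm = (D.visits ++ C.visits).formPerm :=
    List.formPerm_eq_of_isRotated hnd List.isRotated_append
  let c₁ : C.Point := ⟨C.visits.getLast nC, List.getLast_mem nC⟩
  let c₀ : C.Point := ⟨C.visits.head nC, List.head_mem nC⟩
  let d₁ : D.Point := ⟨D.visits.getLast nD, List.getLast_mem nD⟩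
  let d₀ : D.Point := ⟨D.visits.head nD, List.head_mem nD⟩
  let fC : C.Point × Bool → C.Face := fun d => Quot.mk _ d
  let fD : D.Point × Bool → D.Face := fun d => Quot.mk _ d
  have sC : ∀ d, fC (C.faceStep d) = fC d := fun d =>
    (Quot.sound (r := fun d e : C.Point × Bool => e = C.faceStep d) rfl).symm
  have sD : ∀ d, fD (D.faceStep d) = fD d := fun d =>
    (Quot.sound (r := fun d e : D.Point × Bool => e = D.faceStep d) rfl).symm
  let A := C.Face ⊕ D.Face
  let A' := Glue A (.inl (fC (c₁, true))) (.inr (fD (d₁, true)))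
  let p : A → A' := fun x => Quot.mk _ x
  let X := Glue A' (p (.inl (fC (c₀, false)))) (p (.inr (fD (d₀, false))))
  let q : A → X := fun x => Quot.mk _ (p x)
  have q₁ : q (.inl (fC (c₁, true))) = q (.inr (fD (d₁, true))) :=
    congrArg (fun y : A' => (Quot.mk _ y : X)) (Quot.sound ⟨rfl, rfl⟩)
  have q₀ : q (.inl (fC (c₀, false))) = q (.inr (fD (d₀, false))) :=
    Quot.sound ⟨rfl, rfl⟩
  have hX : Nat.card C.Face + Nat.card D.Face ≤ Nat.card X + 2 := by
    have h1 := card_glue A (.inl (fC (c₁, true))) (.inr (fD (d₁, true)))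
    have h2 := card_glue A' (p (.inl (fC (c₀, false)))) (p (.inr (fD (d₀, false))))
    change Nat.card A ≤ Nat.card A' + 1 at h1
    change Nat.card A' ≤ Nat.card X + 1 at h2
    have h3 : Nat.card A = Nat.card C.Face + Nat.card D.Face := Nat.card_sum
    omega
  have hlen : S.visits.length = C.visits.length + D.visits.length := by simp [hS, append]
  suffices Nat.card X ≤ Nat.card S.Face by omega
  have hnot : ∀ v, v ∈ D.visits → v ∉ C.visits := fun v hD hC => h v hC v hD rfl
  let F : S.Point × Bool → X := fun d =>
    if hv : d.1.1 ∈ C.visits then q (.inl (fC (⟨d.1.1, hv⟩, d.2)))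
    else q (.inr (fD (⟨d.1.1, (List.mem_append.1 d.1.2).resolve_left hv⟩, d.2)))
  have FC : ∀ (x : S.Point × Bool) (v : C.Point) (b : Bool), x.1.1 = v.1 → x.2 = b →
      F x = q (.inl (fC (v, b))) := by
    rintro ⟨⟨x, hx⟩, b'⟩ ⟨v, hv⟩ b h1 h2
    simp only at h1 h2
    subst h1 h2
    simp only [F, hv, dif_pos]
  have FD : ∀ (x : S.Point × Bool) (v : D.Point) (b : Bool), x.1.1 = v.1 → x.2 = b →
      F x = q (.inr (fD (v, b))) := by
    rintro ⟨⟨x, hx⟩, b'⟩ ⟨v, hv⟩ b h1 h2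
    simp only at h1 h2
    subst h1 h2
    simp only [F, hnot x hv, dif_neg, not_false_eq_true]
  refine card_le_card_face F ?_ ?_
  · rintro ⟨⟨v, hv⟩, b⟩
    have en : (S.next ⟨v, hv⟩).1 = (C.visits ++ D.visits).formPerm v := rfl
    have ep : (S.prev ⟨v, hv⟩).1 = (C.visits ++ D.visits).formPerm⁻¹ v := rfl
    rcases List.mem_append.1 hv with hv' | hv'
    · rw [FC (⟨v, hv⟩, b) ⟨v, hv'⟩ b rfl rfl]
      cases b
      · rcases formPerm_append_inv hnd nC nD hv' with e | ⟨e1, e2⟩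
        · have ec : (S.prev ⟨v, hv⟩).1 = (C.prev ⟨v, hv'⟩).1 := by rw [ep, e]; rfl
          rw [← sC]
          refine FC _ _ _ ?_ ?_ <;> simp [faceStep, opp, ec]
        · have ed : (S.prev ⟨v, hv⟩).1 = (D.prev d₀).1 := by
            rw [ep, e2]
            exact (Equiv.Perm.inv_eq_iff_eq.2 (formPerm_last D.nodup nD).symm).symm
          have hv0 : (⟨v, hv'⟩ : C.Point) = c₀ := Subtype.ext e1
          rw [hv0, q₀, ← sD]
          refine FD _ _ _ ?_ ?_ <;> simp [faceStep, opp, ed]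
      · rcases formPerm_append hnd nC nD hv' with e | ⟨e1, e2⟩
        · have ec : (S.next ⟨v, hv⟩).1 = (C.next ⟨v, hv'⟩).1 := by rw [en, e]; rfl
          rw [← sC]
          refine FC _ _ _ ?_ ?_ <;> simp [faceStep, opp, ec]
        · have ed : (S.next ⟨v, hv⟩).1 = (D.next d₁).1 := by
            rw [en, e2]
            exact (formPerm_last D.nodup nD).symm
          have hv0 : (⟨v, hv'⟩ : C.Point) = c₁ := Subtype.ext e1
          rw [hv0, q₁, ← sD]
          refine FD _ _ _ ?_ ?_ <;> simp [faceStep, opp, ed]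
    · rw [FD (⟨v, hv⟩, b) ⟨v, hv'⟩ b rfl rfl]
      cases b
      · rcases formPerm_append_inv hnd' nD nC hv' with e | ⟨e1, e2⟩
        · have ec : (S.prev ⟨v, hv⟩).1 = (D.prev ⟨v, hv'⟩).1 := by rw [ep, hperm, e]; rfl
          rw [← sD]
          refine FD _ _ _ ?_ ?_ <;> simp [faceStep, opp, ec]
        · have ed : (S.prev ⟨v, hv⟩).1 = (C.prev c₀).1 := by
            rw [ep, hperm, e2]
            exact (Equiv.Perm.inv_eq_iff_eq.2 (formPerm_last C.nodup nC).symm).symm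
          have hv0 : (⟨v, hv'⟩ : D.Point) = d₀ := Subtype.ext e1
          rw [hv0, ← q₀, ← sC]
          refine FC _ _ _ ?_ ?_ <;> simp [faceStep, opp, ed]
      · rcases formPerm_append hnd' nD nC hv' with e | ⟨e1, e2⟩
        · have ec : (S.next ⟨v, hv⟩).1 = (D.next ⟨v, hv'⟩).1 := by rw [en, hperm, e]; rfl
          rw [← sD]
          refine FD _ _ _ ?_ ?_ <;> simp [faceStep, opp, ec]
        · have ed : (S.next ⟨v, hv⟩).1 = (C.next c₁).1 := by
            rw [en, hperm, e2]
            exact (formPerm_last C.nodup nC).symm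
          have hv0 : (⟨v, hv'⟩ : D.Point) = d₁ := Subtype.ext e1
          rw [hv0, ← q₁, ← sC]
          refine FC _ _ _ ?_ ?_ <;> simp [faceStep, opp, ed]
  · rintro ⟨⟨x⟩⟩
    rcases x with ⟨⟨v, b⟩⟩ | ⟨⟨v, b⟩⟩
    · exact ⟨(⟨v.1, List.mem_append_left _ v.2⟩, b), FC _ _ _ rfl rfl⟩
    · exact ⟨(⟨v.1, List.mem_append_right _ v.2⟩, b), FD _ _ _ rfl rfl⟩

end GaussCode

/-- An oriented knot diagram on the sphere. -/
structure KnotDiagram extends GaussCode where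
  planar : toGaussCode.Planar

namespace KnotDiagram

/-- The diagram without crossings. -/
def unknot : KnotDiagram where
  visits := []
  nodup := List.nodup_nil
  opp_mem := by simp
  sign_eq := by simp
  planar := Or.inl rfl

/-- Apply an operation that leaves the projection as it is to all visits. -/
def map (D : KnotDiagram) (g : Visit → Visit) (hg : Visit.Compatible g) : KnotDiagram :=
  ⟨D.toGaussCode.map g hg, GaussCode.planar_map D.planar g hg⟩

/-- The mirror image: exchange the strands at all crossings. -/
def mirror (D : KnotDiagram) : KnotDiagram := D.map Visit.exchange Visit.compatible_exchange

/-- The crossing change at the crossing named `c`. -/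
def changeCrossing (D : KnotDiagram) (c : ℕ) : KnotDiagram :=
  D.map (Visit.exchangeAt c) (Visit.compatible_exchangeAt c)

/-- The diagram `D` with its crossings renamed. -/
def relabel (D : KnotDiagram) (f : ℕ → ℕ) (hf : Function.Injective f) : KnotDiagram :=
  D.map (Visit.relabel f) (Visit.compatible_relabel hf)

/-- The connected sum of two oriented knots: cut both diagrams at their base points, between the last
and the first visit, and join them there along their orientations. The crossings of the summands are
renamed first, so that no name occurs in both. -/
def connectedSum (D E : KnotDiagram) : KnotDiagram :=
  let D' := D.relabel (fun n => 2 * n) (fun _ _ h => by simpa using h)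
  let E' := E.relabel (fun n => 2 * n + 1) (fun _ _ h => by simpa using h)
  have h : ∀ v ∈ D'.visits, ∀ w ∈ E'.visits, v.crossing ≠ w.crossing := by
    intro v hv w hw
    obtain ⟨v, _, rfl⟩ := List.mem_map.1 hv
    obtain ⟨w, _, rfl⟩ := List.mem_map.1 hw
    simp only [Visit.relabel]
    omega
  ⟨D'.toGaussCode.append E'.toGaussCode h, GaussCode.planar_append D'.planar E'.planar h⟩

end KnotDiagram

/-- Two consecutive visits `v, w`, in this order if `b` is true and in the opposite order if not. -/
def visitPair (b : Bool) (v w : Visit) : List Visit := if b then [v, w] else [w, v]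

/-- The Reidemeister moves, on the lists of visits of knot diagrams (both lists are required to
belong to diagrams on the sphere where the moves are used). -/
inductive ReidemeisterMove : List Visit → List Visit → Prop
  /-- another base point -/
  | rotate (l m : List Visit) : ReidemeisterMove (l ++ m) (m ++ l)
  /-- other names for the crossings -/
  | relabel (f : ℕ → ℕ) (hf : Function.Injective f) (l : List Visit) :
      ReidemeisterMove l (l.map (Visit.relabel f))
  /-- first move: remove a crossing whose two visits are consecutive -/
  | first (v : Visit) (l : List Visit) : ReidemeisterMove (v :: v.opp :: l) l
  /-- second move: remove two crossings of opposite signs that are consecutive both on the strand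
  that is the upper (or the lower) one at both of them and on the other strand -/
  | second (v w : Visit) (b : Bool) (l m : List Visit)
      (hstrand : v.upper = w.upper) (hsign : v.positive ≠ w.positive) :
      ReidemeisterMove ([v, w] ++ l ++ visitPair b v.opp w.opp ++ m) (l ++ m)
  /-- third move, across a triangle formed by an upper strand, which runs over the others at the
  crossings of `u` and `v`, a middle strand, which passes below the upper one at the crossing of `u`
  and over the lower one at the crossing of `w`, and a lower strand. The order in which each strand
  makes its two visits is reversed. The side on which a strand has the triangle is seen at each of its
  two visits, from the direction of the other strand there and the order of its visits; the three
  edges bound a face iff the two sides agree for each strand. On the rest of the knot, the middle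
  strand comes before the lower one. -/
  | third (u v w : Visit) (a b c : Bool) (l m n : List Visit)
      (hu : u.upper = true) (hv : v.upper = true) (hw : w.upper = true)
      (hupper : (u.fromRight == b) = (v.fromRight == c))
      (hmiddle : (u.opp.fromRight == a) = (w.fromRight == !c))
      (hlower : (v.opp.fromRight == !a) = (w.opp.fromRight == !b)) :
      ReidemeisterMove
        (visitPair a u v ++ l ++ visitPair b u.opp w ++ m ++ visitPair c v.opp w.opp ++ n)
        (visitPair (!a) u v ++ l ++ visitPair (!b) u.opp w ++ m ++
          visitPair (!c) v.opp w.opp ++ n)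
  /-- third move, where the lower strand comes before the middle one -/
  | third' (u v w : Visit) (a b c : Bool) (l m n : List Visit)
      (hu : u.upper = true) (hv : v.upper = true) (hw : w.upper = true)
      (hupper : (u.fromRight == b) = (v.fromRight == c))
      (hmiddle : (u.opp.fromRight == a) = (w.fromRight == !c))
      (hlower : (v.opp.fromRight == !a) = (w.opp.fromRight == !b)) :
      ReidemeisterMove
        (visitPair a u v ++ l ++ visitPair c v.opp w.opp ++ m ++ visitPair b u.opp w ++ n)
        (visitPair (!a) u v ++ l ++ visitPair (!c) v.opp w.opp ++ m ++
          visitPair (!b) u.opp w ++ n)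

namespace KnotDiagram

/-- Isotopy of knots: the equivalence relation on diagrams generated by the Reidemeister moves and
their inverses. -/
def Isotopic : KnotDiagram → KnotDiagram → Prop :=
  Relation.EqvGen fun D E => ReidemeisterMove D.visits E.visits

/-- The diagram can be turned into a diagram of the unknot by `n` crossing changes, interspersed with
isotopy. -/
inductive UnknotsIn : ℕ → KnotDiagram → Prop
  | isotopy {D : KnotDiagram} (h : D.Isotopic unknot) : UnknotsIn 0 D
  | change {n : ℕ} {D E : KnotDiagram} (c : ℕ) (h : D.Isotopic E)
      (hc : ∃ v ∈ E.visits, v.crossing = c) (hn : UnknotsIn n (E.changeCrossing c)) :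
      UnknotsIn (n + 1) D

/-- The unknotting number: the least number of crossing changes, interspersed with isotopy, that
turn the diagram into a diagram of the unknot. -/
noncomputable def unknottingNumber (D : KnotDiagram) : ℕ∞ :=
  ⨅ (n : ℕ) (_ : UnknotsIn n D), (n : ℕ∞)

end KnotDiagram

namespace GaussCode

/-- The real cellular 1-cycles of the projection: flows along the edges such that as much arrives
at each crossing as leaves it. -/
def Cycles (C : GaussCode) : Submodule ℝ (C.Point → ℝ) where
  carrier := {f | ∀ v, f (C.prev v) + f (C.prev (C.opp v)) = f v + f (C.opp v)}
  zero_mem' := by simp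
  add_mem' := by
    intro f g hf hg v
    simp only [Pi.add_apply]
    linarith [hf v, hg v]
  smul_mem' := by
    intro r f hf v
    simp only [Pi.smul_apply, smul_eq_mul, ← mul_add, hf v]

/-- The flow along the edge that leaves the visit `v`. -/
def flow (C : GaussCode) (v : C.Point) : C.Cycles →ₗ[ℝ] ℝ :=
  (LinearMap.proj v).comp C.Cycles.subtype

/-- At the crossing with upper visit `v`, draw both strands upwards and smooth the crossing along the
orientation. Then `C.jump v` is the flow that passes from the left to the right Seifert circle
there: the flow on the incoming left edge minus that on the outgoing left edge. -/
def jump (C : GaussCode) (v : C.Point) : C.Cycles →ₗ[ℝ] ℝ :=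
  if v.1.positive then C.flow (C.prev v) - C.flow (C.opp v)
  else C.flow (C.prev (C.opp v)) - C.flow v

/-- At the crossing with upper visit `v`, the flow on the right edge of the lower strand. -/
def lowerRight (C : GaussCode) (v : C.Point) : C.Cycles →ₗ[ℝ] ℝ :=
  if v.1.positive then C.flow (C.prev (C.opp v)) else C.flow (C.opp v)

/-- The Seifert form `lk(x, y⁺)` of the Seifert surface which Seifert's algorithm builds from the
diagram. Each Seifert circle carries a collar hanging down vertically from it, which is closed by
a disc further below, and at each crossing a half twisted band joins two collars. A cycle `x` of the
projection is a cycle on the surface: it runs along the collars, and through the band where it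
passes from one Seifert circle to another. Every class in the first homology of the surface is
represented in this way, and the cycles that bound (the sums of Seifert circles) lie in the radical,
so that the form on `C.Cycles` has the same signature as the one on homology. The normal of the
collars points to the left of the knot, and so `y⁺` runs along the collars to the left of `x`. Hence
in the projection to the plane `x` passes over `y⁺` exactly where `x` runs through a band from left
to right, and `y⁺` runs below it along the right collar. At a positive crossing `y⁺` leaves the
left collar and reaches the right one beyond this point, at a negative crossing before it; so what
passes below `x` there is in both cases the flow of `y` on the right edge of the lower strand. The
crossing of `x` over `y⁺` is positive. -/
def seifertForm (C : GaussCode) : C.Cycles →ₗ[ℝ] C.Cycles →ₗ[ℝ] ℝ :=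
  ∑ v : C.Point, if v.1.upper then (C.jump v).smulRight (C.lowerRight v) else 0

end GaussCode

/-- The Gauss code of the standard diagram of the trefoil. -/
def trefoilCode : GaussCode where
  visits := [⟨0, true, true⟩, ⟨1, false, true⟩, ⟨2, true, true⟩, ⟨0, false, true⟩,
    ⟨1, true, true⟩, ⟨2, false, true⟩]
  nodup := by decide
  opp_mem := by decide
  sign_eq := by decide

theorem planar_trefoilCode : trefoilCode.Planar :=
  GaussCode.planar_of_labels (n := 5)
    (fun d => if d.2 then [0, 2, 1, 2, 4, 2].getD (trefoilCode.visits.idxOf d.1.1) 0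
      else [1, 3, 4, 3, 0, 3].getD (trefoilCode.visits.idxOf d.1.1) 0)
    (by decide) (by decide) (by decide)

/-- The Gauss code of the standard diagram of `10_6`. -/
def tenSixCode : GaussCode where
  visits := [⟨0, true, false⟩, ⟨1, false, false⟩, ⟨2, true, false⟩, ⟨3, false, false⟩,
    ⟨4, true, false⟩, ⟨5, false, true⟩, ⟨6, true, true⟩, ⟨0, false, false⟩, ⟨1, true, false⟩,
    ⟨2, false, false⟩, ⟨3, true, false⟩, ⟨4, false, false⟩, ⟨7, true, false⟩, ⟨8, false, false⟩,
    ⟨9, true, false⟩, ⟨6, false, true⟩, ⟨5, true, true⟩, ⟨9, false, false⟩, ⟨8, true, false⟩,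
    ⟨7, false, false⟩]
  nodup := by decide
  opp_mem := by decide
  sign_eq := by decide

set_option maxRecDepth 100000 in
theorem planar_tenSixCode : tenSixCode.Planar :=
  GaussCode.planar_of_labels (n := 12)
    (fun d => if d.2 then
        [0, 2, 0, 4, 0, 6, 0, 3, 0, 5, 0, 7, 10, 7, 8, 6, 8, 9, 10, 9].getD
          (tenSixCode.visits.idxOf d.1.1) 0
      else [1, 3, 1, 5, 1, 7, 8, 9, 1, 2, 1, 4, 1, 9, 11, 9, 0, 7, 11, 7].getD
          (tenSixCode.visits.idxOf d.1.1) 0)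
    (by decide) (by decide) (by decide)

namespace KnotDiagram

/-- The symmetrized Seifert form, as a quadratic form. -/
noncomputable def seifertQuadraticForm (D : KnotDiagram) : QuadraticForm ℝ D.Cycles :=
  LinearMap.BilinMap.toQuadraticMap (D.seifertForm + D.seifertForm.flip)

/-- The signature of a knot, with the sign for which the right-handed trefoil has signature `-2`. -/
noncomputable def signature (D : KnotDiagram) : ℤ :=
  (sigPos D.seifertQuadraticForm : ℤ) - sigNeg D.seifertQuadraticForm

/-- The standard alternating diagram with three crossings of the trefoil `3_1` (right-handed). -/
def trefoil : KnotDiagram := ⟨trefoilCode, planar_trefoilCode⟩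

/-- The alternating diagram with ten crossings of the knot `10_6`, the two-bridge knot with Conway
notation `5 3 2`: the crossings `0, …, 4` form the twist with five crossings, `7, 8, 9` the one with
three, and `5, 6` the one with two. -/
def tenSix : KnotDiagram := ⟨tenSixCode, planar_tenSixCode⟩

end KnotDiagram

/-! The upper bounds are explicit sequences of Reidemeister moves and crossing changes that end in
the empty diagram. They are executed and checked by kernel computation, including planarity of every
intermediate diagram. Changing crossings in the two summands separately as in `unknotsIn_trefoil`
and `unknotsIn_tenSix` would take four changes for the connected sum; the sequence for
`trefoil.connectedSum tenSix` makes only three, all at crossings created on the way by inverse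
second moves.

The lower bounds come from a signature that is visibly local. Label the regions of the projection by
real numbers. Draw a crossing with both strands going upwards: it contributes its sign times the
squared difference of the front and back labels minus the squared difference of the two side labels.
The total is the sum of the Goeritz forms of both checkerboard colours. Its signature plus the
writhe is the number `τ` of `HasRegionSig`; by Gordon and Litherland it is minus twice the knot
signature, a fact that is not needed here.

Invariance of `τ` is checked move by move. A curl adds one square, balanced by the writhe. A third
move relabels the central triangle isometrically. A bigon adds a hyperbolic plane, provided that the
two strands border a common region of the smaller diagram; this follows from planarity by counting
dimensions (`sideDiff_eq_zero`). A crossing change alters the form by a multiple of a difference of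
two squares, hence the signature by at most two, and it alters the writhe by at most two. So `|τ| ≤
4 * n` if `n` changes suffice (`HasRegionSig.abs_le_of_unknotsIn`). The values `4` for the trefoil
and `-8` for `10_6` give the bounds one and two.

The Seifert signature enters only through the condition on the connected sum. Explicit
diagonalisations give `2`, `-6` and `6` for three choices of mirror images. The fourth choice is the
mirror image of the first, and unknotting numbers are invariant under mirroring. -/

namespace GaussCode

/-! ### Base points and the cyclic order of the visits. -/

theorem ext_visits {C D : GaussCode} (h : C.visits = D.visits) : C = D := by
  cases C; cases D; cases h; rfl

/-- Planarity does not depend on the base point. -/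
theorem planar_of_isRotated {C D : GaussCode} (h : C.visits ~r D.visits) (hC : C.Planar) :
    D.Planar := by
  rcases hC with hC | hC
  · left
    rw [hC] at h
    exact List.isRotated_nil_iff'.1 h ▸ rfl
  right
  have hlen : C.visits.length = D.visits.length := h.perm.length_eq
  rw [← hlen]
  refine hC.trans (Nat.mul_le_mul_left 2 ?_)
  have hmem : ∀ v, v ∈ D.visits → v ∈ C.visits := fun v hv => h.perm.mem_iff.2 hv
  have hperm := List.formPerm_eq_of_isRotated C.nodup h
  let F : D.Point × Bool → C.Face := fun d => Quot.mk _ (⟨d.1.1, hmem _ d.1.2⟩, d.2)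
  have hcF : ∀ d : C.Point × Bool, (Quot.mk _ (C.faceStep d) : C.Face) = Quot.mk _ d := fun d =>
    (Quot.sound (r := fun d e : C.Point × Bool => e = C.faceStep d) rfl).symm
  refine card_le_card_face (C := D) F ?_ ?_
  · rintro ⟨⟨v, hv⟩, b⟩
    have hn : (D.next ⟨v, hv⟩).1 = (C.next ⟨v, hmem v hv⟩).1 := by
      change D.visits.formPerm v = C.visits.formPerm v
      rw [hperm]
    have hp : (D.prev ⟨v, hv⟩).1 = (C.prev ⟨v, hmem v hv⟩).1 := by
      change D.visits.formPerm⁻¹ v = C.visits.formPerm⁻¹ v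
      rw [hperm]
    refine Eq.trans ?_ (hcF (⟨v, hmem v hv⟩, b))
    cases b <;> simp [F, faceStep, opp, hn, hp] <;> rfl
  · rintro ⟨⟨⟨v, hv⟩, b⟩⟩
    exact ⟨(⟨v, h.perm.mem_iff.1 hv⟩, b), rfl⟩

theorem getElem_mem_idxOf {L : List Visit} {v : Visit} (hv : v ∈ L) :
    ∃ i, ∃ hi : i < L.length, L[i] = v ∧ L.idxOf v = i :=
  ⟨L.idxOf v, List.idxOf_lt_length_iff.2 hv, List.getElem_idxOf _, rfl⟩

theorem next_getElem (C : GaussCode) (i : ℕ) (hi : i < C.visits.length) :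
    (C.next ⟨C.visits[i], List.getElem_mem hi⟩).1 =
      C.visits[(i + 1) % C.visits.length]'(Nat.mod_lt _ (by omega)) :=
  List.formPerm_apply_getElem _ C.nodup i hi

/-- Adding the length before subtracting one avoids truncated subtraction at the base point, where
the predecessor is the last visit. -/
theorem prev_getElem (C : GaussCode) (i : ℕ) (hi : i < C.visits.length) :
    (C.prev ⟨C.visits[i], List.getElem_mem hi⟩).1 =
      C.visits[(i + C.visits.length - 1) % C.visits.length]'(Nat.mod_lt _ (by omega)) := by
  set j := (i + C.visits.length - 1) % C.visits.length with hj
  have hjl : j < C.visits.length := Nat.mod_lt _ (by omega)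
  have h := C.next_getElem j hjl
  have e : (j + 1) % C.visits.length = i := by
    rcases Nat.eq_zero_or_pos i with rfl | hi0
    · have : j = C.visits.length - 1 := by
        rw [hj, Nat.mod_eq_of_lt (by omega)]; omega
      rw [this, Nat.sub_add_cancel (by omega), Nat.mod_self]
    · have : j = i - 1 := by
        rw [hj, show i + C.visits.length - 1 = (i - 1) + C.visits.length by omega,
          Nat.add_mod_right, Nat.mod_eq_of_lt (by omega)]
      rw [this, Nat.sub_add_cancel hi0, Nat.mod_eq_of_lt hi]
  have h' : C.next ⟨C.visits[j], List.getElem_mem hjl⟩ = ⟨C.visits[i], List.getElem_mem hi⟩ := by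
    apply Subtype.ext
    rw [h]
    simp only [e]
  rw [← h']
  simp [prev, j]

end GaussCode

/-! ### An executable test for diagrams on the sphere. -/

/-- Evaluate a list of natural numbers before it is passed on. This is `k l`, but the kernel need not
evaluate the entries of `l` again at each use. -/
def forceList {α : Type} : List ℕ → (List ℕ → α) → α
  | [], k => k []
  | 0 :: l, k => forceList l fun l => k (0 :: l)
  | (n + 1) :: l, k => forceList l fun l => k ((n + 1) :: l)

theorem forceList_eq {α : Type} (l : List ℕ) (k : List ℕ → α) : forceList l k = k l := by
  induction l generalizing k with
  | nil => rfl
  | cons n l ih => cases n <;> exact ih _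

/-- A number that determines a visit. -/
def Visit.code (v : Visit) : ℕ := 4 * v.crossing + 2 * v.upper.toNat + v.positive.toNat

theorem Visit.code_injective : Function.Injective Visit.code := by
  rintro ⟨a, _ | _, _ | _⟩ ⟨b, _ | _, _ | _⟩ h <;> simp [Visit.code] at h ⊢ <;> omega

/-- The number of the visit at which the dart number `d` ends, where the darts at the visit number
`i` of `n` are `2 * i` (backwards) and `2 * i + 1` (forwards). -/
def dartEnd (n d : ℕ) : ℕ := if d % 2 = 1 then (d / 2 + 1) % n else (d / 2 + n - 1) % n

/-- `faceStep` on the numbers of the darts, where `o` lists the numbers of the opposite visits and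
`f` tells whether the visits are from the right. -/
def dartStep (n : ℕ) (o f : List ℕ) (d : ℕ) : ℕ :=
  2 * o.getD (dartEnd n d) 0 + if f.getD (dartEnd n d) 0 = d % 2 then 1 else 0

/-- Evaluate a natural number before it is passed on. -/
def forceNat {α : Type} : ℕ → (ℕ → α) → α
  | 0, k => k 0
  | n + 1, k => k (Nat.succ n)

theorem forceNat_eq {α : Type} (n : ℕ) (k : ℕ → α) : forceNat n k = k n := by
  cases n <;> rfl

/-- A list of numbers below `256` as a single number, for quick access to its entries. -/
def packList (l : List ℕ) : ℕ := l.foldr (fun a r => a + 256 * r) 0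

/-- An entry of a packed list. -/
def packedGet (n d : ℕ) : ℕ := Nat.mod (Nat.shiftRight n (Nat.mul 8 d)) 256

/-- Label all darts by the least dart in the same face. In each round `t` is the table of an iterate
of `dartStep` and `l` lists the least darts found so far. -/
def dartLabels {α : Type} : ℕ → List ℕ → List ℕ → (List ℕ → α) → α
  | 0, l, _, k => k l
  | n + 1, l, t, k =>
    forceNat (packList l) fun pl => forceNat (packList t) fun pt =>
    forceList (List.zipWith (fun a d => min a (packedGet pl d)) l t) fun l' =>
      forceList (t.map fun d => packedGet pt d) fun t' => dartLabels n l' t' k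

/-- Soundness of the test does not depend on which labels are computed, only on the fact that one
list of labels reaches the continuation. -/
theorem exists_dartLabels_eq {α : Type} (n : ℕ) (l t : List ℕ) :
    ∃ l', ∀ k : List ℕ → α, dartLabels n l t k = k l' := by
  induction n generalizing l t with
  | zero => exact ⟨l, fun _ => rfl⟩
  | succ n ih =>
    obtain ⟨l', h⟩ := ih (List.zipWith (fun a d => min a (packedGet (packList l) d)) l t)
      (t.map fun d => packedGet (packList t) d)
    exact ⟨l', fun k => by simp only [dartLabels, forceList_eq, forceNat_eq, h]⟩

/-- A test whether a list of visits is a diagram on the sphere. -/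
def isDiagram (L : List Visit) : Bool :=
  forceList (L.map Visit.code) fun cs =>
  forceList (L.map fun v => cs.idxOf v.opp.code) fun o =>
  forceList (L.map fun v => v.fromRight.toNat) fun f =>
  forceList ((List.range (2 * L.length)).map (dartStep L.length o f)) fun t =>
  decide cs.Nodup && o.all (· < L.length) &&
  L.all (fun v => (Visit.mk v.crossing true !v.positive).code ∉ cs ∧
    (Visit.mk v.crossing false !v.positive).code ∉ cs) &&
  (L.isEmpty || dartLabels 6 (List.range (2 * L.length)) t fun l =>
    decide (l.length = 2 * L.length) && decide (L.length + 4 ≤ 2 * l.dedup.length) &&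
      decide (t.map (fun d => l.getD d 0) = l))

/-- Labels that are constant along `dartStep` define a function on the faces, so the number of
distinct labels bounds the number of faces from below. The constancy is part of the test, so nothing
has to be proved about the search, whose six doublings compare up to `2 ^ 6` successive darts. -/
theorem exists_knotDiagram_of_isDiagram {L : List Visit} (h : isDiagram L = true) :
    ∃ D : KnotDiagram, D.visits = L := by
  obtain ⟨lab, hlab⟩ := exists_dartLabels_eq (α := Bool) 6 (List.range (2 * L.length))
    ((List.range (2 * L.length)).map (dartStep L.length
      (L.map fun v => (L.map Visit.code).idxOf v.opp.code) (L.map fun v => v.fromRight.toNat)))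
  simp only [isDiagram, forceList_eq, hlab, Bool.and_eq_true, decide_eq_true_eq, List.all_eq_true,
    Bool.or_eq_true, List.isEmpty_iff, List.mem_map, forall_exists_index, and_imp,
    forall_apply_eq_imp_iff₂] at h
  obtain ⟨⟨⟨h1, h2⟩, h3⟩, h4⟩ := h
  have hcode : ∀ v : Visit, (L.map Visit.code).idxOf v.code = L.idxOf v := by
    intro v
    clear * -
    induction L with
    | nil => rfl
    | cons w L ih =>
      simp only [List.map_cons, List.idxOf_cons, ih, Visit.code_injective.beq_eq]
  have h1 : L.Nodup := h1.of_map
  have h2 : ∀ v ∈ L, v.opp ∈ L := by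
    intro v hv
    have := h2 v hv
    rw [hcode] at this
    exact List.idxOf_lt_length_iff.1 this
  -- The test excludes both possible visits with the same crossing and the opposite sign.
  have h3 : ∀ v ∈ L, ∀ w ∈ L, v.crossing = w.crossing → v.positive = w.positive := by
    rintro v hv ⟨a, b, c⟩ hw rfl
    by_contra hne
    have hc : c = !v.positive := by
      cases c <;> cases h : v.positive <;> simp_all
    subst hc
    cases b
    · exact (h3 v hv).2 ⟨_, hw, rfl⟩
    · exact (h3 v hv).1 ⟨_, hw, rfl⟩
  let C : GaussCode := ⟨L, h1, h2, h3⟩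
  refine ⟨⟨C, ?_⟩, rfl⟩
  rcases h4 with h4 | ⟨⟨hl, hc⟩, hs⟩
  · exact Or.inl h4
  right
  refine hc.trans (Nat.mul_le_mul_left 2 ?_)
  have hlt : ∀ d : C.Point × Bool, 2 * L.idxOf d.1.1 + d.2.toNat < lab.length := by
    rintro ⟨⟨v, hv⟩, b⟩
    have : L.idxOf v < L.length := List.idxOf_lt_length_iff.2 hv
    have hb : b.toNat ≤ 1 := by cases b <;> simp
    simp only [hl]
    omega
  let F : C.Point × Bool → {x // x ∈ lab.dedup} := fun d =>
    ⟨lab.getD (2 * L.idxOf d.1.1 + d.2.toNat) 0, by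
      rw [List.getD_eq_getElem _ _ (hlt d)]
      exact List.mem_dedup.2 (List.getElem_mem _)⟩
  have hcard : Nat.card {x // x ∈ lab.dedup} = lab.dedup.length := by
    classical
    rw [Nat.card_eq_fintype_card, Fintype.card_of_subtype lab.dedup.toFinset (by simp),
      List.toFinset_card_of_nodup (List.nodup_dedup lab)]
  rw [← hcard]
  refine GaussCode.card_le_card_face F ?_ ?_
  · rintro ⟨⟨v, hv⟩, b⟩
    change v ∈ L at hv
    obtain ⟨i, hi, rfl, hidx⟩ := GaussCode.getElem_mem_idxOf hv
    apply Subtype.ext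
    have hd : 2 * i + b.toNat < 2 * L.length := by
      have hb : b.toNat ≤ 1 := by cases b <;> simp
      omega
    -- Under the numbering of the darts, `faceStep` becomes `dartStep`: quotient and remainder
    -- modulo two recover the visit and the direction.
    have key : 2 * L.idxOf (C.faceStep (⟨L[i], hv⟩, b)).1.1 +
        (C.faceStep (⟨L[i], hv⟩, b)).2.toNat = dartStep L.length
          (L.map fun v => (L.map Visit.code).idxOf v.opp.code) (L.map fun v => v.fromRight.toNat)
          (2 * i + b.toNat) := by
      have e1 : (2 * i + b.toNat) / 2 = i := by cases b <;> simp; omega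
      have e2 : (2 * i + b.toNat) % 2 = b.toNat := by cases b <;> simp
      have hn := C.next_getElem i hi
      have hp := C.prev_getElem i hi
      unfold dartStep dartEnd
      simp only [e1, e2]
      cases b
      · have hp' : (C.prev ⟨L[i], hv⟩).1 = _ := hp
        simp only [GaussCode.faceStep, Bool.false_eq_true, if_false, GaussCode.opp, hp',
          Bool.toNat_false, Nat.zero_ne_one]
        rw [List.getD_eq_getElem _ _ (by simpa using Nat.mod_lt _ (Nat.zero_lt_of_lt hi)),
          List.getD_eq_getElem _ _ (by simpa using Nat.mod_lt _ (Nat.zero_lt_of_lt hi)),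
          List.getElem_map, List.getElem_map, hcode]
        cases h : (L[(i + L.length - 1) % L.length]'(Nat.mod_lt _ (Nat.zero_lt_of_lt hi))).fromRight <;>
          simp [C]
      · have hn' : (C.next ⟨L[i], hv⟩).1 = _ := hn
        simp only [GaussCode.faceStep, if_true, GaussCode.opp, hn', Bool.toNat_true]
        rw [List.getD_eq_getElem _ _ (by simpa using Nat.mod_lt _ (Nat.zero_lt_of_lt hi)),
          List.getD_eq_getElem _ _ (by simpa using Nat.mod_lt _ (Nat.zero_lt_of_lt hi)),
          List.getElem_map, List.getElem_map, hcode]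
        cases h : (L[(i + 1) % L.length]'(Nat.mod_lt _ (Nat.zero_lt_of_lt hi))).fromRight <;>
          simp [C]
    simp only [F]
    rw [key, hidx]
    have hget : ∀ T : List ℕ, T.length = 2 * L.length → T.map (fun d => lab.getD d 0) = lab →
        lab.getD (T.getD (2 * i + b.toNat) 0) 0 = lab.getD (2 * i + b.toNat) 0 := by
      intro T hT hTl
      have hk : 2 * i + b.toNat < lab.length := by omega
      have hk' : 2 * i + b.toNat < T.length := by omega
      rw [List.getD_eq_getElem T 0 hk', List.getD_eq_getElem lab 0 hk,
        List.getElem_of_eq hTl.symm hk, List.getElem_map]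
    have := hget _ (by simp) hs
    rwa [List.getD_eq_getElem (List.map _ _) 0 (by simpa using hd), List.getElem_map,
      List.getElem_range] at this
  · rintro ⟨x, hx⟩
    obtain ⟨d, hd, rfl⟩ := List.getElem_of_mem (List.mem_dedup.1 hx)
    have hd2 : d / 2 < L.length := by omega
    refine ⟨(⟨L[d / 2], List.getElem_mem hd2⟩, d % 2 = 1), Subtype.ext ?_⟩
    have : 2 * (d / 2) + (decide (d % 2 = 1)).toNat = d := by
      rcases Nat.mod_two_eq_zero_or_one d with h | h <;> simp [h] <;> omega
    simp only [F, h1.idxOf_getElem, this]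
    rw [List.getD_eq_getElem _ _ hd]

/-! ### Isotopy and unknotting sequences. -/

namespace KnotDiagram

theorem ext_visits {D E : KnotDiagram} (h : D.visits = E.visits) : D = E := by
  cases D; cases E
  cases GaussCode.ext_visits h
  rfl

theorem Isotopic.refl (D : KnotDiagram) : D.Isotopic D := Relation.EqvGen.refl _

theorem Isotopic.trans {D E G : KnotDiagram} (h : D.Isotopic E) (h' : E.Isotopic G) :
    D.Isotopic G := Relation.EqvGen.trans _ _ _ h h'

theorem Isotopic.symm {D E : KnotDiagram} (h : D.Isotopic E) : E.Isotopic D :=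
  Relation.EqvGen.symm _ _ h

theorem Isotopic.of_move {D E : KnotDiagram} (h : ReidemeisterMove D.visits E.visits) :
    D.Isotopic E := Relation.EqvGen.rel _ _ h

theorem UnknotsIn.of_isotopic {D E : KnotDiagram} {n : ℕ} (h : D.Isotopic E)
    (hE : UnknotsIn n E) : UnknotsIn n D := by
  cases hE with
  | isotopy h' => exact .isotopy (h.trans h')
  | change c h' hc hn => exact .change c (h.trans h') hc hn

theorem unknottingNumber_le {D : KnotDiagram} {n : ℕ} (h : UnknotsIn n D) :
    D.unknottingNumber ≤ n := iInf₂_le n h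

theorem le_unknottingNumber {D : KnotDiagram} {n : ℕ} (h : ∀ m < n, ¬ UnknotsIn m D) :
    (n : ℕ∞) ≤ D.unknottingNumber :=
  le_iInf₂ fun m hm => by
    by_contra hlt
    exact h m (by exact_mod_cast not_le.1 hlt) hm

/-- The diagram with another base point. -/
theorem exists_rotate (D : KnotDiagram) {L : List Visit} (h : D.visits ~r L) :
    ∃ E : KnotDiagram, E.visits = L ∧ D.Isotopic E := by
  let C : GaussCode := ⟨L, h.nodup_iff.1 D.nodup,
    fun v hv => h.perm.mem_iff.1 (D.opp_mem v (h.perm.mem_iff.2 hv)),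
    fun v hv w hw => D.sign_eq v (h.perm.mem_iff.2 hv) w (h.perm.mem_iff.2 hw)⟩
  let E : KnotDiagram := ⟨C, GaussCode.planar_of_isRotated (C := D.toGaussCode) h D.planar⟩
  refine ⟨E, rfl, ?_⟩
  obtain ⟨n, hn, rfl⟩ := List.isRotated_iff_mod.1 h
  refine Isotopic.of_move ?_
  have := ReidemeisterMove.rotate (D.visits.take n) (D.visits.drop n)
  rw [List.take_append_drop, ← List.rotate_eq_drop_append_take hn] at this
  exact this

end KnotDiagram

/-! ### Verified execution of sequences of moves. -/

/-- Instructions for the transformation of a list of visits. Each one first rotates the list by the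
number `k`. -/
inductive DiagramOp where
  /-- remove the crossing of the first two visits by a first Reidemeister move -/
  | first (k : ℕ)
  /-- remove the crossings of the first two visits by a second Reidemeister move; `j` visits lie
  between the two pairs -/
  | second (k j : ℕ)
  /-- the inverse of a second Reidemeister move, which inserts `v`, `w` at the beginning and the
  opposite visits `j` visits later -/
  | unsecond (k j : ℕ) (v w : Visit) (b : Bool)
  /-- a third Reidemeister move, the first two visits being those of the upper strand; `i` and `j`
  visits lie between the three pairs -/
  | third (k i j : ℕ)
  /-- change the crossing named `c` -/
  | change (c : ℕ)

/-- The condition for a third Reidemeister move at the crossings of `u`, `v`, `w`. -/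
abbrev ThirdMoveCond (u v w : Visit) (a b c : Bool) : Prop :=
  u.upper = true ∧ v.upper = true ∧ w.upper = true ∧
    (u.fromRight == b) = (v.fromRight == c) ∧
    (u.opp.fromRight == a) = (w.fromRight == !c) ∧
    (v.opp.fromRight == !a) = (w.opp.fromRight == !b)

theorem visitPair_not (b : Bool) (v w : Visit) : visitPair (!b) v w = visitPair b w v := by
  cases b <;> rfl

namespace DiagramOp

/-- Whether there is a third Reidemeister move at the three pairs `x`, `y`, `z`, of which `x`
belongs to the upper and `y` to the middle strand. -/
def IsThird (x y z : Visit × Visit) : Prop :=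
  let a : Bool := x.1.crossing = y.1.crossing ∨ x.1.crossing = y.2.crossing
  let u := if a then x.1 else x.2
  let v := if a then x.2 else x.1
  let b : Bool := y.1 = u.opp
  let w := if b then y.2 else y.1
  let c : Bool := z.1 = v.opp
  ThirdMoveCond u v w a b c ∧ [y.1, y.2] = visitPair b u.opp w ∧
    [z.1, z.2] = visitPair c v.opp w.opp

instance (x y z : Visit × Visit) : Decidable (IsThird x y z) := by
  unfold IsThird; infer_instance

/-- The list of visits after an isotopy, if the instruction applies. -/
def apply : DiagramOp → List Visit → Option (List Visit)
  | first k, L => match L.rotate k with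
    | v :: w :: l => if w = v.opp then some l else none
    | _ => none
  | second k j, L => match L.rotate k with
    | v :: w :: r => match r.drop j with
      | x :: y :: m =>
        if v.upper = w.upper ∧ v.positive ≠ w.positive ∧
          [x, y] = visitPair (x = v.opp) v.opp w.opp then some (r.take j ++ m) else none
      | _ => none
    | _ => none
  | unsecond k j v w b, L =>
    if v.upper = w.upper ∧ v.positive ≠ w.positive then
      some ([v, w] ++ (L.rotate k).take j ++ visitPair b v.opp w.opp ++ (L.rotate k).drop j)
    else none
  | third k i j, L => match L.rotate k with
    | x :: x' :: r => match r.drop i with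
      | y :: y' :: r' => match r'.drop j with
        | z :: z' :: n =>
          if IsThird (x, x') (y, y') (z, z') ∨ IsThird (x, x') (z, z') (y, y') then
            some ([x', x] ++ r.take i ++ [y', y] ++ r'.take j ++ [z', z] ++ n)
          else none
        | _ => none
      | _ => none
    | _ => none
  | change _, _ => none

theorem visitPair_eq_swap {b : Bool} {v w x y : Visit} (h : [x, y] = visitPair b v w) :
    [y, x] = visitPair (!b) v w := by
  cases b <;> simp_all [visitPair]

/-- The pair on the upper strand needs no check: `u` and `v` are by construction its two visits,
sorted by the flag `a`. -/
theorem IsThird.exists_flags {x x' y y' z z' : Visit} (h : IsThird (x, x') (y, y') (z, z')) :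
    ∃ u v w a b c, ThirdMoveCond u v w a b c ∧ [x, x'] = visitPair a u v ∧
      [y, y'] = visitPair b u.opp w ∧ [z, z'] = visitPair c v.opp w.opp := by
  refine ⟨_, _, _, _, _, _, h.1, ?_, h.2⟩
  generalize decide ((x, x').1.crossing = (y, y').1.crossing ∨
    (x, x').1.crossing = (y, y').2.crossing) = a
  cases a <;> rfl

/-- After a rotation every instruction is a single move, read backwards in the case of `unsecond`. A
crossing change never yields a list here; `run` treats it separately. -/
theorem apply_spec {op : DiagramOp} {L L' : List Visit} (h : op.apply L = some L') :
    ∃ k, ReidemeisterMove (L.rotate k) L' ∨ ReidemeisterMove L' (L.rotate k) := by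
  cases op with
  | first k =>
    refine ⟨k, Or.inl ?_⟩
    simp only [apply] at h
    split at h
    · rename_i v w l e
      split_ifs at h with hw
      cases h
      rw [e, hw]
      exact .first v _
    · cases h
  | second k j =>
    refine ⟨k, Or.inl ?_⟩
    simp only [apply] at h
    split at h
    · rename_i v w r e
      split at h
      · rename_i x y m e'
        split_ifs at h with hc
        cases h
        have := ReidemeisterMove.second v w (x = v.opp) (r.take j) m hc.1 hc.2.1
        rw [← hc.2.2] at this
        rw [e]
        convert this using 1
        conv_lhs => rw [← List.take_append_drop j r, e']
        simp
      · cases h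
    · cases h
  | unsecond k j v w b =>
    refine ⟨k, Or.inr ?_⟩
    simp only [apply] at h
    split_ifs at h with hc
    cases h
    have := ReidemeisterMove.second v w b ((L.rotate k).take j) ((L.rotate k).drop j) hc.1 hc.2
    rwa [List.take_append_drop] at this
  | third k i j =>
    refine ⟨k, Or.inl ?_⟩
    simp only [apply] at h
    split at h
    · rename_i x x' r e
      split at h
      · rename_i y y' r' e'
        split at h
        · rename_i z z' n e''
          have er : L.rotate k =
              [x, x'] ++ r.take i ++ [y, y'] ++ r'.take j ++ [z, z'] ++ n := by
            rw [e]
            conv_lhs => rw [← List.take_append_drop i r, e', ← List.take_append_drop j r', e'']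
            simp
          rw [er]
          split_ifs at h with hc
          cases h
          rcases hc with hc | hc
          · obtain ⟨u, v, w, a, b, c, ⟨h1, h2, h3, h4, h5, h6⟩, hx, hy, hz⟩ := hc.exists_flags
            rw [hx, hy, hz, visitPair_eq_swap hx, visitPair_eq_swap hy, visitPair_eq_swap hz]
            exact .third u v w a b c _ _ _ h1 h2 h3 h4 h5 h6
          · obtain ⟨u, v, w, a, b, c, ⟨h1, h2, h3, h4, h5, h6⟩, hx, hz, hy⟩ := hc.exists_flags
            rw [hx, hy, hz, visitPair_eq_swap hx, visitPair_eq_swap hy, visitPair_eq_swap hz]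
            exact .third' u v w a b c _ _ _ h1 h2 h3 h4 h5 h6
        · cases h
      · cases h
    · cases h
  | change c => cases h

/-- Execute the instructions, check that all lists are diagrams, and count the crossing changes. -/
def run : List DiagramOp → List Visit → Option (List Visit × ℕ)
  | [], L => some (L, 0)
  | change c :: ops, L =>
    if ∃ v ∈ L, v.crossing = c then
      (run ops (L.map (Visit.exchangeAt c))).map fun x => (x.1, x.2 + 1)
    else none
  | op :: ops, L => match op.apply L with
    | some L' => if isDiagram L' then run ops L' else none
    | none => none

open KnotDiagram in
-- Isotopy is a relation between diagrams, so each new list must pass `isDiagram`. After a crossing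
-- change no test is needed, because the projection stays the same.
theorem unknotsIn_of_run {ops : List DiagramOp} {D : KnotDiagram} {n : ℕ}
    (h : run ops D.visits = some ([], n)) : UnknotsIn n D := by
  induction ops generalizing D n with
  | nil =>
    simp only [run, Option.some.injEq, Prod.mk.injEq] at h
    have : D = unknot := KnotDiagram.ext_visits h.1
    rw [← h.2, this]
    exact .isotopy (.refl _)
  | cons op ops ih =>
    -- The four isotopy instructions share one branch of `run`, so one argument serves them all.
    have main : ∀ hop : run (op :: ops) D.visits = (match op.apply D.visits with
        | some L' => if isDiagram L' then run ops L' else none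
        | none => none), UnknotsIn n D := by
      intro hop
      rw [hop] at h
      split at h
      · rename_i L' hL'
        split_ifs at h with hd
        obtain ⟨E, rfl⟩ := exists_knotDiagram_of_isDiagram hd
        obtain ⟨k, hk⟩ := apply_spec hL'
        obtain ⟨D', hD', hDD'⟩ := D.exists_rotate (L := D.visits.rotate k) ⟨k, rfl⟩
        rw [← hD'] at hk
        refine .of_isotopic (hDD'.trans ?_) (ih h)
        rcases hk with hk | hk
        · exact .of_move hk
        · exact (Isotopic.of_move hk).symm
      · cases h
    cases op with
    | change c =>
      simp only [run] at h
      split_ifs at h with hc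
      rw [Option.map_eq_some_iff] at h
      obtain ⟨⟨L', m⟩, h1, h2⟩ := h
      simp only [Prod.mk.injEq] at h2
      obtain ⟨rfl, rfl⟩ := h2
      exact .change c (.refl D) hc (ih (D := D.changeCrossing c) h1)
    | first k => exact main rfl
    | second k j => exact main rfl
    | unsecond k j v w b => exact main rfl
    | third k i j => exact main rfl

end DiagramOp

/-! ### Upper bounds from explicit sequences. -/

namespace KnotDiagram

theorem unknotsIn_trefoil : UnknotsIn 1 trefoil :=
  DiagramOp.unknotsIn_of_run (ops := [.change 0, .second 0 1, .first 0]) (by decide +kernel)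

/-- After the change at `5` the clasp of `5` and `6` opens. After the changes at `0` and `1` the
pairs `1`, `2` and `0`, `3` of the five-twist cancel. The crossings `4`, `7`, `8`, `9` that remain
are curls. -/
theorem unknotsIn_tenSix : UnknotsIn 3 tenSix :=
  DiagramOp.unknotsIn_of_run (ops := [
    .change 0, .change 1, .change 5, .second 5 8, .second 1 9, .second 8 1, .first 0, .first 5,
    .first 1, .first 0]) (by decide +kernel)

/-- In the sum the crossings of the trefoil are named `0`, `2`, `4` and those of `10_6` have odd
names. The changed crossings `6`, `8` and again `6` therefore belong to neither summand: inverse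
second moves have created them. -/
theorem unknotsIn_trefoil_connectedSum_tenSix : UnknotsIn 3 (trefoil.connectedSum tenSix) :=
  DiagramOp.unknotsIn_of_run (ops := [
    .unsecond 3 15 ⟨6, false, true⟩ ⟨8, false, false⟩ true, .change 6, .unsecond 12 17 ⟨10, false,
    false⟩ ⟨12, false, true⟩ true, .third 20 4 7, .third 0 5 7, .third 0 6 7, .third 0 7 7, .third
    0 8 7, .second 1 17, .unsecond 9 2 ⟨6, false, false⟩ ⟨12, false, true⟩ false, .third 3 11 17,
    .first 33, .third 11 0 16, .first 1, .third 26 4 3, .third 9 8 2, .third 26 4 18, .third 27 6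
    10, .unsecond 7 16 ⟨12, false, true⟩ ⟨14, false, false⟩ false, .third 17 16 9, .third 10 7 12,
    .change 8, .change 6, .third 13 11 12, .third 14 11 6, .third 22 11 10, .third 14 9 8, .third
    22 11 8, .second 14 6, .third 16 11 4, .third 21 8 11, .second 22 5, .third 16 2 5, .second 10
    13, .third 0 4 9, .third 5 6 1, .third 9 0 8, .first 1, .third 5 5 7, .third 19 8 6, .second 1
    6, .first 14, .second 6 5, .second 4 3, .first 5, .first 1, .first 0]) (by decide +kernel)

end KnotDiagram

/-! ### Mirror images. -/

theorem visitPair_map (g : Visit → Visit) (b : Bool) (v w : Visit) :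
    (visitPair b v w).map g = visitPair b (g v) (g w) := by
  cases b <;> rfl

@[simp] theorem Visit.exchange_exchange (v : Visit) : v.exchange.exchange = v := by
  cases v; simp [Visit.exchange]

theorem Visit.exchange_exchangeAt (c : ℕ) (v : Visit) :
    (v.exchangeAt c).exchange = v.exchange.exchangeAt c := by
  unfold Visit.exchangeAt
  split_ifs <;> simp_all [Visit.exchange]

@[simp] theorem Visit.opp_opp (v : Visit) : v.opp.opp = v := by
  cases v; simp [Visit.opp]

/-- The mirror image of a Reidemeister move is one, up to a change of the base points. -/
theorem ReidemeisterMove.exists_map_exchange {L M : List Visit} (h : ReidemeisterMove L M) :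
    ∃ L' M', L.map Visit.exchange ~r L' ∧ M.map Visit.exchange ~r M' ∧
      ReidemeisterMove L' M' := by
  have hf := Visit.compatible_exchange.fromRight
  have hg := Visit.compatible_exchange.opp
  cases h with
  | rotate l m =>
    exact ⟨_, _, .refl _, .refl _, by simpa using .rotate (l.map Visit.exchange) (m.map _)⟩
  | relabel f hf =>
    refine ⟨_, _, .refl _, .refl _, ?_⟩
    have := ReidemeisterMove.relabel f hf (L.map Visit.exchange)
    rw [List.map_map] at this ⊢
    exact this
  | first v l => exact ⟨_, _, .refl _, .refl _, .first v.exchange (M.map Visit.exchange)⟩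
  | second v w b l m h1 h2 =>
    refine ⟨_, _, .refl _, .refl _, ?_⟩
    have := ReidemeisterMove.second v.exchange w.exchange b (l.map Visit.exchange)
      (m.map Visit.exchange) (by simp [Visit.exchange, h1]) (by simpa [Visit.exchange] using h2)
    simp only [List.map_append, visitPair_map]
    exact this
  | third u v w a b c l m n hu hv hw h1 h2 h3 =>
    -- In the mirror image the lower strand becomes the upper one, so the crossings of `u` and `w`
    -- change roles. Since a third move is written with the upper pair first, the base point has to
    -- move, and the cyclic order of the middle and the lower strand is reversed.
    have := ReidemeisterMove.third' w.opp.exchange v.opp.exchange u.opp.exchange (!c) (!b) (!a)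
      (n.map Visit.exchange) (l.map Visit.exchange) (m.map Visit.exchange)
      (by simp [Visit.exchange, Visit.opp, hw]) (by simp [Visit.exchange, Visit.opp, hv])
      (by simp [Visit.exchange, Visit.opp, hu]) (by rw [hf, hf, h3])
      (by rw [← hg, hf, hf, Bool.not_not, h2, Visit.opp_opp])
      (by rw [← hg, ← hg, hf, hf, Bool.not_not, Bool.not_not, Visit.opp_opp, Visit.opp_opp, h1])
    refine ⟨_, _, ?_, ?_, this⟩ <;>
    · simp only [List.map_append, visitPair_map, visitPair_not, Bool.not_not, Visit.opp_opp,
        ← hg, List.append_assoc]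
      simpa only [List.append_assoc] using List.isRotated_append (l := _ ++ _ ++ _ ++ _) (l' := _ ++ _)
  | third' u v w a b c l m n hu hv hw h1 h2 h3 =>
    have := ReidemeisterMove.third w.opp.exchange v.opp.exchange u.opp.exchange (!c) (!b) (!a)
      (m.map Visit.exchange) (n.map Visit.exchange) (l.map Visit.exchange)
      (by simp [Visit.exchange, Visit.opp, hw]) (by simp [Visit.exchange, Visit.opp, hv])
      (by simp [Visit.exchange, Visit.opp, hu]) (by rw [hf, hf, h3])
      (by rw [← hg, hf, hf, Bool.not_not, h2, Visit.opp_opp])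
      (by rw [← hg, ← hg, hf, hf, Bool.not_not, Bool.not_not, Visit.opp_opp, Visit.opp_opp, h1])
    refine ⟨_, _, ?_, ?_, this⟩ <;>
    · simp only [List.map_append, visitPair_map, visitPair_not, Bool.not_not, Visit.opp_opp,
        ← hg, List.append_assoc]
      simpa only [List.append_assoc] using List.isRotated_append (l := _ ++ _) (l' := _ ++ _ ++ _ ++ _)

namespace KnotDiagram

theorem mirror_mirror (D : KnotDiagram) : D.mirror.mirror = D :=
  ext_visits (by simp [mirror, map, GaussCode.map, Function.comp_def])

theorem Isotopic.mirror {D E : KnotDiagram} (h : D.Isotopic E) : D.mirror.Isotopic E.mirror := by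
  induction h with
  | rel D E h =>
    obtain ⟨L, M, hL, hM, h⟩ := h.exists_map_exchange
    obtain ⟨D', rfl, hD⟩ := exists_rotate (D := D.mirror) hL
    obtain ⟨E', rfl, hE⟩ := exists_rotate (D := E.mirror) hM
    exact hD.trans ((Isotopic.of_move h).trans hE.symm)
  | refl D => exact .refl _
  | symm D E _ ih => exact ih.symm
  | trans D E G _ _ ih ih' => exact ih.trans ih'

theorem UnknotsIn.mirror {D : KnotDiagram} {n : ℕ} (h : UnknotsIn n D) : UnknotsIn n D.mirror := by
  induction h with
  | isotopy h =>
    refine .isotopy (h.mirror.trans ?_)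
    rw [show unknot.mirror = unknot from rfl]
    exact .refl _
  | @change n D E c h hc hn ih =>
    refine .change c h.mirror ?_ ?_
    · obtain ⟨v, hv, hvc⟩ := hc
      exact ⟨v.exchange, List.mem_map_of_mem hv, hvc⟩
    · have : E.mirror.changeCrossing c = (E.changeCrossing c).mirror :=
        ext_visits (by simp [KnotDiagram.mirror, changeCrossing, map, GaussCode.map,
          Visit.exchange_exchangeAt])
      rwa [this]

theorem unknotsIn_mirror_iff {D : KnotDiagram} {n : ℕ} : UnknotsIn n D.mirror ↔ UnknotsIn n D :=
  ⟨fun h => by simpa only [mirror_mirror] using h.mirror, UnknotsIn.mirror⟩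

theorem unknottingNumber_mirror (D : KnotDiagram) :
    D.mirror.unknottingNumber = D.unknottingNumber := by
  simp only [unknottingNumber, unknotsIn_mirror_iff]

/-- Mirroring acts on each visit alone and commutes with renaming and concatenation. -/
theorem connectedSum_mirror (D E : KnotDiagram) :
    D.mirror.connectedSum E.mirror = (D.connectedSum E).mirror :=
  ext_visits (by simp [mirror, connectedSum, relabel, map, GaussCode.map, GaussCode.append,
    Function.comp_def, Visit.relabel, Visit.exchange])

end KnotDiagram

/-! ### Signatures of quadratic forms on subspaces of arbitrary dimension. -/

section Signature

variable {A B : Type*} [AddCommGroup A] [Module ℝ A] [AddCommGroup B] [Module ℝ B]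

/-- A weighted sum of squares of finitely many linear forms. -/
def IsWeightedSumSq (Q : A → ℝ) : Prop :=
  ∃ (ι : Type) (_ : Fintype ι) (c : ι → ℝ) (α : ι → A →ₗ[ℝ] ℝ), ∀ x, Q x = ∑ i, c i * α i x ^ 2

theorem IsWeightedSumSq.zero : IsWeightedSumSq fun _ : A => 0 :=
  ⟨Empty, inferInstance, 0, 0, by simp⟩

theorem IsWeightedSumSq.smul_sq (c : ℝ) (α : A →ₗ[ℝ] ℝ) : IsWeightedSumSq fun x => c * α x ^ 2 :=
  ⟨Unit, inferInstance, fun _ => c, fun _ => α, by simp⟩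

theorem IsWeightedSumSq.add {Q R : A → ℝ} (hQ : IsWeightedSumSq Q) (hR : IsWeightedSumSq R) :
    IsWeightedSumSq fun x => Q x + R x := by
  obtain ⟨ι, _, c, α, h⟩ := hQ
  obtain ⟨κ, _, d, β, h'⟩ := hR
  exact ⟨ι ⊕ κ, inferInstance, Sum.elim c d, Sum.elim α β, fun x => by simp [h, h']⟩

/-- The function `Q` is a quadratic form of signature `σ` on the subspace `V`: it has a diagonal form
in which the difference of the numbers of positive and negative squares is `σ`. -/
def HasSig (V : Submodule ℝ A) (Q : A → ℝ) (σ : ℤ) : Prop :=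
  ∃ (ι : Type) (_ : Fintype ι) (d : ι → ℝ) (φ : ι → A →ₗ[ℝ] ℝ), (∀ i, d i ≠ 0) ∧
    (∀ y : ι → ℝ, ∃ x ∈ V, ∀ i, φ i x = y i) ∧ (∀ x ∈ V, Q x = ∑ i, d i * φ i x ^ 2) ∧
    ∑ i, (SignType.sign (d i) : ℤ) = σ

/-- The negative coefficients are counted as the positive ones of `-d`, so that a bound for positive
indices also serves for negative ones. -/
theorem sum_sign {ι : Type} [Fintype ι] (d : ι → ℝ) :
    ∑ i, (SignType.sign (d i) : ℤ) = (Fintype.card {i // 0 < d i} : ℤ) -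
      Fintype.card {i // 0 < -d i} := by
  classical
  simp only [Fintype.card_subtype, Finset.card_filter, Nat.cast_sum, ← Finset.sum_sub_distrib]
  refine Finset.sum_congr rfl fun i _ => ?_
  rcases lt_trichotomy (d i) 0 with h | h | h
  · simp [h, h.not_gt]
  · simp [h]
  · simp [h, h.not_gt]

/-- A form with `p` positive squares which is, on the kernel of some linear forms, bounded by the
pullback of one with `q` positive squares. -/
theorem card_pos_le {ι κ μ : Type} [Fintype ι] [Fintype κ] [Fintype μ] {V : Submodule ℝ A}
    {d : ι → ℝ} {φ : ι → A →ₗ[ℝ] ℝ} (hφ : ∀ y : ι → ℝ, ∃ x ∈ V, ∀ i, φ i x = y i)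
    {e : κ → ℝ} {χ : κ → B →ₗ[ℝ] ℝ} (f : A →ₗ[ℝ] B) (ψ : μ → A →ₗ[ℝ] ℝ)
    (h : ∀ x ∈ V, (∀ j, ψ j x = 0) → ∑ i, d i * φ i x ^ 2 ≤ ∑ i, e i * χ i (f x) ^ 2) :
    Fintype.card {i // 0 < d i} ≤ Fintype.card {i // 0 < e i} + Fintype.card μ := by
  classical
  choose x hx hφx using hφ
  -- The image of `g` is spanned by vectors dual to the forms with positive coefficients; the first
  -- form is positive definite there.
  let g : ({i // 0 < d i} → ℝ) →ₗ[ℝ] A :=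
    Fintype.linearCombination ℝ fun i : {i // 0 < d i} => x (Pi.single i.1 1)
  have hgV : ∀ t, g t ∈ V := fun t => by
    simp only [g, Fintype.linearCombination_apply]
    exact V.sum_mem fun i _ => V.smul_mem _ (hx _)
  have hg : ∀ t j, φ j (g t) = if hj : 0 < d j then t ⟨j, hj⟩ else 0 := by
    intro t j
    simp only [g, Fintype.linearCombination_apply, map_sum, map_smul, hφx, smul_eq_mul,
      Pi.single_apply, mul_ite, mul_one, mul_zero]
    split_ifs with hj
    · rw [Finset.sum_eq_single ⟨j, hj⟩]
      · simp
      · intro b _ hb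
        rw [if_neg]
        rintro rfl
        exact hb rfl
      · simp
    · refine Finset.sum_eq_zero fun i _ => ?_
      rw [if_neg]
      rintro rfl
      exact hj i.2
  -- Where all coordinates of `k` vanish, the second form is at most zero and bounds the first one
  -- from above. Definiteness then makes `k` injective, and dimensions can be compared.
  let k : ({i // 0 < d i} → ℝ) →ₗ[ℝ] ({i // 0 < e i} → ℝ) × (μ → ℝ) :=
    ((LinearMap.pi fun i : {i // 0 < e i} => (χ i.1).comp f).prod (LinearMap.pi ψ)).comp g
  have hk : Function.Injective k := by
    rw [injective_iff_map_eq_zero]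
    intro t ht
    have h1 : ∀ i, 0 < e i → χ i (f (g t)) = 0 := fun i hi =>
      congrFun (congrArg Prod.fst ht) ⟨i, hi⟩
    have h2 : ∀ j, ψ j (g t) = 0 := fun j => congrFun (congrArg Prod.snd ht) j
    have h3 := h (g t) (hgV t) h2
    have h4 : ∑ i, e i * χ i (f (g t)) ^ 2 ≤ 0 := by
      refine Finset.sum_nonpos fun i _ => ?_
      by_cases hi : 0 < e i
      · simp [h1 i hi]
      · exact mul_nonpos_of_nonpos_of_nonneg (not_lt.1 hi) (sq_nonneg _)
    have h5 : ∀ i ∈ Finset.univ, 0 ≤ d i * φ i (g t) ^ 2 := by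
      intro i _
      rw [hg]
      split_ifs with hi
      · exact mul_nonneg hi.le (sq_nonneg _)
      · simp
    have h6 := (Finset.sum_eq_zero_iff_of_nonneg h5).1 (le_antisymm (h3.trans h4)
      (Finset.sum_nonneg h5))
    funext i
    have := h6 i.1 (Finset.mem_univ _)
    rw [hg, dif_pos i.2] at this
    simpa [i.2.ne'] using this
  have := LinearMap.finrank_le_finrank_of_injective hk
  simpa using this

/-- The map `f` bounds the positive index of `Q` by that of `R` up to the number of forms `ψ`. The
map `g`, applied to the negated forms, bounds the negative index of `R` by that of `Q` up to the
number of forms `χ`. The difference of the two bounds is the claim. -/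
theorem HasSig.le_add {V : Submodule ℝ A} {W : Submodule ℝ B} {Q : A → ℝ} {R : B → ℝ} {σ τ : ℤ}
    (hQ : HasSig V Q σ) (hR : HasSig W R τ) {μ ν : Type} [Fintype μ] [Fintype ν]
    (f : A →ₗ[ℝ] B) (ψ : μ → A →ₗ[ℝ] ℝ)
    (hf : ∀ x ∈ V, (∀ j, ψ j x = 0) → f x ∈ W ∧ Q x ≤ R (f x))
    (g : B →ₗ[ℝ] A) (χ : ν → B →ₗ[ℝ] ℝ)
    (hg : ∀ x ∈ W, (∀ j, χ j x = 0) → g x ∈ V ∧ Q (g x) ≤ R x) :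
    σ ≤ τ + Fintype.card μ + Fintype.card ν := by
  obtain ⟨ι, _, d, φ, -, h1, h2, rfl⟩ := hQ
  obtain ⟨κ, _, e, ξ, -, h3, h4, rfl⟩ := hR
  have k1 := card_pos_le (d := d) (e := e) (χ := ξ) h1 f ψ fun x hx hx' => by
    obtain ⟨a, b⟩ := hf x hx hx'
    rwa [h2 x hx, h4 _ a] at b
  have k2 := card_pos_le (d := fun i => - e i) (e := fun i => - d i) (χ := φ) h3 g χ
    fun x hx hx' => by
      obtain ⟨a, b⟩ := hg x hx hx'
      rw [h2 _ a, h4 _ hx] at b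
      simpa [Finset.sum_neg_distrib] using b
  rw [sum_sign, sum_sign]
  omega

/-- Maps in both directions that preserve the forms, which need not be injective. -/
theorem HasSig.eq_of_isometry {V : Submodule ℝ A} {W : Submodule ℝ B} {Q : A → ℝ} {R : B → ℝ}
    {σ τ : ℤ} (hQ : HasSig V Q σ) (hR : HasSig W R τ)
    (f : A →ₗ[ℝ] B) (hf : ∀ x ∈ V, f x ∈ W ∧ R (f x) = Q x)
    (g : B →ₗ[ℝ] A) (hg : ∀ x ∈ W, g x ∈ V ∧ Q (g x) = R x) : σ = τ := by
  have h1 := hQ.le_add hR (μ := Empty) (ν := Empty) f nofun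
    (fun x hx _ => ⟨(hf x hx).1, (hf x hx).2.ge⟩)
    g nofun (fun x hx _ => ⟨(hg x hx).1, (hg x hx).2.le⟩)
  have h2 := hR.le_add hQ (μ := Empty) (ν := Empty) g nofun
    (fun x hx _ => ⟨(hg x hx).1, (hg x hx).2.ge⟩)
    f nofun (fun x hx _ => ⟨(hf x hx).1, (hf x hx).2.le⟩)
  simp at h1 h2
  omega

theorem HasSig.unique {V : Submodule ℝ A} {Q : A → ℝ} {σ τ : ℤ} (h : HasSig V Q σ)
    (h' : HasSig V Q τ) : σ = τ :=
  h.eq_of_isometry h' .id (fun _ hx => ⟨hx, rfl⟩) .id (fun _ hx => ⟨hx, rfl⟩)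

/-- The form factors through the finite-dimensional range of its linear forms, where Sylvester's
theorem applies. The space of labels is infinite-dimensional, since labels at absent crossings are
arbitrary; they lie in the radical. -/
theorem IsWeightedSumSq.exists_hasSig {Q : A → ℝ} (hQ : IsWeightedSumSq Q) (V : Submodule ℝ A) :
    ∃ σ, HasSig V Q σ := by
  obtain ⟨κ, _, c, α, hQ⟩ := hQ
  let F : V →ₗ[ℝ] (κ → ℝ) := (LinearMap.pi α).comp V.subtype
  let q : QuadraticForm ℝ (LinearMap.range F) :=
    (QuadraticMap.weightedSumSquares ℝ c).comp (LinearMap.range F).subtype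
  obtain ⟨w, ⟨e⟩⟩ := QuadraticForm.equivalent_signType_weighted_sum_squared q
  -- The diagonalising forms live on `V`, whereas `HasSig` asks for forms on all of `A`.
  have hext : ∀ i, ∃ φ : A →ₗ[ℝ] ℝ, φ.comp V.subtype =
      ((LinearMap.proj i).comp e.toLinearEquiv.toLinearMap).comp F.rangeRestrict :=
    fun i => LinearMap.exists_extend _
  choose φ hφ using hext
  have hφ' : ∀ i (x : V), φ i x = e (F.rangeRestrict x) i := fun i x => LinearMap.congr_fun (hφ i) x
  refine ⟨_, {i // w i ≠ 0}, inferInstance, fun i => (w i.1 : ℝ), fun i => φ i.1, ?_, ?_, ?_, rfl⟩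
  · rintro ⟨i, hi⟩
    cases hw : w i <;> simp_all
  · intro y
    obtain ⟨x, hx⟩ := F.surjective_rangeRestrict
      (e.symm fun i => if hi : w i ≠ 0 then y ⟨i, hi⟩ else 0)
    refine ⟨x, x.2, fun i => ?_⟩
    rw [hφ', hx]
    have := congrFun (e.apply_symm_apply fun i => if hi : w i ≠ 0 then y ⟨i, hi⟩ else 0) i.1
    simpa [i.2] using this
  · intro x hx
    have h1 := e.map_app (F.rangeRestrict ⟨x, hx⟩)
    have h2 : q (F.rangeRestrict ⟨x, hx⟩) = Q x := by
      rw [hQ]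
      simp [q, QuadraticMap.weightedSumSquares_apply, F, sq]
    rw [← h2, ← h1, QuadraticMap.weightedSumSquares_apply]
    classical
    rw [← Fintype.sum_subtype_add_sum_subtype (fun i => w i ≠ 0)]
    have h3 : ∀ i : {i // ¬ w i ≠ 0}, w i.1 = 0 := fun i => not_not.1 i.2
    have h4 : ∀ i, φ i x = e (F.rangeRestrict ⟨x, hx⟩) i := fun i => hφ' i ⟨x, hx⟩
    simp [h3, h4, sq]

/-- The joint surjectivity in `hs` makes `α` independent of the forms pulled back along `f`, so
exactly one square is added. -/
theorem HasSig.add_sq {V : Submodule ℝ A} {W : Submodule ℝ B} {Q : A → ℝ} {R : B → ℝ} {σ : ℤ}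
    (hR : HasSig W R σ) {c : ℝ} (hc : c ≠ 0) (f : A →ₗ[ℝ] B) (α : A →ₗ[ℝ] ℝ)
    (hs : ∀ y ∈ W, ∀ t, ∃ x ∈ V, f x = y ∧ α x = t)
    (hQ : ∀ x ∈ V, f x ∈ W ∧ Q x = R (f x) + c * α x ^ 2) :
    HasSig V Q (σ + (SignType.sign c : ℤ)) := by
  obtain ⟨ι, _, d, φ, h1, h2, h3, rfl⟩ := hR
  refine ⟨Option ι, inferInstance, fun i => i.elim c d, fun i => i.elim α fun j => (φ j).comp f,
    ?_, ?_, ?_, ?_⟩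
  · rintro (_ | i)
    exacts [hc, h1 i]
  · intro y
    obtain ⟨b, hb, hby⟩ := h2 fun i => y (some i)
    obtain ⟨x, hx, hxb, hxt⟩ := hs b hb (y none)
    refine ⟨x, hx, ?_⟩
    rintro (_ | i)
    · exact hxt
    · simpa [hxb] using hby i
  · intro x hx
    rw [(hQ x hx).2, h3 _ (hQ x hx).1, Fintype.sum_option]
    simp [add_comm]
  · rw [Fintype.sum_option, add_comm]
    rfl

theorem HasSig.of_surjective {V : Submodule ℝ A} {W : Submodule ℝ B} {Q : A → ℝ} {R : B → ℝ}
    {σ : ℤ} (hR : HasSig W R σ) (f : A →ₗ[ℝ] B) (hs : ∀ y ∈ W, ∃ x ∈ V, f x = y)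
    (hQ : ∀ x ∈ V, f x ∈ W ∧ Q x = R (f x)) : HasSig V Q σ := by
  obtain ⟨ι, _, d, φ, h1, h2, h3, rfl⟩ := hR
  refine ⟨ι, inferInstance, d, fun j => (φ j).comp f, h1, ?_, ?_, rfl⟩
  · intro y
    obtain ⟨b, hb, hby⟩ := h2 y
    obtain ⟨x, hx, rfl⟩ := hs b hb
    exact ⟨x, hx, hby⟩
  · intro x hx
    rw [(hQ x hx).2, h3 _ (hQ x hx).1]
    rfl

/-- Adding a product `l * α` of linear forms, where `α` is independent of all other ones, has the
same effect as restricting to the kernel of `l`. -/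
theorem HasSig.add_mul {V : Submodule ℝ A} {Q R : A → ℝ} {σ : ℤ} {l α : A →ₗ[ℝ] ℝ}
    (h : HasSig (V ⊓ LinearMap.ker l) R σ) (hR : IsWeightedSumSq R)
    (hQ : ∀ x ∈ V, Q x = R x + l x * α x) {z : A} (hzV : z ∈ V) (hzl : l z = 0) (hzα : α z ≠ 0)
    (hzR : ∀ x, R (x + z) = R x) : HasSig V Q σ := by
  by_cases hl : ∀ x ∈ V, l x = 0
  · exact h.of_surjective .id (fun y hy => ⟨y, hy.1, rfl⟩)
      fun x hx => ⟨⟨hx, hl x hx⟩, by rw [hQ x hx, hl x hx]; simp⟩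
  push Not at hl
  obtain ⟨v, hv, hlv⟩ := hl
  obtain ⟨v, hv, hlv⟩ : ∃ v ∈ V, l v = 1 :=
    ⟨(l v)⁻¹ • v, V.smul_mem _ hv, by simp [hlv]⟩
  obtain ⟨κ, _, c, ρ, hρ⟩ := hR
  obtain ⟨ι, _, d, φ, h1, h2, h3, rfl⟩ := h
  -- Invariance under translation by `z` puts `z` into the radical of `R`: first its own value
  -- vanishes, then its pairing with every vector.
  have hz0 : ∑ i, c i * ρ i z ^ 2 = 0 := by
    have := hzR 0
    simpa [hρ] using this
  have hzρ : ∀ x, ∑ i, c i * ρ i x * ρ i z = 0 := by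
    intro x
    have := hzR x
    simp only [hρ, map_add] at this
    have e : ∀ i, c i * (ρ i x + ρ i z) ^ 2 = c i * ρ i x ^ 2 + 2 * (c i * ρ i x * ρ i z) +
        c i * ρ i z ^ 2 := fun i => by ring
    simp only [e, Finset.sum_add_distrib, hz0, ← Finset.mul_sum] at this
    linarith
  -- With `x` chosen such that `φ i x = d i * φ i z`, the mixed term in the expansion of `R (x + z)`
  -- is a sum of squares and must vanish.
  have hzφ : ∀ i, φ i z = 0 := by
    intro j
    have hz' : z ∈ V ⊓ LinearMap.ker l := ⟨hzV, hzl⟩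
    obtain ⟨x, hx, hxy⟩ := h2 fun i => d i * φ i z
    have e0 : ∑ i, d i * φ i z ^ 2 = 0 := by rw [← h3 z hz', hρ, hz0]
    have e1 := hzR x
    rw [h3 _ (add_mem hx hz'), h3 _ hx] at e1
    simp only [map_add, hxy] at e1
    have e : ∀ i, d i * (d i * φ i z + φ i z) ^ 2 = d i * (d i * φ i z) ^ 2 +
        2 * (d i * φ i z) ^ 2 + d i * φ i z ^ 2 := fun i => by ring
    simp only [e, Finset.sum_add_distrib, e0, ← Finset.mul_sum] at e1
    have e2 : ∑ i, (d i * φ i z) ^ 2 = 0 := by linarith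
    have := (Finset.sum_eq_zero_iff_of_nonneg fun i _ => sq_nonneg (d i * φ i z)).1 e2 j
      (Finset.mem_univ j)
    simpa [h1 j] using this
  -- The projection to the kernel of `l` along `v`. In the expansion of `R` around `P x`, all
  -- further terms are divisible by `l` and are absorbed into `β`.
  let P : A →ₗ[ℝ] A := LinearMap.id - l.smulRight v
  have hP : ∀ x, P x = x - l x • v := fun x => rfl
  have hPV : ∀ x ∈ V, P x ∈ V ⊓ LinearMap.ker l := fun x hx =>
    ⟨V.sub_mem hx (V.smul_mem _ hv), by simp [hP, hlv]⟩
  let β : A →ₗ[ℝ] ℝ := (2 : ℝ) • (∑ i, (c i * ρ i v) • (ρ i).comp P) + (R v) • l + α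
  have hβ : ∀ x, β x = 2 * ∑ i, c i * ρ i v * ρ i (P x) + R v * l x + α x := fun x => by
    simp [β, mul_assoc]
  have hQ' : ∀ x ∈ V, Q x = R (P x) + l x * β x := by
    intro x hx
    have hx' : x = P x + l x • v := by simp [hP]
    have : R x = R (P x) + 2 * l x * (∑ i, c i * ρ i v * ρ i (P x)) + l x ^ 2 * R v := by
      conv_lhs => rw [hx', hρ]
      rw [hρ, hρ v, Finset.mul_sum, Finset.mul_sum, ← Finset.sum_add_distrib,
        ← Finset.sum_add_distrib]
      refine Finset.sum_congr rfl fun i _ => ?_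
      simp only [map_add, map_smul, smul_eq_mul]
      ring
    rw [hQ x hx, this, hβ]
    ring
  -- The product `l * β` is the square of `(l + β) / 2` minus the square of `(l - β) / 2`, a
  -- hyperbolic plane, which does not contribute to the signature.
  refine ⟨ι ⊕ Bool, inferInstance, Sum.elim d fun b => if b then 1 else -1,
    Sum.elim (fun i => (φ i).comp P) fun b => (2⁻¹ : ℝ) • (l + if b then β else -β), ?_, ?_, ?_, ?_⟩
  · rintro (i | _ | _)
    exacts [h1 i, by simp, by simp]
  · intro y
    obtain ⟨u, hu, huy⟩ := h2 fun i => y (.inl i)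
    have hu0 : l u = 0 := hu.2
    have hPz : P z = z := by simp [hP, hzl]
    have hβz : β z = α z := by simp [hβ, hPz, hzl, hzρ]
    let a := y (.inr true)
    let b := y (.inr false)
    -- The prescribed values `a`, `b` of the two new forms require `l = a + b` and `β = a - b`. The
    -- multiple of `v` achieves the former; a multiple of `z` then corrects `β` without disturbing
    -- anything else.
    let w := u + (a + b) • v
    have hlw : l w = a + b := by simp [w, hu0, hlv]
    refine ⟨w + ((a - b - β w) / α z) • z, add_mem (add_mem hu.1 (V.smul_mem _ hv))
      (V.smul_mem _ hzV), ?_⟩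
    have hPw : P w = u := by rw [hP, hlw]; simp [w]
    rintro (i | _ | _)
    · simp [hPw, hPz, hzφ, huy]
    · simp only [Sum.elim_inr, Bool.false_eq_true, if_false, LinearMap.smul_apply,
        LinearMap.add_apply, LinearMap.neg_apply, map_add, map_smul, hlw, hzl, hβz, smul_eq_mul]
      field_simp
      simp only [b]
      ring
    · simp only [Sum.elim_inr, if_true, LinearMap.smul_apply,
        LinearMap.add_apply, map_add, map_smul, hlw, hzl, hβz, smul_eq_mul]
      field_simp
      simp only [a]
      ring
  · intro x hx
    rw [hQ' x hx, h3 _ (hPV x hx)]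
    simp
    ring
  · simp

end Signature

/-! ### Labellings of the regions and the region form. -/

/-- Labels of the four regions around a crossing, in the order back left, back right, front left,
front right, as seen along the strand to which the other one comes from the right. -/
abbrev Corners : Type := (ℝ × ℝ) × (ℝ × ℝ)

namespace Corners

/-- The labels to the left and to the right of the edge that arrives at the crossing along the strand
to which the other one comes from the right (if `b` is true), or along the other strand. -/
def source (b : Bool) (x : Corners) : ℝ × ℝ := if b then x.1 else (x.1.2, x.2.2)

/-- The labels to the left and to the right of the edge that leaves the crossing. -/
def target (b : Bool) (x : Corners) : ℝ × ℝ := if b then x.2 else (x.1.1, x.2.1)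

/-- The quadratic form that a positive crossing contributes. -/
def form (x : Corners) : ℝ := (x.2.1 - x.1.2) ^ 2 - (x.2.2 - x.1.1) ^ 2

theorem source_add (b : Bool) (x y : Corners) : source b (x + y) = source b x + source b y := by
  cases b <;> rfl

theorem source_smul (b : Bool) (r : ℝ) (x : Corners) : source b (r • x) = r • source b x := by
  cases b <;> rfl

theorem target_add (b : Bool) (x y : Corners) : target b (x + y) = target b x + target b y := by
  cases b <;> rfl

theorem target_smul (b : Bool) (r : ℝ) (x : Corners) : target b (r • x) = r • target b x := by
  cases b <;> rfl

end Corners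

/-- Labels of the regions around all crossings. -/
abbrev Labels : Type := ℕ → Corners

/-- The labels along the edge after a list of visits that starts with an edge labelled `e`. -/
def endLabels (s : Labels) : List Visit → ℝ × ℝ → ℝ × ℝ
  | [], e => e
  | v :: L, _ => endLabels s L ((s v.crossing).target v.fromRight)

/-- Whether the labels agree along the edges of a list of visits that starts with an edge labelled
`e`. -/
def Agree (s : Labels) : List Visit → ℝ × ℝ → Prop
  | [], _ => True
  | v :: L, e => (s v.crossing).source v.fromRight = e ∧
      Agree s L ((s v.crossing).target v.fromRight)

/-- The sign of a visit. -/
def Visit.sign (v : Visit) : ℤ := if v.positive then 1 else -1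

/-- The sum of a function over the crossings, with the signs of the crossings. -/
def crossingSum {R : Type*} [Ring R] (f : ℕ → R) (L : List Visit) : R :=
  (L.map fun v => if v.fromRight then v.sign * f v.crossing else 0).sum

section Lists

variable {s s' : Labels} {L M : List Visit} {e : ℝ × ℝ}

theorem endLabels_append (e : ℝ × ℝ) :
    endLabels s (L ++ M) e = endLabels s M (endLabels s L e) := by
  induction L generalizing e with
  | nil => rfl
  | cons v L ih => exact ih _

theorem agree_append (e : ℝ × ℝ) :
    Agree s (L ++ M) e ↔ Agree s L e ∧ Agree s M (endLabels s L e) := by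
  induction L generalizing e with
  | nil => simp [Agree, endLabels]
  | cons v L ih => simp [Agree, endLabels, ih, and_assoc]

theorem endLabels_congr (h : ∀ v ∈ L, s v.crossing = s' v.crossing) :
    endLabels s L e = endLabels s' L e := by
  induction L generalizing e with
  | nil => rfl
  | cons v L ih =>
    simp only [List.mem_cons, forall_eq_or_imp] at h
    simp only [endLabels, h.1, ih h.2]

theorem agree_congr (h : ∀ v ∈ L, s v.crossing = s' v.crossing) : Agree s L e ↔ Agree s' L e := by
  induction L generalizing e with
  | nil => rfl
  | cons v L ih =>
    simp only [List.mem_cons, forall_eq_or_imp] at h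
    simp only [Agree, h.1, ih h.2]

theorem endLabels_add (e e' : ℝ × ℝ) :
    endLabels (s + s') L (e + e') = endLabels s L e + endLabels s' L e' := by
  induction L generalizing e e' with
  | nil => rfl
  | cons v L ih => simp only [endLabels, Pi.add_apply, Corners.target_add, ih]

theorem endLabels_smul (r : ℝ) (e : ℝ × ℝ) :
    endLabels (r • s) L (r • e) = r • endLabels s L e := by
  induction L generalizing e with
  | nil => rfl
  | cons v L ih => simp only [endLabels, Pi.smul_apply, Corners.target_smul, ih]

theorem Agree.add {e e' : ℝ × ℝ} (h : Agree s L e) (h' : Agree s' L e') :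
    Agree (s + s') L (e + e') := by
  induction L generalizing e e' with
  | nil => trivial
  | cons v L ih =>
    exact ⟨by rw [Pi.add_apply, Corners.source_add, h.1, h'.1],
      by rw [Pi.add_apply, Corners.target_add]; exact ih h.2 h'.2⟩

theorem Agree.smul (r : ℝ) {e : ℝ × ℝ} (h : Agree s L e) : Agree (r • s) L (r • e) := by
  induction L generalizing e with
  | nil => trivial
  | cons v L ih =>
    exact ⟨by rw [Pi.smul_apply, Corners.source_smul, h.1],
      by rw [Pi.smul_apply, Corners.target_smul]; exact ih h.2⟩

theorem agree_zero (L : List Visit) : Agree 0 L 0 ∧ endLabels 0 L 0 = 0 := by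
  induction L with
  | nil => exact ⟨trivial, rfl⟩
  | cons v L ih =>
    have h1 : Corners.source v.fromRight 0 = 0 := by cases v.fromRight <;> rfl
    have h2 : Corners.target v.fromRight 0 = 0 := by cases v.fromRight <;> rfl
    simp [Agree, endLabels, h1, h2, ih]

theorem crossingSum_append {R : Type*} [Ring R] (f : ℕ → R) (L M : List Visit) :
    crossingSum f (L ++ M) = crossingSum f L + crossingSum f M := by
  simp [crossingSum]

theorem crossingSum_cons {R : Type*} [Ring R] (f : ℕ → R) (v : Visit) (L : List Visit) :
    crossingSum f (v :: L) = (if v.fromRight then (v.sign : R) * f v.crossing else 0) +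
      crossingSum f L := by
  simp [crossingSum]

theorem crossingSum_nil {R : Type*} [Ring R] (f : ℕ → R) : crossingSum f [] = 0 := rfl

theorem crossingSum_congr {R : Type*} [Ring R] {f g : ℕ → R}
    (h : ∀ v ∈ L, f v.crossing = g v.crossing) : crossingSum f L = crossingSum g L := by
  unfold crossingSum
  congr 1
  exact List.map_congr_left fun v hv => by rw [h v hv]

end Lists

/-- The labellings of the regions of a closed list of visits. The second component labels the two
sides of the edge at which the list starts. -/
def regionLabels (L : List Visit) : Submodule ℝ (Labels × (ℝ × ℝ)) where
  carrier := {x | Agree x.1 L x.2 ∧ endLabels x.1 L x.2 = x.2}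
  zero_mem' := agree_zero L
  add_mem' hx hy := ⟨hx.1.add hy.1, by
    simp only [Prod.fst_add, Prod.snd_add, endLabels_add, hx.2, hy.2]⟩
  smul_mem' r _ hx := ⟨hx.1.smul r, by
    simp only [Prod.smul_fst, Prod.smul_snd, endLabels_smul, hx.2]⟩

theorem mem_regionLabels {L : List Visit} {x : Labels × (ℝ × ℝ)} :
    x ∈ regionLabels L ↔ Agree x.1 L x.2 ∧ endLabels x.1 L x.2 = x.2 := Iff.rfl

/-- The sum of the Goeritz forms for both colours of regions. -/
def regionForm (L : List Visit) (x : Labels × (ℝ × ℝ)) : ℝ :=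
  crossingSum (fun c => (x.1 c).form) L

theorem isWeightedSumSq_form (c : ℕ) :
    IsWeightedSumSq fun x : Labels × (ℝ × ℝ) => (x.1 c).form := by
  let p : Labels × (ℝ × ℝ) →ₗ[ℝ] Corners := (LinearMap.proj c).comp (LinearMap.fst ℝ _ _)
  let f : Corners →ₗ[ℝ] ℝ := (LinearMap.fst ℝ _ _).comp (LinearMap.snd ℝ _ _) -
    (LinearMap.snd ℝ _ _).comp (LinearMap.fst ℝ _ _)
  let g : Corners →ₗ[ℝ] ℝ := (LinearMap.snd ℝ _ _).comp (LinearMap.snd ℝ _ _) -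
    (LinearMap.fst ℝ _ _).comp (LinearMap.fst ℝ _ _)
  have := (IsWeightedSumSq.smul_sq 1 (f.comp p)).add (IsWeightedSumSq.smul_sq (-1) (g.comp p))
  convert this using 2 with x
  simp [Corners.form, f, g, p]
  ring

theorem IsWeightedSumSq.const_mul {A : Type*} [AddCommGroup A] [Module ℝ A] {Q : A → ℝ}
    (hQ : IsWeightedSumSq Q) (r : ℝ) : IsWeightedSumSq fun x => r * Q x := by
  obtain ⟨ι, _, c, α, h⟩ := hQ
  exact ⟨ι, inferInstance, fun i => r * c i, α, fun x => by simp [h, Finset.mul_sum, mul_assoc]⟩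

theorem isWeightedSumSq_regionForm (L : List Visit) : IsWeightedSumSq (regionForm L) := by
  induction L with
  | nil => exact .zero
  | cons v L ih =>
    have : regionForm (v :: L) = fun x => (if v.fromRight then (v.sign : ℝ) else 0) *
        (x.1 v.crossing).form + regionForm L x := by
      funext x
      simp only [regionForm, crossingSum_cons]
      split_ifs <;> simp
    rw [this]
    exact ((isWeightedSumSq_form _).const_mul _).add ih

/-! ### The corrected signature and crossing changes. -/

namespace GaussCode

/-- At a crossing the other strand comes from the right along exactly one of the two strands. Thus
`crossingSum` counts each crossing once. -/
theorem eq_of_fromRight (C : GaussCode) {v w : Visit} (hv : v ∈ C.visits) (hw : w ∈ C.visits)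
    (h : v.fromRight = true) (h' : w.fromRight = true) (hc : v.crossing = w.crossing) : v = w := by
  have := C.sign_eq v hv w hw hc
  obtain ⟨a, b, p⟩ := v
  obtain ⟨a', b', p'⟩ := w
  simp only [Visit.fromRight, beq_iff_eq] at h h' this hc
  subst h h' this hc
  rfl

end GaussCode

namespace KnotDiagram

/-- The signature of the region form of `D`, corrected by the writhe, is `τ`. -/
def HasRegionSig (D : KnotDiagram) (τ : ℤ) : Prop :=
  HasSig (regionLabels D.visits) (regionForm D.visits) (τ - crossingSum (fun _ => 1) D.visits)

theorem exists_hasRegionSig (D : KnotDiagram) : ∃ τ, D.HasRegionSig τ := by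
  obtain ⟨σ, h⟩ := (isWeightedSumSq_regionForm D.visits).exists_hasSig (regionLabels D.visits)
  exact ⟨σ + crossingSum (fun _ => 1) D.visits, by simpa [HasRegionSig] using h⟩

theorem HasRegionSig.unique {D : KnotDiagram} {σ τ : ℤ} (h : D.HasRegionSig σ)
    (h' : D.HasRegionSig τ) : σ = τ := by
  have := HasSig.unique h h'
  omega

theorem agree_map_exchangeAt (c : ℕ) (s : Labels) (L : List Visit) (e : ℝ × ℝ) :
    (Agree s (L.map (Visit.exchangeAt c)) e ↔ Agree s L e) ∧
      endLabels s (L.map (Visit.exchangeAt c)) e = endLabels s L e := by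
  have h1 : ∀ v : Visit, (v.exchangeAt c).crossing = v.crossing := fun v => by
    unfold Visit.exchangeAt; split_ifs <;> rfl
  induction L generalizing e with
  | nil => exact ⟨Iff.rfl, rfl⟩
  | cons v L ih =>
    simp only [List.map_cons, Agree, endLabels, h1, (Visit.compatible_exchangeAt c).fromRight,
      (ih _).1, (ih _).2, and_self]

/-- A single `k` is found for all rings and functions, because it must describe the change of the
writhe and of the region form simultaneously. -/
theorem crossingSum_map_exchangeAt (c : ℕ) {L : List Visit} (hL : L.Nodup)
    (h : ∀ v ∈ L, ∀ w ∈ L, v.fromRight = true → w.fromRight = true → v.crossing = w.crossing →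
      v = w) :
    ∃ k : ℤ, |k| ≤ 2 ∧ ∀ (R : Type) [Ring R] (f : ℕ → R),
      crossingSum f (L.map (Visit.exchangeAt c)) = crossingSum f L + k * f c := by
  induction L with
  | nil => exact ⟨0, by simp, fun R _ f => by simp [crossingSum]⟩
  | cons v L ih =>
    have hL' := List.nodup_cons.1 hL
    by_cases hv : v.fromRight = true ∧ v.crossing = c
    -- Reversing the sign of the crossing replaces its contribution by the negative one.
    · refine ⟨-2 * v.sign, by unfold Visit.sign; split_ifs <;> simp, fun R _ f => ?_⟩
      have e : L.map (fun w => if (w.exchangeAt c).fromRight then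
          ((w.exchangeAt c).sign : R) * f (w.exchangeAt c).crossing else 0) =
          L.map fun w => if w.fromRight then (w.sign : R) * f w.crossing else 0 := by
        refine List.map_congr_left fun w hw => ?_
        rw [(Visit.compatible_exchangeAt c).fromRight]
        split_ifs with hf
        · have : w.crossing ≠ c := by
            rintro rfl
            exact hL'.1 (h v (by simp) w (by simp [hw]) hv.1 hf hv.2 ▸ hw)
          simp [Visit.exchangeAt, this]
        · rfl
      have e2 : (v.exchangeAt c).sign = - v.sign := by
        simp only [Visit.exchangeAt, hv.2, if_true, Visit.sign, Visit.exchange]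
        cases v.positive <;> simp
      have e3 : (v.exchangeAt c).crossing = v.crossing := by
        unfold Visit.exchangeAt; split_ifs <;> rfl
      have e4 : crossingSum f (L.map (Visit.exchangeAt c)) = crossingSum f L := by
        simp only [crossingSum, List.map_map, Function.comp_def, e]
      rw [List.map_cons, crossingSum_cons, crossingSum_cons, e4, e2, e3,
        (Visit.compatible_exchangeAt c).fromRight, if_pos hv.1, if_pos hv.1, hv.2]
      push_cast
      noncomm_ring
    · obtain ⟨k, hk, h'⟩ := ih hL'.2 fun v hv w hw => h v (by simp [hv]) w (by simp [hw])
      refine ⟨k, hk, fun R _ f => ?_⟩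
      have e : (if (v.exchangeAt c).fromRight then
          ((v.exchangeAt c).sign : R) * f (v.exchangeAt c).crossing else 0) =
          if v.fromRight then (v.sign : R) * f v.crossing else 0 := by
        rw [(Visit.compatible_exchangeAt c).fromRight]
        split_ifs with hf
        · have : v.crossing ≠ c := fun hc => hv ⟨hf, hc⟩
          simp [Visit.exchangeAt, this]
        · rfl
      rw [List.map_cons, crossingSum_cons, crossingSum_cons, h', e, add_assoc]

/-- A crossing change alters the signature of the region form, corrected by the writhe, by at most
four. -/
theorem HasRegionSig.abs_sub_le {D : KnotDiagram} {c : ℕ} {σ τ : ℤ} (h : D.HasRegionSig σ)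
    (h' : (D.changeCrossing c).HasRegionSig τ) : |σ - τ| ≤ 4 := by
  obtain ⟨k, hk, hsum⟩ := crossingSum_map_exchangeAt c D.nodup fun v hv w hw =>
    D.eq_of_fromRight hv hw
  unfold HasRegionSig at h h'
  have hvis : (D.changeCrossing c).visits = D.visits.map (Visit.exchangeAt c) := rfl
  rw [hvis, hsum] at h'
  have hV : regionLabels (D.visits.map (Visit.exchangeAt c)) = regionLabels D.visits := by
    ext x
    simp only [mem_regionLabels, (agree_map_exchangeAt c x.1 D.visits x.2).1,
      (agree_map_exchangeAt c x.1 D.visits x.2).2]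
  rw [hV] at h'
  have hQ : ∀ x, regionForm (D.visits.map (Visit.exchangeAt c)) x =
      regionForm D.visits x + k * (x.1 c).form := fun x => hsum ℝ _
  let p : Labels × (ℝ × ℝ) →ₗ[ℝ] Corners := (LinearMap.proj c).comp (LinearMap.fst ℝ _ _)
  let f : Corners →ₗ[ℝ] ℝ := (LinearMap.fst ℝ _ _).comp (LinearMap.snd ℝ _ _) -
    (LinearMap.snd ℝ _ _).comp (LinearMap.fst ℝ _ _)
  let g : Corners →ₗ[ℝ] ℝ := (LinearMap.snd ℝ _ _).comp (LinearMap.snd ℝ _ _) -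
    (LinearMap.fst ℝ _ _).comp (LinearMap.fst ℝ _ _)
  have hf : ∀ x, (x.1 c).form = f (p x) ^ 2 - g (p x) ^ 2 := fun x => rfl
  -- The two forms differ by `k * (f ^ 2 - g ^ 2)`. On the kernel of `g` if `k` is nonnegative, and
  -- of `f` otherwise, they are comparable; so each index of inertia can contribute at most one to
  -- the bound.
  have key : ∀ {Q R : Labels × (ℝ × ℝ) → ℝ} {σ τ k : ℤ}, HasSig (regionLabels D.visits) Q σ →
      HasSig (regionLabels D.visits) R τ → (∀ x, R x = Q x + k * (x.1 c).form) → σ ≤ τ + 2 := by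
    intro Q R σ τ k h h' hQR
    rcases le_total 0 k with hk | hk
    · have hk : (0 : ℝ) ≤ k := by exact_mod_cast hk
      have := h.le_add h' (μ := Unit) (ν := Unit) .id (fun _ => g.comp p)
        (fun x hx hx' => ⟨hx, ?_⟩) .id (fun _ => g.comp p) (fun x hx hx' => ⟨hx, ?_⟩)
      · simpa [add_assoc] using this
      all_goals
        have h0 : g (p x) = 0 := hx' ()
        simp only [LinearMap.id_apply, hQR, hf, h0]
        nlinarith [mul_nonneg hk (sq_nonneg (f (p x)))]
    · have hk : (k : ℝ) ≤ 0 := by exact_mod_cast hk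
      have := h.le_add h' (μ := Unit) (ν := Unit) .id (fun _ => f.comp p)
        (fun x hx hx' => ⟨hx, ?_⟩) .id (fun _ => f.comp p) (fun x hx hx' => ⟨hx, ?_⟩)
      · simpa [add_assoc] using this
      all_goals
        have h0 : f (p x) = 0 := hx' ()
        simp only [LinearMap.id_apply, hQR, hf, h0]
        nlinarith [mul_nonneg (neg_nonneg.2 hk) (sq_nonneg (g (p x)))]
  have k1 := key h h' hQ
  have k2 := key h' h (k := -k) fun x => by rw [hQ]; push_cast; ring
  -- At most two come from the form and at most two from the writhe.
  rw [abs_le] at hk ⊢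
  simp only [mul_one, Int.cast_id] at k1 k2
  omega

end KnotDiagram

/-! ### Local algebra of the third move. -/

namespace Corners

/-- Whether the labels `x` and `y` at two crossings agree along an edge from the one to the other (if
`a` is true) or in the opposite direction. The flags `f` and `g` tell which strands it belongs to. -/
def PairAgree (a f : Bool) (x : Corners) (g : Bool) (y : Corners) : Prop :=
  if a then source g y = target f x else source f x = target g y

/-- The labels along the edge that arrives at the first one of two consecutive crossings. -/
def pairSource (a f : Bool) (x : Corners) (g : Bool) (y : Corners) : ℝ × ℝ :=
  if a then source f x else source g y

/-- The labels along the edge that leaves the second one of two consecutive crossings. -/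
def pairTarget (a f : Bool) (x : Corners) (g : Bool) (y : Corners) : ℝ × ℝ :=
  if a then target g y else target f x

/-- The effect of a third Reidemeister move on the labels at the three crossings, with the label `t`
in the new triangle. -/
def thirdMap (fu fv fw a : Bool) : Corners × Corners × Corners → Corners × Corners × Corners
  | (((xbl, xbr), xfl, xfr), ((ybl, ybr), yfl, yfr), (zbl, zbr), zfl, zfr) =>
    match fu, fv, fw, a with
    | true, true, true, true =>
      let t := xfl - xbr + yfr - zfl + yfl - xbl + xfr
      (((zfl, t), yfl, yfr), ((xbl, xbr), zfl, t),
        (xbr, xfr), t, yfr)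
    | true, true, true, false =>
      let t := xbr - xfl + ybl - zbr + ybr - xfr + xbl
      (((ybl, ybr), t, zbr), ((t, zbr), xfl, xfr),
        (ybl, t), xbl, xfl)
    | true, true, false, true =>
      let t := xfr - xbl + yfl - zbr + yfr - xbr + xfl
      (((t, zbr), yfl, yfr), ((xbl, xbr), t, zbr),
        (xbl, t), xfl, yfl)
    | true, true, false, false =>
      let t := xbl - xfr + ybr - zfl + ybl - xfl + xbr
      (((ybl, ybr), zfl, t), ((zfl, t), xfl, xfr),
        (ybr, xbr), t, xfr)
    | true, false, true, true =>
      let t := xfr - xbl + ybl - zbl + yfl - xbr + xfl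
      (((t, zbl), ybl, yfl), ((t, xbl), zbl, xbr),
        (t, ybl), xbl, xfl)
    | true, false, true, false =>
      let t := xbl - xfr + yfr - zfr + ybr - xfl + xbr
      (((ybr, yfr), zfr, t), ((xfl, zfr), xfr, t),
        (xbr, xfr), yfr, t)
    | true, false, false, true =>
      let t := xfl - xbr + yfl - zbl + ybl - xbl + xfr
      (((zbl, t), ybl, yfl), ((zbl, xbl), t, xbr),
        (t, xbr), yfl, xfr)
    | true, false, false, false =>
      let t := xbr - xfl + ybr - zfr + yfr - xfr + xbl
      (((ybr, yfr), t, zfr), ((xfl, t), xfr, zfr),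
        (xbl, ybr), xfl, t)
    | false, true, true, true =>
      let t := xfl - xbr + yfl - zfr + yfr - xfr + xbl
      (((yfl, t), yfr, zfr), ((xbr, xfr), t, zfr),
        (xbl, xbr), yfl, t)
    | false, true, true, false =>
      let t := xbr - xfl + ybr - zbl + ybl - xbl + xfr
      (((zbl, ybl), t, ybr), ((zbl, t), xbl, xfl),
        (t, ybr), xfl, xfr)
    | false, true, false, true =>
      let t := xbl - xfr + yfr - zfr + yfl - xbr + xfl
      (((yfl, zfr), yfr, t), ((xbr, xfr), zfr, t),
        (xfl, yfr), xfr, t)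
    | false, true, false, false =>
      let t := xfr - xbl + ybl - zbl + ybr - xfl + xbr
      (((t, ybl), zbl, ybr), ((t, zbl), xbl, xfl),
        (t, xbl), ybl, xbr)
    | false, false, true, true =>
      let t := xbl - xfr + yfl - zbr + ybl - xbr + xfl
      (((ybl, zbr), yfl, t), ((zbr, xbr), t, xfr),
        (yfl, t), xfl, xfr)
    | false, false, true, false =>
      let t := xfr - xbl + ybr - zfl + yfr - xfl + xbr
      (((t, ybr), zfl, yfr), ((xbl, t), xfl, zfl),
        (xbl, xbr), t, ybr)
    | false, false, false, true =>
      let t := xfl - xbr + ybl - zfl + yfl - xfr + xbl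
      (((ybl, t), yfl, zfl), ((t, xbr), zfl, xfr),
        (ybl, xbl), t, xbr)
    | false, false, false, false =>
      let t := xbr - xfl + yfr - zbr + ybr - xbl + xfr
      (((zbr, ybr), t, yfr), ((xbl, zbr), xfl, t),
        (xfl, t), xfr, yfr)

theorem thirdMap_add (fu fv fw a : Bool) (p q : Corners × Corners × Corners) :
    thirdMap fu fv fw a (p + q) = thirdMap fu fv fw a p + thirdMap fu fv fw a q := by
  obtain ⟨⟨⟨_, _⟩, _, _⟩, ⟨⟨_, _⟩, _, _⟩, ⟨_, _⟩, _, _⟩ := p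
  obtain ⟨⟨⟨_, _⟩, _, _⟩, ⟨⟨_, _⟩, _, _⟩, ⟨_, _⟩, _, _⟩ := q
  cases fu <;> cases fv <;> cases fw <;> cases a <;>
    simp only [thirdMap, Prod.mk_add_mk, Prod.mk.injEq, true_and, and_true] <;>
    (try constructor) <;> (try constructor) <;> ring

theorem thirdMap_smul (fu fv fw a : Bool) (r : ℝ) (p : Corners × Corners × Corners) :
    thirdMap fu fv fw a (r • p) = r • thirdMap fu fv fw a p := by
  obtain ⟨⟨⟨_, _⟩, _, _⟩, ⟨⟨_, _⟩, _, _⟩, ⟨_, _⟩, _, _⟩ := p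
  cases fu <;> cases fv <;> cases fw <;> cases a <;>
    simp only [thirdMap, Prod.smul_mk, smul_eq_mul, Prod.mk.injEq, true_and, and_true] <;>
    (try constructor) <;> (try constructor) <;> ring

/-- The six regions around the triangle keep their labels. The label of the new triangle is the
signed sum of the seven old labels for which the three contributions have the same total. The flags
`fu`, `fv`, `fw`, `a` determine `b` and `c`, which is why `thirdMap` needs only sixteen cases. -/
theorem thirdMap_spec {fu fv fw a b c : Bool} (h1 : (fu == b) = (fv == c))
    (h2 : ((!fu) == a) = (fw == !c)) (h3 : ((!fv) == !a) = ((!fw) == !b)) (x y z : Corners)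
    (hx : PairAgree a fu x fv y) (hy : PairAgree b (!fu) x fw z)
    (hz : PairAgree c (!fv) y (!fw) z) :
    ∃ x' y' z', thirdMap fu fv fw a (x, y, z) = (x', y', z') ∧
      PairAgree (!a) fu x' fv y' ∧ PairAgree (!b) (!fu) x' fw z' ∧
      PairAgree (!c) (!fv) y' (!fw) z' ∧
      pairSource (!a) fu x' fv y' = pairSource a fu x fv y ∧
      pairSource (!b) (!fu) x' fw z' = pairSource b (!fu) x fw z ∧
      pairSource (!c) (!fv) y' (!fw) z' = pairSource c (!fv) y (!fw) z ∧
      pairTarget (!a) fu x' fv y' = pairTarget a fu x fv y ∧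
      pairTarget (!b) (!fu) x' fw z' = pairTarget b (!fu) x fw z ∧
      pairTarget (!c) (!fv) y' (!fw) z' = pairTarget c (!fv) y (!fw) z ∧
      (if fu then x'.form else -x'.form) + (if fv then y'.form else -y'.form) +
        (if fw then z'.form else -z'.form) =
      (if fu then x.form else -x.form) + (if fv then y.form else -y.form) +
        (if fw then z.form else -z.form) := by
  refine ⟨_, _, _, rfl, ?_⟩
  obtain ⟨⟨_, _⟩, _, _⟩ := x
  obtain ⟨⟨_, _⟩, _, _⟩ := y
  obtain ⟨⟨_, _⟩, _, _⟩ := z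
  cases fu <;> cases fv <;> cases fw <;> cases a <;> cases b <;> cases c <;>
    first
    | (exfalso; revert h1 h2 h3; decide)
    | (clear h1 h2 h3
       simp only [PairAgree, source, target, Bool.not_true, Bool.not_false, Bool.false_eq_true,
         if_true, if_false, Prod.mk.injEq] at hx hy hz
       obtain ⟨rfl, rfl⟩ := hx
       obtain ⟨rfl, hy⟩ := hy
       obtain ⟨hz, hz'⟩ := hz
       subst_vars
       simp [PairAgree, pairSource, pairTarget, source, target, form]
       try ring)

end Corners

/-! ### Invariance under rotation, renaming, first and third moves. -/

theorem HasSig.prod {A : Type*} [AddCommGroup A] [Module ℝ A] {W : Submodule ℝ A} {R : A → ℝ}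
    {σ : ℤ} (hR : HasSig W R σ) {c : ℝ} (hc : c ≠ 0) :
    HasSig (W.prod (⊤ : Submodule ℝ ℝ)) (fun x : A × ℝ => R x.1 + c * x.2 ^ 2)
      (σ + (SignType.sign c : ℤ)) :=
  hR.add_sq hc (LinearMap.fst ℝ A ℝ) (LinearMap.snd ℝ A ℝ)
    (fun y hy t => ⟨(y, t), ⟨hy, trivial⟩, rfl, rfl⟩) fun _ hx => ⟨hx.1, rfl⟩

theorem crossingSum_perm {R : Type*} [Ring R] (f : ℕ → R) {L M : List Visit} (h : L.Perm M) :
    crossingSum f L = crossingSum f M :=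
  (h.map _).sum_eq

theorem crossingSum_relabel {R : Type*} [Ring R] (f : ℕ → R) (g : ℕ → ℕ) (L : List Visit) :
    crossingSum f (L.map (Visit.relabel g)) = crossingSum (f ∘ g) L := by
  simp only [crossingSum, List.map_map]
  rfl

theorem agree_relabel (s : Labels) (g : ℕ → ℕ) (L : List Visit) (e : ℝ × ℝ) :
    (Agree s (L.map (Visit.relabel g)) e ↔ Agree (s ∘ g) L e) ∧
      endLabels s (L.map (Visit.relabel g)) e = endLabels (s ∘ g) L e := by
  induction L generalizing e with
  | nil => exact ⟨Iff.rfl, rfl⟩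
  | cons v L ih => exact ⟨and_congr Iff.rfl (ih _).1, (ih _).2⟩

theorem agree_visitPair (s : Labels) (a : Bool) (v w : Visit) (e : ℝ × ℝ) :
    Agree s (visitPair a v w) e ↔
      Corners.pairSource a v.fromRight (s v.crossing) w.fromRight (s w.crossing) = e ∧
      Corners.PairAgree a v.fromRight (s v.crossing) w.fromRight (s w.crossing) := by
  cases a <;> simp [visitPair, Agree, Corners.pairSource, Corners.PairAgree]

theorem endLabels_visitPair (s : Labels) (a : Bool) (v w : Visit) (e : ℝ × ℝ) :
    endLabels s (visitPair a v w) e =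
      Corners.pairTarget a v.fromRight (s v.crossing) w.fromRight (s w.crossing) := by
  cases a <;> rfl

theorem visitPair_perm (a : Bool) (v w : Visit) : (visitPair a v w).Perm [v, w] := by
  cases a
  · exact List.Perm.swap _ _ _
  · exact .refl _

@[simp] theorem Visit.crossing_opp (v : Visit) : v.opp.crossing = v.crossing := rfl

theorem Visit.fromRight_opp (v : Visit) : v.opp.fromRight = !v.fromRight := by
  obtain ⟨_, a, b⟩ := v
  cases a <;> cases b <;> rfl

@[simp] theorem Visit.sign_opp (v : Visit) : v.opp.sign = v.sign := rfl

/-- The contribution of both visits to a crossing. -/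
theorem crossingSum_opp {R : Type*} [Ring R] (f : ℕ → R) (v : Visit) :
    crossingSum f [v, v.opp] = v.sign * f v.crossing := by
  simp only [crossingSum_cons, crossingSum_nil, Visit.fromRight_opp, Visit.crossing_opp,
    Visit.sign_opp]
  cases v.fromRight <;> simp

/-- The linear map that follows the labels along a list of visits. -/
def endMap (L : List Visit) : Labels × (ℝ × ℝ) →ₗ[ℝ] ℝ × ℝ where
  toFun x := endLabels x.1 L x.2
  map_add' x y := endLabels_add x.2 y.2
  map_smul' r x := endLabels_smul r x.2

/-- Replace the labels at one crossing. -/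
noncomputable def replaceAt {A : Type*} [AddCommGroup A] [Module ℝ A] (c : ℕ) (k : A →ₗ[ℝ] Corners)
    (f : A →ₗ[ℝ] Labels) : A →ₗ[ℝ] Labels where
  toFun x := Function.update (f x) c (k x)
  map_add' x y := by simp [← Function.update_add]
  map_smul' r x := by simp [Function.update_smul]

theorem eq_of_regionSig {L M : List Visit} {σ τ : ℤ}
    (hL : HasSig (regionLabels L) (regionForm L) (σ - crossingSum (fun _ => 1) L))
    (hM : HasSig (regionLabels M) (regionForm M) (τ - crossingSum (fun _ => 1) M))
    (hw : crossingSum (fun _ => (1 : ℤ)) L = crossingSum (fun _ => 1) M)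
    (f : Labels × (ℝ × ℝ) →ₗ[ℝ] Labels × (ℝ × ℝ))
    (hf : ∀ x ∈ regionLabels L, f x ∈ regionLabels M ∧ regionForm M (f x) = regionForm L x)
    (g : Labels × (ℝ × ℝ) →ₗ[ℝ] Labels × (ℝ × ℝ))
    (hg : ∀ x ∈ regionLabels M, g x ∈ regionLabels L ∧ regionForm L (g x) = regionForm M x) :
    σ = τ := by
  have := hL.eq_of_isometry hM f hf g hg
  omega

/-- The second component of a labelling belongs to the base edge, so it has to be carried along `l`
to the new one. -/
theorem regionSig_rotate {l m : List Visit} {σ τ : ℤ}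
    (hL : HasSig (regionLabels (l ++ m)) (regionForm (l ++ m))
      (σ - crossingSum (fun _ => 1) (l ++ m)))
    (hM : HasSig (regionLabels (m ++ l)) (regionForm (m ++ l))
      (τ - crossingSum (fun _ => 1) (m ++ l))) : σ = τ := by
  have key : ∀ l m : List Visit, ∀ x ∈ regionLabels (l ++ m),
      (LinearMap.fst ℝ _ _).prod (endMap l) x ∈ regionLabels (m ++ l) ∧
      regionForm (m ++ l) ((LinearMap.fst ℝ _ _).prod (endMap l) x) = regionForm (l ++ m) x := by
    rintro l m ⟨s, e⟩ ⟨h1, h2⟩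
    simp only [agree_append, endLabels_append] at h1 h2
    refine ⟨⟨?_, ?_⟩, crossingSum_perm _ List.perm_append_comm⟩
    · exact (agree_append _).2 ⟨h1.2, by simpa [endMap, h2] using h1.1⟩
    · simp [endMap, endLabels_append, h2]
  exact eq_of_regionSig hL hM (crossingSum_perm _ List.perm_append_comm) _ (key l m) _ (key m l)

/-- Labels are transported by `f` and a left inverse of it. The two maps need not be inverse to each
other, since isometries in both directions suffice. -/
theorem regionSig_relabel {f : ℕ → ℕ} (hf : Function.Injective f) {L : List Visit} {σ τ : ℤ}
    (hL : HasSig (regionLabels L) (regionForm L) (σ - crossingSum (fun _ => 1) L))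
    (hM : HasSig (regionLabels (L.map (Visit.relabel f))) (regionForm (L.map (Visit.relabel f)))
      (τ - crossingSum (fun _ => 1) (L.map (Visit.relabel f)))) : σ = τ := by
  have hinv := Function.leftInverse_invFun hf
  have key : ∀ s : Labels, (s ∘ Function.invFun f) ∘ f = s := fun s => by
    rw [Function.comp_assoc, hinv.comp_eq_id, Function.comp_id]
  refine eq_of_regionSig hL hM (by rw [crossingSum_relabel]; rfl)
    ((LinearMap.funLeft ℝ Corners (Function.invFun f)).prodMap .id) ?_
    ((LinearMap.funLeft ℝ Corners f).prodMap .id) ?_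
  · rintro ⟨s, e⟩ ⟨h1, h2⟩
    refine ⟨⟨(agree_relabel _ _ _ _).1.2 ?_, (agree_relabel _ _ _ _).2.trans ?_⟩,
      (crossingSum_relabel _ _ _).trans ?_⟩
    · exact (key s).symm ▸ h1
    · exact (key s).symm ▸ h2
    · refine crossingSum_congr fun v _ => ?_
      change ((((s ∘ Function.invFun f) ∘ f) v.crossing).form) = _
      rw [key]
  · rintro ⟨s, e⟩ ⟨h1, h2⟩
    exact ⟨⟨(agree_relabel s f L e).1.1 h1, (agree_relabel s f L e).2.symm.trans h2⟩,
      (crossingSum_relabel (fun c => (s c).form) f L).symm⟩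

/-- At a curl the regions in front of the crossing and behind it coincide, so only the square of the
difference of the side regions remains. One of the latter is the disc inside the curl. -/
theorem Corners.target_not_of_curl {b : Bool} {x : Corners} (h : source (!b) x = target b x) :
    target (!b) x = source b x ∧ x.form = -(x.2.2 - x.1.1) ^ 2 := by
  obtain ⟨⟨_, _⟩, _, _⟩ := x
  cases b <;>
  · simp only [source, target, form, Bool.not_true, Bool.not_false, Bool.false_eq_true, if_true,
      if_false, Prod.mk.injEq, true_and, and_true] at h ⊢
    subst h
    exact ⟨rfl, by ring⟩

/-- The label of the disc is a new free variable, and the form gains a square with coefficient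
`-v.sign`. This cancels against the change of the writhe and explains the correction term. -/
theorem regionSig_first {v : Visit} {l : List Visit} (hv : ∀ w ∈ l, w.crossing ≠ v.crossing)
    {σ τ : ℤ}
    (hL : HasSig (regionLabels (v :: v.opp :: l)) (regionForm (v :: v.opp :: l))
      (σ - crossingSum (fun _ => 1) (v :: v.opp :: l)))
    (hM : HasSig (regionLabels l) (regionForm l) (τ - crossingSum (fun _ => 1) l)) : σ = τ := by
  have hsum : ∀ (R : Type) [Ring R] (f : ℕ → R), crossingSum f (v :: v.opp :: l) =
      v.sign * f v.crossing + crossingSum f l := fun R _ f => by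
    rw [← crossingSum_opp, ← crossingSum_append]
    rfl
  have hc : -(v.sign : ℝ) ≠ 0 := by unfold Visit.sign; split_ifs <;> simp
  have hM' := hM.prod hc
  let α : Labels × (ℝ × ℝ) →ₗ[ℝ] ℝ :=
    { toFun := fun x => (x.1 v.crossing).2.2 - (x.1 v.crossing).1.1
      map_add' := fun x y => by simp; ring
      map_smul' := fun r x => by simp; ring }
  have hα : ∀ x, α x = (x.1 v.crossing).2.2 - (x.1 v.crossing).1.1 := fun x => rfl
  -- The new coordinate is the front right label minus the back left one; it determines the label of
  -- the disc, which is front right or back left depending on `v.fromRight`.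
  let k : (Labels × (ℝ × ℝ)) × ℝ →ₗ[ℝ] Corners :=
    { toFun := fun y => if v.fromRight then
        (y.1.2, (y.1.2.2, y.2 + y.1.2.1))
        else ((y.1.2.2 - y.2, y.1.2.1), y.1.2)
      map_add' := fun y z => by
        split_ifs
        · simp; ring
        · simp; ring
      map_smul' := fun r y => by
        split_ifs
        · simp; ring
        · simp; ring }
  have hk : ∀ y, k y = if v.fromRight then
        (y.1.2, (y.1.2.2, y.2 + y.1.2.1))
        else ((y.1.2.2 - y.2, y.1.2.1), y.1.2) := fun _ => rfl
  have := hL.eq_of_isometry hM' (LinearMap.id.prod α) ?_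
    ((replaceAt v.crossing k ((LinearMap.fst ℝ _ _).comp (LinearMap.fst ℝ _ _))).prod
      ((LinearMap.snd ℝ _ _).comp (LinearMap.fst ℝ _ _))) ?_
  · rw [hsum] at this
    have hs : (SignType.sign (-(v.sign : ℝ)) : ℤ) = - v.sign := by
      unfold Visit.sign; split_ifs <;> simp
    rw [hs] at this
    simp only [mul_one, Int.cast_id] at this
    omega
  · rintro ⟨s, e⟩ ⟨h1, h2⟩
    simp only [Agree, endLabels, Visit.crossing_opp, Visit.fromRight_opp] at h1 h2
    obtain ⟨h1, h3, h4⟩ := h1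
    have key := Corners.target_not_of_curl h3
    rw [h1] at key
    rw [key.1] at h2 h4
    refine ⟨⟨⟨h4, h2⟩, trivial⟩, ?_⟩
    change regionForm l (s, e) + -(v.sign : ℝ) * α (s, e) ^ 2 = _
    simp only [regionForm, hsum, hα, key.2]
    ring
  · rintro ⟨⟨s, e⟩, t⟩ ⟨⟨h1, h2⟩, -⟩
    obtain ⟨s', hs'⟩ : ∃ s', s' = Function.update s v.crossing (k ((s, e), t)) := ⟨_, rfl⟩
    have hu : s' v.crossing = k ((s, e), t) := by rw [hs', Function.update_self]
    have hs : ∀ w ∈ l, s w.crossing = s' w.crossing :=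
      fun w hw => by rw [hs', Function.update_of_ne (hv w hw)]
    have key : Corners.target (!v.fromRight) (k ((s, e), t)) = e ∧
        Corners.source v.fromRight (k ((s, e), t)) = e ∧
        Corners.source (!v.fromRight) (k ((s, e), t)) =
          Corners.target v.fromRight (k ((s, e), t)) ∧
        (k ((s, e), t)).form = - t ^ 2 := by
      cases hf : v.fromRight <;> simp [hk, hf, Corners.source, Corners.target, Corners.form]
    have hmem : (s', e) ∈ regionLabels (v :: v.opp :: l) := by
      simp only [mem_regionLabels, Agree, endLabels, Visit.crossing_opp, Visit.fromRight_opp, hu,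
        key.1, key.2.1, key.2.2.1, true_and]
      exact ⟨(agree_congr hs).1 h1, (endLabels_congr hs).symm.trans h2⟩
    have hform : regionForm (v :: v.opp :: l) (s', e) =
        regionForm l (s, e) + -(v.sign : ℝ) * t ^ 2 := by
      simp only [regionForm, hsum, hu, key.2.2.2]
      rw [crossingSum_congr (f := fun c => (s' c).form) (g := fun c => (s c).form)
        fun w hw => by simp only [hs w hw]]
      ring
    rw [hs'] at hmem hform
    exact ⟨hmem, hform⟩

/-- The linear map on labels that belongs to a third Reidemeister move. -/
noncomputable def thirdLabels (u v w : Visit) (a : Bool) :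
    Labels × (ℝ × ℝ) →ₗ[ℝ] Labels × (ℝ × ℝ) where
  toFun x :=
    let q := Corners.thirdMap u.fromRight v.fromRight w.fromRight a
      (x.1 u.crossing, x.1 v.crossing, x.1 w.crossing)
    (fun d => if d = u.crossing then q.1 else if d = v.crossing then q.2.1
      else if d = w.crossing then q.2.2 else x.1 d, x.2)
  map_add' x y := by
    have := Corners.thirdMap_add u.fromRight v.fromRight w.fromRight a
      (x.1 u.crossing, x.1 v.crossing, x.1 w.crossing)
      (y.1 u.crossing, y.1 v.crossing, y.1 w.crossing)
    refine Prod.ext (funext fun d => ?_) rfl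
    simp only [Prod.fst_add, Pi.add_apply, ← Prod.mk_add_mk, this]
    split_ifs <;> rfl
  map_smul' r x := by
    have := Corners.thirdMap_smul u.fromRight v.fromRight w.fromRight a r
      (x.1 u.crossing, x.1 v.crossing, x.1 w.crossing)
    refine Prod.ext (funext fun d => ?_) rfl
    simp only [Prod.smul_fst, Pi.smul_apply, ← Prod.smul_mk, this]
    split_ifs <;> rfl

theorem thirdLabels_spec {u v w : Visit} {a b c : Bool} (h : ThirdMoveCond u v w a b c)
    (huv : v.crossing ≠ u.crossing) (huw : w.crossing ≠ u.crossing) (hvw : w.crossing ≠ v.crossing)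
    {x : Labels × (ℝ × ℝ)}
    (hx : Corners.PairAgree a u.fromRight (x.1 u.crossing) v.fromRight (x.1 v.crossing))
    (hy : Corners.PairAgree b u.opp.fromRight (x.1 u.opp.crossing) w.fromRight (x.1 w.crossing))
    (hz : Corners.PairAgree c v.opp.fromRight (x.1 v.opp.crossing) w.opp.fromRight
      (x.1 w.opp.crossing)) :
    ∃ s : Labels, thirdLabels u v w a x = (s, x.2) ∧
      (∀ d, d ≠ u.crossing → d ≠ v.crossing → d ≠ w.crossing → s d = x.1 d) ∧
      (∀ e, Agree s (visitPair (!a) u v) e ↔ Agree x.1 (visitPair a u v) e) ∧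
      (∀ e, Agree s (visitPair (!b) u.opp w) e ↔ Agree x.1 (visitPair b u.opp w) e) ∧
      (∀ e, Agree s (visitPair (!c) v.opp w.opp) e ↔ Agree x.1 (visitPair c v.opp w.opp) e) ∧
      (∀ e, endLabels s (visitPair (!a) u v) e = endLabels x.1 (visitPair a u v) e) ∧
      (∀ e, endLabels s (visitPair (!b) u.opp w) e = endLabels x.1 (visitPair b u.opp w) e) ∧
      (∀ e, endLabels s (visitPair (!c) v.opp w.opp) e =
        endLabels x.1 (visitPair c v.opp w.opp) e) ∧
      crossingSum (fun d => (s d).form) [u, u.opp, v, v.opp, w, w.opp] =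
        crossingSum (fun d => (x.1 d).form) [u, u.opp, v, v.opp, w, w.opp] := by
  obtain ⟨hu, hv, hw, h1, h2, h3⟩ := h
  simp only [Visit.fromRight_opp, Visit.crossing_opp] at h2 h3 hx hy hz
  obtain ⟨X, Y, Z, hq, k1, k2, k3, k4, k5, k6, k7, k8, k9, k10⟩ :=
    Corners.thirdMap_spec h1 h2 h3 _ _ _ hx hy hz
  obtain ⟨s, hs⟩ : ∃ s : Labels, s = fun d => if d = u.crossing then X else
    if d = v.crossing then Y else if d = w.crossing then Z else x.1 d := ⟨_, rfl⟩
  have su : s u.crossing = X := by rw [hs]; simp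
  have sv : s v.crossing = Y := by rw [hs]; simp [huv]
  have sw : s w.crossing = Z := by rw [hs]; simp [huw, hvw]
  refine ⟨s, ?_, ?_, ?_, ?_, ?_, ?_, ?_, ?_, ?_⟩
  · rw [hs]
    simp only [thirdLabels, LinearMap.coe_mk, AddHom.coe_mk, hq]
  · intro d d1 d2 d3
    rw [hs]
    simp [d1, d2, d3]
  · intro e
    simp only [agree_visitPair, su, sv, k1, k4, hx]
  · intro e
    simp only [agree_visitPair, Visit.fromRight_opp, Visit.crossing_opp, su, sw, k2, k5, hy]
  · intro e
    simp only [agree_visitPair, Visit.fromRight_opp, Visit.crossing_opp, sv, sw, k3, k6, hz]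
  · intro e
    simp only [endLabels_visitPair, su, sv, k7]
  · intro e
    simp only [endLabels_visitPair, Visit.fromRight_opp, Visit.crossing_opp, su, sw, k8]
  · intro e
    simp only [endLabels_visitPair, Visit.fromRight_opp, Visit.crossing_opp, sv, sw, k9]
  -- For an upper visit, `fromRight` means that the crossing is positive. So the flags in
  -- `thirdMap_spec` encode the signs of the crossings.
  · have key : ∀ (v : Visit) (x : Corners), v.upper = true →
        (if v.fromRight then x.form else -x.form) = v.sign * x.form := by
      rintro ⟨_, _, _ | _⟩ x h <;> cases h <;> simp [Visit.fromRight, Visit.sign]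
    have e : ∀ f : ℕ → ℝ, crossingSum f [u, u.opp, v, v.opp, w, w.opp] =
        u.sign * f u.crossing + v.sign * f v.crossing + w.sign * f w.crossing := fun f => by
      rw [show [u, u.opp, v, v.opp, w, w.opp] = [u, u.opp] ++ ([v, v.opp] ++ [w, w.opp]) from rfl,
        crossingSum_append, crossingSum_append, crossingSum_opp, crossingSum_opp, crossingSum_opp,
        add_assoc]
    rw [e, e, su, sv, sw, ← key u _ hu, ← key v _ hv, ← key w _ hw, ← key u _ hu, ← key v _ hv,
      ← key w _ hw]
    exact k10

theorem thirdMove_perm (u v w : Visit) (a b c : Bool) (l m n : List Visit) :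
    (visitPair a u v ++ l ++ visitPair b u.opp w ++ m ++ visitPair c v.opp w.opp ++ n).Perm
      ([u, u.opp, v, v.opp, w, w.opp] ++ (l ++ (m ++ n))) := by
  have h : ∀ (a : Bool) (v w : Visit), ((visitPair a v w : List Visit) : Multiset Visit) =
      {v} + {w} := fun a v w => Multiset.coe_eq_coe.2 (visitPair_perm a v w)
  rw [← Multiset.coe_eq_coe]
  simp only [← Multiset.coe_add, h]
  rw [show ((([u, u.opp, v, v.opp, w, w.opp] : List Visit)) : Multiset Visit) =
    {u} + ({u.opp} + ({v} + ({v.opp} + ({w} + {w.opp})))) from rfl]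
  abel

theorem thirdMove_perm' (u v w : Visit) (a b c : Bool) (l m n : List Visit) :
    (visitPair a u v ++ l ++ visitPair c v.opp w.opp ++ m ++ visitPair b u.opp w ++ n).Perm
      ([u, u.opp, v, v.opp, w, w.opp] ++ (l ++ (m ++ n))) := by
  refine List.Perm.trans ?_ (thirdMove_perm u v w a b c l m n)
  rw [← Multiset.coe_eq_coe]
  simp only [← Multiset.coe_add]
  abel

/-- The conditions compare parities, and reversing all three flags changes both sides of each
comparison equally. Hence the inverse of a third move has the same form. -/
theorem ThirdMoveCond.reverse {u v w : Visit} {a b c : Bool} (h : ThirdMoveCond u v w a b c) :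
    ThirdMoveCond u v w (!a) (!b) (!c) := by
  obtain ⟨hu, hv, hw, h1, h2, h3⟩ := h
  refine ⟨hu, hv, hw, ?_⟩
  revert h1 h2 h3
  generalize u.fromRight = p1
  generalize v.fromRight = p2
  generalize w.fromRight = p3
  generalize u.opp.fromRight = p4
  generalize v.opp.fromRight = p5
  generalize w.opp.fromRight = p6
  revert a b c p1 p2 p3 p4 p5 p6
  decide

/-- The visits at the three crossings of a third Reidemeister move do not occur elsewhere. -/
structure ThirdFresh (u v w : Visit) (L : List Visit) : Prop where
  uv : v.crossing ≠ u.crossing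
  uw : w.crossing ≠ u.crossing
  vw : w.crossing ≠ v.crossing
  rest : ∀ x ∈ L, x.crossing ≠ u.crossing ∧ x.crossing ≠ v.crossing ∧ x.crossing ≠ w.crossing

theorem thirdLabels_mem {u v w : Visit} {a b c : Bool} (h : ThirdMoveCond u v w a b c)
    {l m n : List Visit} (hf : ThirdFresh u v w (l ++ (m ++ n))) {x : Labels × (ℝ × ℝ)}
    (hx : x ∈ regionLabels
      (visitPair a u v ++ l ++ visitPair b u.opp w ++ m ++ visitPair c v.opp w.opp ++ n)) :
    thirdLabels u v w a x ∈ regionLabels (visitPair (!a) u v ++ l ++ visitPair (!b) u.opp w ++ m ++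
        visitPair (!c) v.opp w.opp ++ n) ∧
      regionForm (visitPair (!a) u v ++ l ++ visitPair (!b) u.opp w ++ m ++
        visitPair (!c) v.opp w.opp ++ n) (thirdLabels u v w a x) = regionForm
      (visitPair a u v ++ l ++ visitPair b u.opp w ++ m ++ visitPair c v.opp w.opp ++ n) x := by
  obtain ⟨h1, h2⟩ := hx
  simp only [agree_append, endLabels_append] at h1 h2
  obtain ⟨⟨⟨⟨⟨a1, a2⟩, a3⟩, a4⟩, a5⟩, a6⟩ := h1
  obtain ⟨s, hs, h0, k1, k2, k3, k4, k5, k6, k7⟩ := thirdLabels_spec h hf.uv hf.uw hf.vw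
    ((agree_visitPair _ _ _ _ _).1 a1).2 ((agree_visitPair _ _ _ _ _).1 a3).2
    ((agree_visitPair _ _ _ _ _).1 a5).2
  have hr : ∀ y ∈ l ++ (m ++ n), s y.crossing = x.1 y.crossing := fun y hy =>
    h0 _ (hf.rest y hy).1 (hf.rest y hy).2.1 (hf.rest y hy).2.2
  have hl : ∀ y ∈ l, s y.crossing = x.1 y.crossing := fun y hy => hr y (by simp [hy])
  have hm : ∀ y ∈ m, s y.crossing = x.1 y.crossing := fun y hy => hr y (by simp [hy])
  have hn : ∀ y ∈ n, s y.crossing = x.1 y.crossing := fun y hy => hr y (by simp [hy])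
  rw [hs]
  refine ⟨⟨?_, ?_⟩, ?_⟩
  · simp only [agree_append, endLabels_append, k1, k2, k3, k4, k5, k6, agree_congr hl,
      agree_congr hm, agree_congr hn, endLabels_congr hl, endLabels_congr hm]
    exact ⟨⟨⟨⟨⟨a1, a2⟩, a3⟩, a4⟩, a5⟩, a6⟩
  · simp only [endLabels_append, k4, k5, k6, endLabels_congr hl, endLabels_congr hm,
      endLabels_congr hn]
    exact h2
  · simp only [regionForm]
    rw [crossingSum_perm _ (thirdMove_perm u v w _ _ _ l m n),
      crossingSum_perm _ (thirdMove_perm u v w _ _ _ l m n),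
      crossingSum_append _ [u, u.opp, v, v.opp, w, w.opp], k7,
      crossingSum_append _ [u, u.opp, v, v.opp, w, w.opp], crossingSum_congr (L := l ++ (m ++ n))
        (f := fun d => (s d).form)
        (g := fun d => (x.1 d).form) fun y hy => by simp only [hr y hy]]

theorem thirdLabels_mem' {u v w : Visit} {a b c : Bool} (h : ThirdMoveCond u v w a b c)
    {l m n : List Visit} (hf : ThirdFresh u v w (l ++ (m ++ n))) {x : Labels × (ℝ × ℝ)}
    (hx : x ∈ regionLabels
      (visitPair a u v ++ l ++ visitPair c v.opp w.opp ++ m ++ visitPair b u.opp w ++ n)) :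
    thirdLabels u v w a x ∈ regionLabels (visitPair (!a) u v ++ l ++ visitPair (!c) v.opp w.opp ++
        m ++ visitPair (!b) u.opp w ++ n) ∧
      regionForm (visitPair (!a) u v ++ l ++ visitPair (!c) v.opp w.opp ++ m ++
        visitPair (!b) u.opp w ++ n) (thirdLabels u v w a x) = regionForm
      (visitPair a u v ++ l ++ visitPair c v.opp w.opp ++ m ++ visitPair b u.opp w ++ n) x := by
  obtain ⟨h1, h2⟩ := hx
  simp only [agree_append, endLabels_append] at h1 h2
  obtain ⟨⟨⟨⟨⟨a1, a2⟩, a3⟩, a4⟩, a5⟩, a6⟩ := h1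
  obtain ⟨s, hs, h0, k1, k2, k3, k4, k5, k6, k7⟩ := thirdLabels_spec h hf.uv hf.uw hf.vw
    ((agree_visitPair _ _ _ _ _).1 a1).2 ((agree_visitPair _ _ _ _ _).1 a5).2
    ((agree_visitPair _ _ _ _ _).1 a3).2
  have hr : ∀ y ∈ l ++ (m ++ n), s y.crossing = x.1 y.crossing := fun y hy =>
    h0 _ (hf.rest y hy).1 (hf.rest y hy).2.1 (hf.rest y hy).2.2
  have hl : ∀ y ∈ l, s y.crossing = x.1 y.crossing := fun y hy => hr y (by simp [hy])
  have hm : ∀ y ∈ m, s y.crossing = x.1 y.crossing := fun y hy => hr y (by simp [hy])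
  have hn : ∀ y ∈ n, s y.crossing = x.1 y.crossing := fun y hy => hr y (by simp [hy])
  rw [hs]
  refine ⟨⟨?_, ?_⟩, ?_⟩
  · simp only [agree_append, endLabels_append, k1, k2, k3, k4, k5, k6, agree_congr hl,
      agree_congr hm, agree_congr hn, endLabels_congr hl, endLabels_congr hm]
    exact ⟨⟨⟨⟨⟨a1, a2⟩, a3⟩, a4⟩, a5⟩, a6⟩
  · simp only [endLabels_append, k4, k5, k6, endLabels_congr hl, endLabels_congr hm,
      endLabels_congr hn]
    exact h2
  · simp only [regionForm]
    rw [crossingSum_perm _ (thirdMove_perm' u v w _ (!b) (!c) l m n),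
      crossingSum_perm _ (thirdMove_perm' u v w _ b c l m n),
      crossingSum_append _ [u, u.opp, v, v.opp, w, w.opp], k7,
      crossingSum_append _ [u, u.opp, v, v.opp, w, w.opp], crossingSum_congr (L := l ++ (m ++ n))
        (f := fun d => (s d).form)
        (g := fun d => (x.1 d).form) fun y hy => by simp only [hr y hy]]

/-- The relabelling of the triangle for the move and that for the reversed move are isometries in
opposite directions. -/
theorem regionSig_third {u v w : Visit} {a b c : Bool} (h : ThirdMoveCond u v w a b c)
    {l m n : List Visit} (hf : ThirdFresh u v w (l ++ (m ++ n))) {L M : List Visit}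
    (hLM : (L = visitPair a u v ++ l ++ visitPair b u.opp w ++ m ++ visitPair c v.opp w.opp ++ n ∧
      M = visitPair (!a) u v ++ l ++ visitPair (!b) u.opp w ++ m ++ visitPair (!c) v.opp w.opp ++
        n) ∨
      (L = visitPair a u v ++ l ++ visitPair c v.opp w.opp ++ m ++ visitPair b u.opp w ++ n ∧
      M = visitPair (!a) u v ++ l ++ visitPair (!c) v.opp w.opp ++ m ++ visitPair (!b) u.opp w ++
        n)) {σ τ : ℤ}
    (hL : HasSig (regionLabels L) (regionForm L) (σ - crossingSum (fun _ => 1) L))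
    (hM : HasSig (regionLabels M) (regionForm M) (τ - crossingSum (fun _ => 1) M)) : σ = τ := by
  refine eq_of_regionSig hL hM ?_ (thirdLabels u v w a) (fun x hx => ?_)
    (thirdLabels u v w (!a)) fun x hx => ?_
  · rcases hLM with ⟨rfl, rfl⟩ | ⟨rfl, rfl⟩
    · rw [crossingSum_perm _ (thirdMove_perm u v w _ _ _ l m n),
        crossingSum_perm _ (thirdMove_perm u v w _ _ _ l m n)]
    · rw [crossingSum_perm _ (thirdMove_perm' u v w _ (!b) (!c) l m n),
        crossingSum_perm _ (thirdMove_perm' u v w _ b c l m n)]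
  · rcases hLM with ⟨rfl, rfl⟩ | ⟨rfl, rfl⟩
    · exact thirdLabels_mem h hf hx
    · exact thirdLabels_mem' h hf hx
  · rcases hLM with ⟨rfl, rfl⟩ | ⟨rfl, rfl⟩
    · simpa only [Bool.not_not] using thirdLabels_mem h.reverse hf hx
    · simpa only [Bool.not_not] using thirdLabels_mem' h.reverse hf hx

/-! ### The dimension of the space of labellings. -/

section Lists

variable {s : Labels} {L : List Visit} {e : ℝ × ℝ}

theorem Agree.source_zero (h : Agree s L e) (hL : 0 < L.length) :
    (s L[0].crossing).source L[0].fromRight = e := by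
  cases L with
  | nil => simp at hL
  | cons v L => exact h.1

theorem Agree.source_succ (h : Agree s L e) {i : ℕ} (hi : i + 1 < L.length) :
    (s L[i + 1].crossing).source L[i + 1].fromRight =
      (s L[i].crossing).target L[i].fromRight := by
  induction L generalizing e i with
  | nil => simp at hi
  | cons v L ih =>
    cases i with
    | zero => exact h.2.source_zero (by simpa using hi)
    | succ i => exact ih h.2 (by simpa using hi)

theorem agree_of_source_eq (h0 : ∀ hL : 0 < L.length, (s L[0].crossing).source L[0].fromRight = e)
    (h : ∀ i (hi : i + 1 < L.length), (s L[i + 1].crossing).source L[i + 1].fromRight =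
      (s L[i].crossing).target L[i].fromRight) : Agree s L e := by
  induction L generalizing e with
  | nil => trivial
  | cons v L ih =>
    refine ⟨h0 (by simp), ih (fun hL => h 0 (by simpa using hL)) fun i hi => h (i + 1) (by simpa)⟩

theorem endLabels_eq_target (hL : L ≠ []) :
    endLabels s L e = (s (L.getLast hL).crossing).target (L.getLast hL).fromRight := by
  induction L generalizing e with
  | nil => exact absurd rfl hL
  | cons v L ih =>
    cases L with
    | nil => rfl
    | cons w L => exact ih (e := (s v.crossing).target v.fromRight) (by simp)

end Lists

/-- Labels that vanish at the crossings which do not occur in `L`. -/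
def supportedLabels (L : List Visit) : Submodule ℝ (Labels × (ℝ × ℝ)) where
  carrier := {x | ∀ c, (∀ v ∈ L, v.crossing ≠ c) → x.1 c = 0}
  zero_mem' _ _ := rfl
  add_mem' hx hy c hc := by simp [hx c hc, hy c hc]
  smul_mem' r x hx c hc := by simp [hx c hc]

namespace GaussCode

variable (C : GaussCode)

/-- The flow across an edge that belongs to the labels at its sides. -/
def edgeFlow : ℝ × ℝ →ₗ[ℝ] ℝ := LinearMap.fst ℝ ℝ ℝ - LinearMap.snd ℝ ℝ ℝ

theorem edgeFlow_apply (e : ℝ × ℝ) : edgeFlow e = e.1 - e.2 := rfl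

/-- The flow out of a crossing after the first one of the two visits. -/
noncomputable def firstFlow (v : Visit) : Labels × (ℝ × ℝ) →ₗ[ℝ] ℝ :=
  edgeFlow.comp (endMap [if C.visits.idxOf v ≤ C.visits.idxOf v.opp then v else v.opp])

/-- Follow the knot from the base edge. The flow out of a crossing is prescribed at the first visit
and is forced at the second one by conservation, the other three flows being known to vanish. -/
theorem edgeFlow_eq_zero {x : Labels × (ℝ × ℝ)} (hx : x ∈ regionLabels C.visits) (h0 : x.2 = 0)
    (h : ∀ v ∈ C.visits, v.upper = true → C.firstFlow v x = 0) (i : ℕ) (hi : i < C.visits.length) :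
    edgeFlow ((x.1 C.visits[i].crossing).source C.visits[i].fromRight) = 0 ∧
      edgeFlow ((x.1 C.visits[i].crossing).target C.visits[i].fromRight) = 0 := by
  induction i using Nat.strong_induction_on with
  | _ i ih =>
  have h1 : edgeFlow ((x.1 C.visits[i].crossing).source C.visits[i].fromRight) = 0 := by
    cases i with
    | zero => rw [hx.1.source_zero hi, h0, map_zero]
    | succ i =>
      rw [hx.1.source_succ hi]
      exact (ih i (by omega) (by omega)).2
  refine ⟨h1, ?_⟩
  generalize hv : C.visits[i] = v at h1 ⊢
  have hvm : v ∈ C.visits := hv ▸ List.getElem_mem hi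
  have hidx : C.visits.idxOf v = i := by rw [← hv]; exact C.nodup.idxOf_getElem i hi
  by_cases hle : C.visits.idxOf v ≤ C.visits.idxOf v.opp
  -- The prescribed flows are indexed by upper visits, while the first visit to a crossing may be
  -- the lower one.
  · cases hu : v.upper
    · have := h v.opp (C.opp_mem v hvm) (by simp [Visit.opp, hu])
      have hne : ¬ C.visits.idxOf v.opp ≤ C.visits.idxOf v.opp.opp := by
        rw [Visit.opp_opp]
        intro hge
        have := List.idxOf_inj (l := C.visits) (x := v) (y := v.opp) hvm |>.1 (le_antisymm hle hge)
        have := congrArg Visit.upper this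
        simp [Visit.opp] at this
      rw [firstFlow, if_neg hne, Visit.opp_opp] at this
      exact this
    · have := h v hvm hu
      rw [firstFlow, if_pos hle] at this
      exact this
  · have hj : C.visits.idxOf v.opp < i := by omega
    have hjl : C.visits.idxOf v.opp < C.visits.length := by omega
    have := ih _ hj hjl
    rw [List.getElem_idxOf] at this
    simp only [Visit.crossing_opp, Visit.fromRight_opp, edgeFlow_apply] at this h1 ⊢
    obtain ⟨k1, k2⟩ := this
    cases hf : v.fromRight <;> rw [hf] at h1 k1 k2 <;>
      simp only [Corners.source, Corners.target, Bool.not_true, Bool.not_false, Bool.false_eq_true,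
        if_true, if_false] at h1 k1 k2 ⊢ <;> linarith

/-- Without flow, the two sides of each edge carry equal labels. So all four labels at a crossing
agree, and the value zero spreads along the knot. -/
theorem eq_zero_of_edgeFlow {s : Labels} {L : List Visit} (hopp : ∀ v ∈ L, v.opp ∈ L)
    (h : ∀ v ∈ L, edgeFlow ((s v.crossing).source v.fromRight) = 0 ∧
      edgeFlow ((s v.crossing).target v.fromRight) = 0) (h0 : Agree s L 0) :
    ∀ v ∈ L, s v.crossing = 0 := by
  have key : ∀ v ∈ L, (s v.crossing).source v.fromRight = 0 → s v.crossing = 0 := by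
    intro v hv hs
    have h1 := h v hv
    have h2 := h v.opp (hopp v hv)
    simp only [Visit.crossing_opp, Visit.fromRight_opp, edgeFlow_apply] at h1 h2
    revert h1 h2 hs
    generalize s v.crossing = X
    obtain ⟨⟨a, b⟩, c, d⟩ := X
    cases v.fromRight <;>
    · simp only [Corners.source, Corners.target, Bool.not_true, Bool.not_false, Bool.false_eq_true,
        if_true, if_false, Prod.mk_eq_zero]
      rintro ⟨h1, h2⟩ ⟨h3, h4⟩ ⟨h5, h6⟩
      refine ⟨⟨?_, ?_⟩, ?_, ?_⟩ <;> linarith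
  clear h hopp
  induction L with
  | nil => simp
  | cons v L ih =>
    simp only [List.mem_cons, forall_eq_or_imp] at key ⊢
    have hv := key.1 h0.1
    have ht : (s v.crossing).target v.fromRight = 0 := by
      rw [hv]; cases v.fromRight <;> rfl
    exact ⟨hv, ih (ht ▸ h0.2) key.2⟩

/-- Labellings are determined by the labels along one edge and one flow at each crossing. -/
noncomputable def flowMap : ↥(regionLabels C.visits ⊓ supportedLabels C.visits) →ₗ[ℝ]
    (ℝ × ℝ) × ({v // v ∈ C.visits.toFinset.filter fun v => v.upper = true} → ℝ) :=
  ((LinearMap.snd ℝ _ _).prod (LinearMap.pi fun v => C.firstFlow v.1)).comp (Submodule.subtype _)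

/-- With `n` crossings this bounds the dimension by `n + 2`, whatever the genus of the surface. -/
theorem flowMap_injective : Function.Injective C.flowMap := by
  rw [injective_iff_map_eq_zero]
  rintro ⟨⟨s, e⟩, hx, hs⟩ h
  have he : e = 0 := congrArg Prod.fst h
  have hf : ∀ v ∈ C.visits, v.upper = true → C.firstFlow v (s, e) = 0 := fun v hv hu =>
    congrFun (congrArg Prod.snd h) ⟨v, by simp [hv, hu]⟩
  have h1 := C.edgeFlow_eq_zero hx he hf
  have h2 := eq_zero_of_edgeFlow (s := s) C.opp_mem (fun v hv => by
    obtain ⟨i, hi, rfl⟩ := List.getElem_of_mem hv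
    exact h1 i hi) (he ▸ hx.1)
  refine Subtype.ext (Prod.ext (funext fun c => ?_) he)
  by_cases hc : ∃ v ∈ C.visits, v.crossing = c
  · obtain ⟨v, hv, rfl⟩ := hc
    exact h2 v hv
  · push Not at hc
    exact hs c hc

theorem card_upper : 2 * (C.visits.toFinset.filter fun v => v.upper = true).card =
    C.visits.length := by
  have h1 := Finset.card_filter_add_card_filter_not (s := C.visits.toFinset) fun v => v.upper = true
  have h2 : (C.visits.toFinset.filter fun v => v.upper = true).card =
      (C.visits.toFinset.filter fun v => ¬ v.upper = true).card := by
    refine Finset.card_bij (fun v _ => v.opp) ?_ ?_ ?_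
    · intro v hv
      simp only [Finset.mem_filter, List.mem_toFinset] at hv ⊢
      exact ⟨C.opp_mem v hv.1, by simp [Visit.opp, hv.2]⟩
    · intro v _ w _ h
      simpa using congrArg Visit.opp h
    · intro v hv
      simp only [Finset.mem_filter, List.mem_toFinset] at hv
      exact ⟨v.opp, by simpa [Visit.opp, hv.2] using C.opp_mem v hv.1, Visit.opp_opp v⟩
  rw [List.toFinset_card_of_nodup C.nodup] at h1
  omega

instance finite_regionLabels :
    Module.Finite ℝ ↥(regionLabels C.visits ⊓ supportedLabels C.visits) :=
  Module.Finite.of_injective C.flowMap C.flowMap_injective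

/-- The Euler characteristic of a connected surface is at most two. -/
theorem finrank_regionLabels_le :
    2 * Module.finrank ℝ ↥(regionLabels C.visits ⊓ supportedLabels C.visits) ≤
      C.visits.length + 4 := by
  have := LinearMap.finrank_le_finrank_of_injective C.flowMap_injective
  simp only [Module.finrank_prod, Module.finrank_self, Module.finrank_fintype_fun_eq_card,
    Fintype.card_coe] at this
  have := C.card_upper
  omega

/-- The labels of the regions around a crossing. -/
noncomputable def faceCorners (c : ℕ) : (C.Face → ℝ) →ₗ[ℝ] Corners :=
  open Classical in
  if h : ∃ v : C.Point, v.1.fromRight = true ∧ v.1.crossing = c then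
    let v := h.choose
    let p (d : C.Point × Bool) : (C.Face → ℝ) →ₗ[ℝ] ℝ := LinearMap.proj (Quot.mk _ d)
    ((p (C.opp v, true)).prod (p (v, false))).prod ((p (v, true)).prod (p (C.opp v, false)))
  else 0

theorem faceCorners_of_not {c : ℕ} (h : ∀ v ∈ C.visits, v.crossing ≠ c) : C.faceCorners c = 0 := by
  rw [faceCorners, dif_neg]
  rintro ⟨v, -, hv⟩
  exact h v.1 v.2 hv

theorem opp_opp (v : C.Point) : C.opp (C.opp v) = v := Subtype.ext (Visit.opp_opp v.1)

theorem faceCorners_eq (g : C.Face → ℝ) {v : C.Point} (hv : v.1.fromRight = true) :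
    C.faceCorners v.1.crossing g =
      ((g (Quot.mk _ (C.opp v, true)), g (Quot.mk _ (v, false))),
        (g (Quot.mk _ (v, true)), g (Quot.mk _ (C.opp v, false)))) := by
  have h : ∃ w : C.Point, w.1.fromRight = true ∧ w.1.crossing = v.1.crossing := ⟨v, hv, rfl⟩
  have hw : h.choose = v :=
    Subtype.ext (C.eq_of_fromRight h.choose.2 v.2 h.choose_spec.1 hv h.choose_spec.2)
  rw [faceCorners, dif_pos h, hw]
  rfl

theorem source_faceCorners (g : C.Face → ℝ) (v : C.Point) :
    (C.faceCorners v.1.crossing g).source v.1.fromRight =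
      (g (Quot.mk _ (C.opp v, v.1.fromRight)), g (Quot.mk _ (v, false))) ∧
    (C.faceCorners v.1.crossing g).target v.1.fromRight =
      (g (Quot.mk _ (v, true)), g (Quot.mk _ (C.opp v, !v.1.fromRight))) := by
  cases hv : v.1.fromRight
  · have hw : (C.opp v).1.fromRight = true := by
      change v.1.opp.fromRight = true
      rw [Visit.fromRight_opp, hv, Bool.not_false]
    have := C.faceCorners_eq g hw
    rw [opp_opp] at this
    change C.faceCorners v.1.crossing g = _ at this
    rw [this]
    exact ⟨rfl, rfl⟩
  · rw [C.faceCorners_eq g hv]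
    exact ⟨rfl, rfl⟩

/-- The region to the left of an edge is seen from the forward dart and the one to the right from
the backward dart; `faceStep` carries each of them to a corner at the other end. -/
theorem target_eq_source_next (g : C.Face → ℝ) (v : C.Point) :
    (C.faceCorners (C.next v).1.crossing g).source (C.next v).1.fromRight =
      (C.faceCorners v.1.crossing g).target v.1.fromRight := by
  have h : ∀ d : C.Point × Bool, (Quot.mk _ (C.faceStep d) : C.Face) = Quot.mk _ d := fun d =>
    (Quot.sound (r := fun d e : C.Point × Bool => e = C.faceStep d) rfl).symm
  rw [(C.source_faceCorners g _).1, (C.source_faceCorners g v).2]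
  have e1 : C.faceStep (v, true) = (C.opp (C.next v), (C.next v).1.fromRight) := by simp [faceStep]
  have e2 : C.faceStep (C.next v, false) = (C.opp v, !v.1.fromRight) := by simp [faceStep, prev]
  rw [← e1, ← e2, h, h]

/-- A function on the faces labels the regions. -/
noncomputable def faceLabels (v : C.Point) : (C.Face → ℝ) →ₗ[ℝ] Labels × (ℝ × ℝ) :=
  (LinearMap.pi C.faceCorners).prod ((LinearMap.proj (Quot.mk _ (C.opp v, v.1.fromRight))).prod
    (LinearMap.proj (Quot.mk _ (v, false))))

theorem faceLabels_injective (v : C.Point) : Function.Injective (C.faceLabels v) := by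
  intro g g' h
  have h1 : ∀ c, C.faceCorners c g = C.faceCorners c g' := fun c =>
    congrFun (congrArg Prod.fst h) c
  funext f
  obtain ⟨⟨w, b⟩, rfl⟩ := Quot.exists_rep f
  cases b
  · have := congrArg (fun X => (Corners.source w.1.fromRight X).2) (h1 w.1.crossing)
    simpa only [(C.source_faceCorners _ w).1] using this
  · have := congrArg (fun X => (Corners.target w.1.fromRight X).1) (h1 w.1.crossing)
    simpa only [(C.source_faceCorners _ w).2] using this

theorem faceLabels_mem (hC : C.visits ≠ []) (g : C.Face → ℝ) :
    C.faceLabels ⟨C.visits.head hC, List.head_mem hC⟩ g ∈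
      regionLabels C.visits ⊓ supportedLabels C.visits := by
  have hlen : 0 < C.visits.length := List.length_pos_iff.2 hC
  set v0 : C.Point := ⟨C.visits.head hC, List.head_mem hC⟩ with hv0
  have he : (C.faceLabels v0 g).2 = (C.faceCorners v0.1.crossing g).source v0.1.fromRight :=
    (C.source_faceCorners g v0).1.symm
  have hstep : ∀ i (hi : i < C.visits.length),
      (C.faceCorners (C.visits[(i + 1) % C.visits.length]'(Nat.mod_lt _ hlen)).crossing g).source
        (C.visits[(i + 1) % C.visits.length]'(Nat.mod_lt _ hlen)).fromRight =
      (C.faceCorners C.visits[i].crossing g).target C.visits[i].fromRight := by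
    intro i hi
    have := C.target_eq_source_next g ⟨C.visits[i], List.getElem_mem hi⟩
    rwa [C.next_getElem i hi] at this
  refine ⟨⟨agree_of_source_eq (fun _ => ?_) fun i hi => ?_, ?_⟩, fun c hc => ?_⟩
  · rw [he, hv0]
    simp only [List.head_eq_getElem]
    rfl
  · have := hstep i (by omega)
    simp only [Nat.mod_eq_of_lt hi] at this
    exact this
  · rw [endLabels_eq_target hC, he, hv0]
    have := hstep (C.visits.length - 1) (by omega)
    simp only [Nat.sub_add_cancel hlen, Nat.mod_self] at this
    simp only [List.getLast_eq_getElem, List.head_eq_getElem]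
    exact this.symm
  · change C.faceCorners c g = 0
    rw [C.faceCorners_of_not hc, LinearMap.zero_apply]

/-- Every function on the faces is a labelling, and each face occurs at some corner. Together with
planarity this gives the lower bound that matches `finrank_regionLabels_le`. -/
theorem card_face_le_finrank (hC : C.visits ≠ []) :
    Nat.card C.Face ≤ Module.finrank ℝ ↥(regionLabels C.visits ⊓ supportedLabels C.visits) := by
  have : Fintype C.Face := Fintype.ofFinite _
  rw [Nat.card_eq_fintype_card, ← Module.finrank_fintype_fun_eq_card ℝ]
  refine LinearMap.finrank_le_finrank_of_injective (f := (C.faceLabels _).codRestrict _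
    (C.faceLabels_mem hC)) fun g g' h => C.faceLabels_injective _ (congrArg Subtype.val h)

end GaussCode

/-! ### The bigon of a second move. -/

namespace Corners

/-- The label on one side of an edge. -/
def side (b : Bool) (e : ℝ × ℝ) : ℝ := if b then e.2 else e.1

/-- The difference of the labels of the two regions at the ends of a bigon with crossings `x`, `y`. -/
def bigonDiff (f b : Bool) (x y : Corners) : ℝ :=
  if b then x.1.2 - y.2.1 else if f then y.1.1 - x.1.1 else y.2.2 - x.2.2

/-- The sum of the labels of the two regions at the ends of a bigon, minus twice the label of the
bigon. -/
def bigonSum (f b : Bool) (x y : Corners) : ℝ :=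
  if b then x.1.2 + y.2.1 - 2 * x.2.1 else if f then y.1.1 + x.1.1 - 2 * x.2.2
  else y.2.2 + x.2.2 - 2 * x.1.1

/-- The labels at the crossings of a bigon whose region has the label zero, where `e` and `e'` are the
labels along the two strands after the bigon has been removed. -/
def bigonMap (f b : Bool) (e e' : ℝ × ℝ) : Corners × Corners :=
  match f, b with
  | true, true => ((e, (0, e'.2)), ((e.1, 0), e'))
  | true, false => ((e, (e'.2, 0)), (e', (e.2, 0)))
  | false, true => (((e'.1, e.1), (0, e.2)), ((e'.1, 0), e))
  | false, false => (((0, e.1), (e'.1, e.2)), ((0, e'.1), e))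

/-- The labels at the crossings of a bigon that vanish except for the label of the bigon. -/
def bigonLoop (f b : Bool) : Corners × Corners :=
  if b then (((0, 0), (1, 0)), ((0, 1), (0, 0))) else
    if f then (((0, 0), (0, 1)), ((0, 0), (0, 1))) else (((1, 0), (0, 0)), ((1, 0), (0, 0)))

variable {f b : Bool} {x y : Corners}

/-- The regions beside the bigon meet both crossings and their terms cancel. If `p` and `q` are the
labels at the two ends and `t` is that of the bigon, what remains is `(p - t) ^ 2 - (q - t) ^ 2 = (p
- q) * (p + q - 2 * t)`. -/
theorem bigon_spec (h : source (!f) y = target f x) (h' : PairAgree b (!f) x f y) :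
    x.form - y.form = bigonDiff f b x y * bigonSum f b x y ∧
    (bigonDiff f b x y = 0 → source f x = target (!f) y ∧
      pairTarget b (!f) x f y = pairSource b (!f) x f y ∧
      side (f == b) (target (!f) y) = side (!f) (pairSource b (!f) x f y)) ∧
    (bigonDiff f b x y = 0 → bigonSum f b x y = 0 → target (!f) y = 0 →
      pairSource b (!f) x f y = 0 → x = 0 ∧ y = 0) := by
  obtain ⟨⟨x1, x2⟩, x3, x4⟩ := x
  obtain ⟨⟨y1, y2⟩, y3, y4⟩ := y
  cases f <;> cases b <;>
  · simp only [source, target, PairAgree, Bool.not_true, Bool.not_false, Bool.false_eq_true,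
      if_true, if_false, Prod.mk.injEq] at h h'
    obtain ⟨h1, h2⟩ := h
    obtain ⟨h3, h4⟩ := h'
    subst_vars
    simp only [bigonDiff, bigonSum, form, side, source, target, pairSource, pairTarget,
      Bool.not_true, Bool.not_false, Bool.false_eq_true, if_true, if_false, Prod.mk.injEq,
      Prod.mk_eq_zero, beq_self_eq_true, Bool.true_beq, Bool.false_beq]
    refine ⟨by ring, fun h => ?_, fun h h' => ?_⟩
    · refine ⟨⟨?_, ?_⟩, ⟨?_, ?_⟩, ?_⟩ <;> first | trivial | linarith
    · rintro ⟨k1, k2⟩ ⟨k3, k4⟩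
      refine ⟨⟨⟨?_, ?_⟩, ?_, ?_⟩, ⟨?_, ?_⟩, ?_, ?_⟩ <;> linarith

/-- The hypothesis says that the labels on the facing sides of the two strands agree. The bigon
separates this region into two ends, which inherit the common label. -/
theorem bigonMap_spec {e e' : ℝ × ℝ} (h : side (f == b) e = side (!f) e')
    (hx : (bigonMap f b e e').1 = x) (hy : (bigonMap f b e e').2 = y) :
    source (!f) y = target f x ∧ PairAgree b (!f) x f y ∧ source f x = e ∧ target (!f) y = e ∧
      pairSource b (!f) x f y = e' ∧ pairTarget b (!f) x f y = e' ∧ bigonDiff f b x y = 0 := by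
  obtain ⟨e1, e2⟩ := e
  obtain ⟨e3, e4⟩ := e'
  subst hx hy
  cases f <;> cases b <;>
  · simp only [side, Bool.not_true, Bool.not_false, Bool.false_eq_true, if_true, if_false,
      beq_self_eq_true, Bool.true_beq, Bool.false_beq] at h
    subst h
    simp [bigonMap, bigonDiff, source, target, pairSource, pairTarget, PairAgree]

/-- This labelling is the direction that decouples `bigonSum` from all other forms: only the label
of the bigon varies. -/
theorem bigonLoop_spec (hx : (bigonLoop f b).1 = x) (hy : (bigonLoop f b).2 = y) :
    source (!f) y = target f x ∧ PairAgree b (!f) x f y ∧ source f x = 0 ∧ target (!f) y = 0 ∧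
      pairSource b (!f) x f y = 0 ∧ pairTarget b (!f) x f y = 0 ∧ bigonDiff f b x y = 0 ∧
      bigonSum f b x y = -2 := by
  subst hx hy
  cases f <;> cases b <;>
    simp [bigonLoop, bigonDiff, bigonSum, source, target, pairSource, pairTarget, PairAgree]

end Corners

section Bigon

variable (v w : Visit) (b : Bool) (l m : List Visit)

/-- The difference of the labels of the regions at the two ends of a bigon. -/
def bigonDiff : Labels × (ℝ × ℝ) →ₗ[ℝ] ℝ where
  toFun x := Corners.bigonDiff v.fromRight b (x.1 v.crossing) (x.1 w.crossing)
  map_add' x y := by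
    unfold Corners.bigonDiff
    split_ifs <;> simp <;> ring
  map_smul' r x := by
    unfold Corners.bigonDiff
    split_ifs <;> simp <;> ring

/-- The sum of the labels of the regions at the two ends of a bigon, minus twice the label of the
bigon. -/
def bigonSum : Labels × (ℝ × ℝ) →ₗ[ℝ] ℝ where
  toFun x := Corners.bigonSum v.fromRight b (x.1 v.crossing) (x.1 w.crossing)
  map_add' x y := by
    unfold Corners.bigonSum
    split_ifs <;> simp <;> ring
  map_smul' r x := by
    unfold Corners.bigonSum
    split_ifs <;> simp <;> ring

/-- The difference of the labels of two regions on different sides of the strands that are to be moved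
over each other. -/
def sideDiff : Labels × (ℝ × ℝ) →ₗ[ℝ] ℝ where
  toFun x := Corners.side (v.fromRight == b) x.2 -
    Corners.side (!v.fromRight) (endLabels x.1 l x.2)
  map_add' x y := by
    simp only [Prod.fst_add, Prod.snd_add, endLabels_add, Corners.side]
    split_ifs <;> ring
  map_smul' r x := by
    simp only [Prod.smul_fst, Prod.smul_snd, endLabels_smul, Corners.side]
    split_ifs <;> simp only [smul_eq_mul, RingHom.id_apply] <;> ring

/-- The labels after the removal of a bigon. -/
noncomputable def removeBigon : Labels × (ℝ × ℝ) →ₗ[ℝ] Labels × (ℝ × ℝ) :=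
  (replaceAt v.crossing 0 (replaceAt w.crossing 0 (LinearMap.fst ℝ _ _))).prod (endMap [v, w])

/-- The labels after the creation of a bigon. -/
noncomputable def insertBigon : Labels × (ℝ × ℝ) →ₗ[ℝ] Labels × (ℝ × ℝ) :=
  have h (e e' d d' : ℝ × ℝ) : Corners.bigonMap v.fromRight b (e + d) (e' + d') =
      Corners.bigonMap v.fromRight b e e' + Corners.bigonMap v.fromRight b d d' := by
    cases v.fromRight <;> cases b <;> simp [Corners.bigonMap]
  have h' (r : ℝ) (e e' : ℝ × ℝ) : Corners.bigonMap v.fromRight b (r • e) (r • e') =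
      r • Corners.bigonMap v.fromRight b e e' := by
    cases v.fromRight <;> cases b <;> simp [Corners.bigonMap]
  let k : Labels × (ℝ × ℝ) →ₗ[ℝ] Corners × Corners :=
    { toFun := fun x => Corners.bigonMap v.fromRight b x.2 (endLabels x.1 l x.2)
      map_add' := fun x y => by simp only [Prod.fst_add, Prod.snd_add, endLabels_add, h]
      map_smul' := fun r x => by
        simp only [Prod.smul_fst, Prod.smul_snd, endLabels_smul, h', RingHom.id_apply] }
  (replaceAt v.crossing ((LinearMap.fst ℝ _ _).comp k) (replaceAt w.crossing
    ((LinearMap.snd ℝ _ _).comp k) (LinearMap.fst ℝ _ _))).prod (LinearMap.snd ℝ _ _)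

/-- The conditions on the lists of visits in a second Reidemeister move. -/
structure SecondFresh (v w : Visit) (L : List Visit) : Prop where
  vw : v.crossing ≠ w.crossing
  strand : v.upper = w.upper
  sign : v.positive ≠ w.positive
  rest : ∀ x ∈ L, x.crossing ≠ v.crossing ∧ x.crossing ≠ w.crossing

variable {v w b l m}

theorem SecondFresh.fromRight (h : SecondFresh v w (l ++ m)) : w.fromRight = !v.fromRight := by
  have h1 := h.strand
  have h2 := h.sign
  unfold Visit.fromRight
  rw [← h1]
  revert h2
  generalize v.upper = p
  generalize v.positive = q
  generalize w.positive = r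
  revert p q r
  decide

theorem SecondFresh.sign_eq (h : SecondFresh v w (l ++ m)) : w.sign = -v.sign := by
  have h2 := h.sign
  unfold Visit.sign
  revert h2
  generalize v.positive = q
  generalize w.positive = r
  revert q r
  decide

theorem mem_regionLabels_bigon (h : SecondFresh v w (l ++ m)) {s : Labels} {e : ℝ × ℝ} :
    (s, e) ∈ regionLabels ([v, w] ++ l ++ visitPair b v.opp w.opp ++ m) ↔
      (s v.crossing).source v.fromRight = e ∧
      (s w.crossing).source (!v.fromRight) = (s v.crossing).target v.fromRight ∧
      Agree s l ((s w.crossing).target (!v.fromRight)) ∧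
      Corners.pairSource b (!v.fromRight) (s v.crossing) v.fromRight (s w.crossing) =
        endLabels s l ((s w.crossing).target (!v.fromRight)) ∧
      Corners.PairAgree b (!v.fromRight) (s v.crossing) v.fromRight (s w.crossing) ∧
      Agree s m (Corners.pairTarget b (!v.fromRight) (s v.crossing) v.fromRight (s w.crossing)) ∧
      endLabels s m (Corners.pairTarget b (!v.fromRight) (s v.crossing) v.fromRight
        (s w.crossing)) = e := by
  simp only [mem_regionLabels, agree_append, endLabels_append, endLabels_visitPair,
    agree_visitPair, Visit.fromRight_opp, Visit.crossing_opp, h.fromRight, Bool.not_not]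
  simp only [Agree, endLabels, h.fromRight, and_true, and_assoc]

theorem second_perm (v w : Visit) (b : Bool) (l m : List Visit) :
    ([v, w] ++ l ++ visitPair b v.opp w.opp ++ m).Perm ([v, v.opp, w, w.opp] ++ (l ++ m)) := by
  rw [← Multiset.coe_eq_coe]
  simp only [← Multiset.coe_add, Multiset.coe_eq_coe.2 (visitPair_perm b v.opp w.opp)]
  rw [show (([v, w] : List Visit) : Multiset Visit) = {v} + {w} from rfl,
    show (([v.opp, w.opp] : List Visit) : Multiset Visit) = {v.opp} + {w.opp} from rfl,
    show (([v, v.opp, w, w.opp] : List Visit) : Multiset Visit) =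
      {v} + ({v.opp} + ({w} + {w.opp})) from rfl]
  abel

theorem crossingSum_bigon (h : SecondFresh v w (l ++ m)) {R : Type*} [Ring R] (f : ℕ → R) :
    crossingSum f ([v, w] ++ l ++ visitPair b v.opp w.opp ++ m) =
      v.sign * (f v.crossing - f w.crossing) + crossingSum f (l ++ m) := by
  rw [crossingSum_perm f (second_perm v w b l m),
    crossingSum_append _ [v, v.opp, w, w.opp],
    show [v, v.opp, w, w.opp] = [v, v.opp] ++ [w, w.opp] from rfl, crossingSum_append,
    crossingSum_opp, crossingSum_opp, h.sign_eq]
  push_cast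
  noncomm_ring

theorem agree_update {s : Labels} (h : SecondFresh v w (l ++ m)) (x y : Corners) {L : List Visit}
    (hL : ∀ u ∈ L, u ∈ l ++ m) (e : ℝ × ℝ) :
    (Agree (Function.update (Function.update s w.crossing y) v.crossing x) L e ↔ Agree s L e) ∧
      endLabels (Function.update (Function.update s w.crossing y) v.crossing x) L e =
        endLabels s L e := by
  have : ∀ u ∈ L, Function.update (Function.update s w.crossing y) v.crossing x u.crossing =
      s u.crossing := fun u hu => by
    rw [Function.update_of_ne (h.rest u (hL u hu)).1, Function.update_of_ne (h.rest u (hL u hu)).2]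
  exact ⟨agree_congr this, endLabels_congr this⟩

/-- If both ends carry the same label, they can be merged into one region when the strands are
pulled apart; that region borders both strands. -/
theorem removeBigon_mem (h : SecondFresh v w (l ++ m)) {x : Labels × (ℝ × ℝ)}
    (hx : x ∈ regionLabels ([v, w] ++ l ++ visitPair b v.opp w.opp ++ m))
    (hx0 : bigonDiff v w b x = 0) :
    removeBigon v w x ∈ regionLabels (l ++ m) ∧ sideDiff v b l (removeBigon v w x) = 0 := by
  obtain ⟨s, e⟩ := x
  obtain ⟨h1, h2, h3, h4, h5, h6, h7⟩ := (mem_regionLabels_bigon h).1 hx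
  obtain ⟨-, k, -⟩ := Corners.bigon_spec h2 h5
  obtain ⟨k1, k2, k3⟩ := k hx0
  have hl := fun e => agree_update (s := s) h 0 0 (L := l) (by simp +contextual) e
  have hm := fun e => agree_update (s := s) h 0 0 (L := m) (by simp +contextual) e
  have he : removeBigon v w (s, e) = (Function.update (Function.update s w.crossing 0) v.crossing 0,
      (s w.crossing).target (!v.fromRight)) := by
    rw [← h.fromRight]
    rfl
  rw [he]
  rw [k2, h4] at h6 h7
  refine ⟨⟨?_, ?_⟩, ?_⟩
  · simp only [agree_append, hl, hm]
    exact ⟨h3, h6⟩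
  · simp only [endLabels_append, hl, hm]
    rw [h7, ← k1, h1]
  · simp only [sideDiff, LinearMap.coe_mk, AddHom.coe_mk, hl, k3, h4, sub_self]

theorem insertBigon_mem (h : SecondFresh v w (l ++ m)) {x : Labels × (ℝ × ℝ)}
    (hx : x ∈ regionLabels (l ++ m)) (hx0 : sideDiff v b l x = 0) :
    insertBigon v w b l x ∈ regionLabels ([v, w] ++ l ++ visitPair b v.opp w.opp ++ m) ∧
      bigonDiff v w b (insertBigon v w b l x) = 0 := by
  obtain ⟨s, e⟩ := x
  obtain ⟨h1, h2⟩ := hx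
  simp only [agree_append, endLabels_append] at h1 h2
  obtain ⟨X, hX⟩ : ∃ X, (Corners.bigonMap v.fromRight b e (endLabels s l e)).1 = X := ⟨_, rfl⟩
  obtain ⟨Y, hY⟩ : ∃ Y, (Corners.bigonMap v.fromRight b e (endLabels s l e)).2 = Y := ⟨_, rfl⟩
  obtain ⟨k1, k2, k3, k4, k5, k6, k7⟩ := Corners.bigonMap_spec (sub_eq_zero.1 hx0) hX hY
  have hl := fun e => agree_update (s := s) h X Y (L := l) (by simp +contextual) e
  have hm := fun e => agree_update (s := s) h X Y (L := m) (by simp +contextual) e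
  have he : insertBigon v w b l (s, e) =
      (Function.update (Function.update s w.crossing Y) v.crossing X, e) := by
    rw [← hX, ← hY]
    rfl
  have hv : Function.update (Function.update s w.crossing Y) v.crossing X v.crossing = X := by simp
  have hw : Function.update (Function.update s w.crossing Y) v.crossing X w.crossing = Y := by
    rw [Function.update_of_ne h.vw.symm, Function.update_self]
  rw [he]
  refine ⟨(mem_regionLabels_bigon h).2 ?_, ?_⟩
  · simp only [hl, hm, hv, hw, k1, k2, k3, k4, k5, k6, h1, h2, true_and]
  · simp only [bigonDiff, LinearMap.coe_mk, AddHom.coe_mk, hv, hw, k7]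

end Bigon

/-! ### Planarity and invariance under second moves. -/

section BigonPlanar

variable {v w : Visit} {b : Bool} {l m : List Visit}

theorem removeBigon_supported {x : Labels × (ℝ × ℝ)}
    (hx : x ∈ supportedLabels ([v, w] ++ l ++ visitPair b v.opp w.opp ++ m)) :
    removeBigon v w x ∈ supportedLabels (l ++ m) := by
  intro c hc
  change Function.update (Function.update x.1 w.crossing 0) v.crossing 0 c = 0
  by_cases h1 : c = v.crossing
  · rw [h1, Function.update_self]
  by_cases h2 : c = w.crossing
  · rw [Function.update_of_ne h1, h2, Function.update_self]
  rw [Function.update_of_ne h1, Function.update_of_ne h2]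
  refine hx c fun u hu => ?_
  simp only [List.mem_append, List.mem_cons, List.not_mem_nil, or_false,
    (visitPair_perm b v.opp w.opp).mem_iff] at hu hc
  rintro rfl
  rcases hu with (((rfl | rfl) | hu) | rfl | rfl) | hu
  exacts [h1 rfl, h2 rfl, hc u (.inl hu) rfl, h1 rfl, h2 rfl, hc u (.inr hu) rfl]

/-- Removal forgets only the label of the bigon, and `bigonSum` recovers it. -/
theorem eq_zero_of_removeBigon (h : SecondFresh v w (l ++ m)) {x : Labels × (ℝ × ℝ)}
    (hx : x ∈ regionLabels ([v, w] ++ l ++ visitPair b v.opp w.opp ++ m))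
    (h0 : bigonDiff v w b x = 0) (h1 : removeBigon v w x = 0) (h2 : bigonSum v w b x = 0) :
    x = 0 := by
  obtain ⟨s, e⟩ := x
  obtain ⟨k1, k2, k3, k4, k5, k6, k7⟩ := (mem_regionLabels_bigon h).1 hx
  obtain ⟨-, j1, j2⟩ := Corners.bigon_spec k2 k5
  have he : (s w.crossing).target (!v.fromRight) = 0 := by
    have := congrArg Prod.snd h1
    rwa [← h.fromRight]
  have hs : ∀ c, c ≠ v.crossing → c ≠ w.crossing → s c = 0 := by
    intro c h3 h4
    have : Function.update (Function.update s w.crossing 0) v.crossing 0 c = 0 :=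
      congrFun (congrArg Prod.fst h1) c
    rwa [Function.update_of_ne h3, Function.update_of_ne h4] at this
  have hl : endLabels s l 0 = 0 := by
    rw [endLabels_congr (s' := 0) fun u hu => hs _ (h.rest u (by simp [hu])).1
      (h.rest u (by simp [hu])).2]
    exact (agree_zero l).2
  rw [he, hl] at k4
  obtain ⟨j3, j4⟩ := j2 h0 h2 he k4
  have he' : e = 0 := by rw [← k1, (j1 h0).1, he]
  refine Prod.ext (funext fun c => ?_) he'
  by_cases h3 : c = v.crossing
  · rw [h3]; exact j3
  by_cases h4 : c = w.crossing
  · rw [h4]; exact j4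
  exact hs c h3 h4

theorem finrank_le_ker_add_one {A : Type*} [AddCommGroup A] [Module ℝ A] [Module.Finite ℝ A]
    (f : A →ₗ[ℝ] ℝ) : Module.finrank ℝ A ≤ Module.finrank ℝ (LinearMap.ker f) + 1 := by
  have h1 := f.finrank_range_add_finrank_ker
  have h2 := (LinearMap.range f).finrank_le
  rw [Module.finrank_self] at h2
  omega

/-- If a second Reidemeister move relates two diagrams on the sphere, then the strands that are moved
over each other are at the boundary of the same region. -/
theorem sideDiff_eq_zero (h : SecondFresh v w (l ++ m)) {D E : KnotDiagram}
    (hD : D.visits = [v, w] ++ l ++ visitPair b v.opp w.opp ++ m) (hE : E.visits = l ++ m)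
    {x : Labels × (ℝ × ℝ)} (hx : x ∈ regionLabels (l ++ m)) : sideDiff v b l x = 0 := by
  have hne : D.visits ≠ [] := by rw [hD]; simp
  have hlen : D.visits.length = E.visits.length + 4 := by
    rw [hD, hE, (second_perm v w b l m).length_eq]
    simp
  have h1 : D.visits.length + 4 ≤ 2 * Nat.card D.Face := D.planar.resolve_left hne
  have h2 := D.toGaussCode.card_face_le_finrank hne
  have h3 := E.toGaussCode.finrank_regionLabels_le
  let A := regionLabels D.visits ⊓ supportedLabels D.visits
  let B := regionLabels E.visits ⊓ supportedLabels E.visits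
  have : Module.Finite ℝ A := D.toGaussCode.finite_regionLabels
  have : Module.Finite ℝ B := E.toGaussCode.finite_regionLabels
  -- Let `E` have `n` crossings. Planarity of `D` gives `dim A ≥ n + 4`, while `dim B ≤ n + 2`.
  -- Passing from `A` to `K` costs at most one dimension, and `K` embeds into `J × ℝ`. Hence `dim J
  -- ≥ n + 2 ≥ dim B`, and `sideDiff` vanishes on `B`.
  let K := LinearMap.ker ((bigonDiff v w b).comp A.subtype)
  let J := LinearMap.ker ((sideDiff v b l).comp B.subtype)
  have hK : Module.finrank ℝ A ≤ Module.finrank ℝ K + 1 := finrank_le_ker_add_one _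
  have hA : ∀ x : A, x.1 ∈ regionLabels ([v, w] ++ l ++ visitPair b v.opp w.opp ++ m) ∧
      x.1 ∈ supportedLabels ([v, w] ++ l ++ visitPair b v.opp w.opp ++ m) := by
    rw [← hD]
    exact fun x => x.2
  have hB' : ∀ y ∈ regionLabels (l ++ m), y ∈ supportedLabels (l ++ m) → y ∈ B := by
    rw [← hE]
    exact fun y h1 h2 => ⟨h1, h2⟩
  have hmem : ∀ x : K, removeBigon v w x.1.1 ∈ B := fun x =>
    hB' _ (removeBigon_mem h (hA x.1).1 x.2).1 (removeBigon_supported (hA x.1).2)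
  have hmem' : ∀ x : K, (⟨_, hmem x⟩ : B) ∈ J := fun x =>
    (removeBigon_mem h (hA x.1).1 x.2).2
  let F : K →ₗ[ℝ] J × ℝ :=
    ((((removeBigon v w).comp (A.subtype.comp K.subtype)).codRestrict B hmem).codRestrict J
      hmem').prod ((bigonSum v w b).comp (A.subtype.comp K.subtype))
  have hF : Function.Injective F := by
    rw [injective_iff_map_eq_zero]
    intro x hx
    refine Subtype.ext (Subtype.ext ?_)
    refine eq_zero_of_removeBigon h (b := b) (hA x.1).1 x.2 ?_ ?_
    · exact congrArg (fun y : J × ℝ => y.1.1.1) hx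
    · exact congrArg (fun y : J × ℝ => y.2) hx
  have hFK := LinearMap.finrank_le_finrank_of_injective hF
  have : Module.Free ℝ J := Module.Free.of_divisionRing ℝ J
  rw [Module.finrank_prod, Module.finrank_self] at hFK
  have hJ := ((sideDiff v b l).comp B.subtype).finrank_range_add_finrank_ker
  have hzero : Module.finrank ℝ (LinearMap.range ((sideDiff v b l).comp B.subtype)) = 0 := by
    change _ + Module.finrank ℝ J = Module.finrank ℝ B at hJ
    change Nat.card D.Face ≤ Module.finrank ℝ A at h2
    change 2 * Module.finrank ℝ B ≤ _ at h3
    omega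
  rw [Submodule.finrank_eq_zero, LinearMap.range_eq_bot] at hzero
  obtain ⟨s, e⟩ := x
  classical
  -- The dimension count concerns labels supported on the crossings of `E`; cutting off the others
  -- does not affect `sideDiff`.
  let s' : Labels := fun c => if ∃ u ∈ l ++ m, u.crossing = c then s c else 0
  have hs : ∀ u ∈ l ++ m, s u.crossing = s' u.crossing := fun u hu =>
    (if_pos ⟨u, hu, rfl⟩).symm
  have hl : endLabels s l e = endLabels s' l e := endLabels_congr fun u hu => hs u (by simp [hu])
  have hB : ((s', e) : Labels × (ℝ × ℝ)) ∈ B := by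
    refine ⟨?_, fun c hc => if_neg ?_⟩
    · rw [hE]
      exact ⟨(agree_congr hs).1 hx.1, (endLabels_congr hs).symm.trans hx.2⟩
    · rw [hE] at hc
      push Not
      exact hc
  have : Corners.side (v.fromRight == b) e -
      Corners.side (!v.fromRight) (endLabels s' l e) = 0 := LinearMap.congr_fun hzero ⟨_, hB⟩
  rwa [← hl] at this

/-- On the larger diagram the form is that of the smaller one plus a multiple of `bigonDiff *
bigonSum`. By `HasSig.add_mul` the product may be replaced by the restriction to equal end labels,
and there removing and inserting the bigon are isometries. The two signs cancel in the writhe. -/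
theorem regionSig_second (h : SecondFresh v w (l ++ m)) {D E : KnotDiagram}
    (hD : D.visits = [v, w] ++ l ++ visitPair b v.opp w.opp ++ m) (hE : E.visits = l ++ m)
    {σ τ : ℤ} (hσ : D.HasRegionSig σ) (hτ : E.HasRegionSig τ) : σ = τ := by
  unfold KnotDiagram.HasRegionSig at hσ hτ
  rw [hD, crossingSum_bigon h] at hσ
  rw [hE] at hτ
  have hR := isWeightedSumSq_regionForm (l ++ m)
  obtain ⟨ρ, hρ⟩ := hR.exists_hasSig (regionLabels ([v, w] ++ l ++ visitPair b v.opp w.opp ++ m) ⊓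
    LinearMap.ker (bigonDiff v w b))
  have hform : ∀ (s : Labels) (x y : Corners) (e e' : ℝ × ℝ), regionForm (l ++ m)
      (Function.update (Function.update s w.crossing y) v.crossing x, e) =
      regionForm (l ++ m) (s, e') := fun s x y e e' => by
    refine crossingSum_congr fun u hu => ?_
    dsimp only
    rw [Function.update_of_ne (h.rest u hu).1, Function.update_of_ne (h.rest u hu).2]
  have hρτ := hρ.eq_of_isometry hτ (removeBigon v w)
    (fun x hx => ⟨(removeBigon_mem h hx.1 hx.2).1, hform _ _ _ _ _⟩) (insertBigon v w b l)
    fun x hx => ⟨insertBigon_mem h hx (sideDiff_eq_zero h hD hE hx), hform _ _ _ _ _⟩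
  obtain ⟨X, hX⟩ : ∃ X, (Corners.bigonLoop v.fromRight b).1 = X := ⟨_, rfl⟩
  obtain ⟨Y, hY⟩ : ∃ Y, (Corners.bigonLoop v.fromRight b).2 = Y := ⟨_, rfl⟩
  obtain ⟨k1, k2, k3, k4, k5, k6, k7, k8⟩ := Corners.bigonLoop_spec hX hY
  -- The labelling supported in the bigon serves as the vector `z` of `HasSig.add_mul`.
  obtain ⟨s, hs⟩ : ∃ s : Labels, s = Function.update (Function.update (0 : Labels) w.crossing Y)
    v.crossing X := ⟨_, rfl⟩
  have sv : s v.crossing = X := by rw [hs, Function.update_self]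
  have sw : s w.crossing = Y := by
    rw [hs, Function.update_of_ne h.vw.symm, Function.update_self]
  have sr : ∀ u ∈ l ++ m, s u.crossing = 0 := fun u hu => by
    rw [hs, Function.update_of_ne (h.rest u hu).1, Function.update_of_ne (h.rest u hu).2]
    rfl
  have sl : ∀ L : List Visit, (∀ u ∈ L, u ∈ l ++ m) → Agree s L 0 ∧ endLabels s L 0 = 0 :=
    fun L hL => by
      rw [agree_congr (s' := 0) fun u hu => sr u (hL u hu),
        endLabels_congr (s' := 0) fun u hu => sr u (hL u hu)]
      exact agree_zero L
  obtain ⟨l1, l2⟩ := sl l (by simp +contextual)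
  obtain ⟨m1, m2⟩ := sl m (by simp +contextual)
  have hsign : (v.sign : ℝ) ≠ 0 := by unfold Visit.sign; split_ifs <;> simp
  have := hρ.add_mul (Q := regionForm ([v, w] ++ l ++ visitPair b v.opp w.opp ++ m))
    (α := (v.sign : ℝ) • bigonSum v w b) hR ?_ (z := (s, 0)) ?_ ?_ ?_ ?_
  · have := this.unique hσ
    rw [hρτ] at this
    simp only [mul_zero, sub_self, zero_add] at this
    omega
  · rintro ⟨s, e⟩ hx
    obtain ⟨j1, j2, j3, j4, j5, j6, j7⟩ := (mem_regionLabels_bigon h).1 hx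
    have := (Corners.bigon_spec j2 j5).1
    simp only [regionForm, crossingSum_bigon h, this]
    simp only [LinearMap.smul_apply, bigonDiff, bigonSum, LinearMap.coe_mk, AddHom.coe_mk,
      smul_eq_mul]
    ring
  · refine (mem_regionLabels_bigon h).2 ?_
    simp only [sv, sw, k1, k2, k3, k4, k5, k6, l1, l2, m1, m2, and_self]
  · simp only [bigonDiff, LinearMap.coe_mk, AddHom.coe_mk, sv, sw, k7]
  · simp only [bigonSum, LinearMap.smul_apply, LinearMap.coe_mk, AddHom.coe_mk, sv, sw, k8]
    simpa using hsign
  · rintro ⟨t, e⟩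
    refine crossingSum_congr fun u hu => ?_
    simp [sr u hu]

end BigonPlanar

/-! ### Isotopy invariance and the lower bound. -/

namespace KnotDiagram

theorem eq_or_eq_opp (D : KnotDiagram) {v w : Visit} (hv : v ∈ D.visits) (hw : w ∈ D.visits)
    (h : w.crossing = v.crossing) : w = v ∨ w = v.opp := by
  have := D.sign_eq w hw v hv h
  obtain ⟨a, p, q⟩ := v
  obtain ⟨a', p', q'⟩ := w
  simp only at h this
  subst h this
  cases p <;> cases p' <;> simp [Visit.opp]

theorem HasRegionSig.eq_of_move {D E : KnotDiagram} (h : ReidemeisterMove D.visits E.visits)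
    {σ τ : ℤ} (hσ : D.HasRegionSig σ) (hτ : E.HasRegionSig τ) : σ = τ := by
  have hnd := D.nodup
  have hop := fun {v w} => D.eq_or_eq_opp (v := v) (w := w)
  -- A crossing has only two visits, and the code has no repetitions. So the crossings of the
  -- triangle are distinct and do not occur elsewhere.
  have hthird : ∀ {u v w : Visit} {L : List Visit},
      D.visits.Perm ([u, u.opp, v, v.opp, w, w.opp] ++ L) → ThirdFresh u v w L := by
    intro u v w L hp
    have hnd' := hp.nodup_iff.1 hnd
    have hm : ∀ {x}, x ∈ [u, u.opp, v, v.opp, w, w.opp] ++ L → x ∈ D.visits :=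
      fun hx => hp.mem_iff.2 hx
    simp only [List.cons_append, List.nil_append, List.nodup_cons, List.mem_cons, not_or] at hnd' hm
    refine ⟨fun e => ?_, fun e => ?_, fun e => ?_,
      fun x hx => ⟨fun e => ?_, fun e => ?_, fun e => ?_⟩⟩
    · rcases hop (hm (by simp)) (hm (by simp)) e with e | e <;> simp_all
    · rcases hop (hm (by simp)) (hm (by simp)) e with e | e <;> simp_all
    · rcases hop (hm (by simp)) (hm (by simp)) e with e | e <;> simp_all
    · rcases hop (hm (by simp)) (hm (by simp [hx])) e with e | e <;> simp_all
    · rcases hop (hm (by simp)) (hm (by simp [hx])) e with e | e <;> simp_all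
    · rcases hop (hm (by simp)) (hm (by simp [hx])) e with e | e <;> simp_all
  unfold HasRegionSig at hσ hτ
  generalize hL : D.visits = L at *
  generalize hM : E.visits = M at *
  cases h with
  | rotate l m => exact regionSig_rotate hσ hτ
  | relabel f hf => exact regionSig_relabel hf hσ hτ
  | first v l =>
    refine regionSig_first (fun w hw e => ?_) hσ hτ
    simp only [List.nodup_cons, List.mem_cons, not_or] at hnd
    rcases hop (v := v) (w := w) (by simp) (by simp [hw]) e with rfl | rfl
    · exact hnd.1.2 hw
    · exact hnd.2.1 hw
  | second v w b l m h1 h2 =>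
    have hp := second_perm v w b l m
    have hnd' := hp.nodup_iff.1 hnd
    have hm : ∀ {x}, x = v ∨ x = v.opp ∨ x = w ∨ x = w.opp ∨ x ∈ l ++ m →
        x ∈ [v, w] ++ l ++ visitPair b v.opp w.opp ++ m :=
      fun hx => hp.mem_iff.2 (by simpa using hx)
    simp only [List.cons_append, List.nil_append, List.nodup_cons, List.mem_cons, not_or] at hnd'
    refine regionSig_second (D := D) (E := E) 
      ⟨fun e => ?_, h1, h2, fun x hx => ⟨fun e => ?_, fun e => ?_⟩⟩ hL hM
      (by rw [HasRegionSig, hL]; exact hσ) (by rw [HasRegionSig, hM]; exact hτ)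
    · rcases hop (hm (by simp)) (hm (by simp)) e with e | e <;> simp_all
    · rcases hop (hm (by simp)) (hm (.inr (.inr (.inr (.inr hx))))) e
        with e | e <;> simp_all
    · rcases hop (hm (by simp)) (hm (.inr (.inr (.inr (.inr hx))))) e
        with e | e <;> simp_all
  | third u v w a b c l m n hu hv hw h1 h2 h3 =>
    exact regionSig_third ⟨hu, hv, hw, h1, h2, h3⟩ (hthird (thirdMove_perm u v w a b c l m n))
      (.inl ⟨rfl, rfl⟩) hσ hτ
  | third' u v w a b c l m n hu hv hw h1 h2 h3 =>
    exact regionSig_third ⟨hu, hv, hw, h1, h2, h3⟩ (hthird (thirdMove_perm' u v w a b c l m n))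
      (.inr ⟨rfl, rfl⟩) hσ hτ

/-- Transitivity needs a value at the intermediate diagram, which is why existence of `τ` for every
diagram was established. -/
theorem Isotopic.regionSig_eq {D E : KnotDiagram} (h : D.Isotopic E) {σ τ : ℤ}
    (hσ : D.HasRegionSig σ) (hτ : E.HasRegionSig τ) : σ = τ := by
  induction h generalizing σ τ with
  | rel D E h => exact hσ.eq_of_move h hτ
  | refl D => exact hσ.unique hτ
  | symm D E _ ih => exact (ih hτ hσ).symm
  | trans D E G _ _ ih ih' =>
    obtain ⟨ρ, hρ⟩ := E.exists_hasRegionSig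
    exact (ih hσ hρ).trans (ih' hρ hτ)

theorem hasRegionSig_unknot : unknot.HasRegionSig 0 := by
  refine ⟨Empty, inferInstance, nofun, nofun, nofun, fun _ => ⟨0, Submodule.zero_mem _, nofun⟩,
    fun _ _ => ?_, ?_⟩
  · simp [regionForm, unknot, crossingSum]
  · simp [unknot, crossingSum]

/-- The signature of the region form bounds the unknotting number from below. -/
theorem HasRegionSig.abs_le_of_unknotsIn {D : KnotDiagram} {n : ℕ} (h : UnknotsIn n D) {τ : ℤ}
    (hτ : D.HasRegionSig τ) : |τ| ≤ 4 * n := by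
  induction h generalizing τ with
  | isotopy h => simp [h.regionSig_eq hτ hasRegionSig_unknot]
  | @change n D E c h hc hn ih =>
    obtain ⟨ρ, hρ⟩ := E.exists_hasRegionSig
    obtain ⟨π, hπ⟩ := (E.changeCrossing c).exists_hasRegionSig
    have h1 := h.regionSig_eq hτ hρ
    have h2 := hρ.abs_sub_le hπ
    have h3 := ih hπ
    rw [abs_le] at *
    push_cast
    omega

end KnotDiagram

/-! ### The region signatures of the trefoil and of `10_6`. -/

section Corner

/-- The label of the region behind a crossing, to the left. -/
def backLeft (c : ℕ) : Labels × (ℝ × ℝ) →ₗ[ℝ] ℝ :=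
  (LinearMap.fst ℝ ℝ ℝ).comp ((LinearMap.fst ℝ _ _).comp 
    ((LinearMap.proj c).comp (LinearMap.fst ℝ Labels _)))

/-- The label of the region behind a crossing, to the right. -/
def backRight (c : ℕ) : Labels × (ℝ × ℝ) →ₗ[ℝ] ℝ :=
  (LinearMap.snd ℝ ℝ ℝ).comp ((LinearMap.fst ℝ _ _).comp 
    ((LinearMap.proj c).comp (LinearMap.fst ℝ Labels _)))

/-- The label of the region in front of a crossing, to the left. -/
def frontLeft (c : ℕ) : Labels × (ℝ × ℝ) →ₗ[ℝ] ℝ :=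
  (LinearMap.fst ℝ ℝ ℝ).comp ((LinearMap.snd ℝ _ _).comp 
    ((LinearMap.proj c).comp (LinearMap.fst ℝ Labels _)))

/-- The label of the region in front of a crossing, to the right. -/
def frontRight (c : ℕ) : Labels × (ℝ × ℝ) →ₗ[ℝ] ℝ :=
  (LinearMap.snd ℝ ℝ ℝ).comp ((LinearMap.snd ℝ _ _).comp 
    ((LinearMap.proj c).comp (LinearMap.fst ℝ Labels _)))

end Corner

namespace KnotDiagram

/-- The five regions fall into colours with three and two members. The form is definite on each
colour modulo constants, with two positive squares and one negative one; the writhe is three. The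
coefficients of either colour multiply to plus or minus the determinant `3`. -/
theorem hasRegionSig_trefoil : trefoil.HasRegionSig (4) := by
  refine ⟨Fin 3, inferInstance, ![2, 3 / 2, -3],
    ![backRight 0 - (1 / 2 : ℝ) • frontLeft 0 - (1 / 2 : ℝ) • frontLeft 1,
      frontLeft 0 - frontLeft 1,
      frontRight 0 - backLeft 0],
    ?_, fun y => ?_, ?_, ?_⟩
  · intro i
    fin_cases i <;> norm_num
  -- Labels of the five regions by back substitution. One region of each colour gets the label zero,
  -- since constants on a colour lie in the radical.
  · let z : Fin 5 → ℝ := ![y 0 + 1 / 2 * y 1, y 1, y 2, 0, 0]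
    refine ⟨(fun c => [((z 3, z 0), (z 1, z 2)), ((z 3, z 1), (z 4, z 2)), ((z 3, z 4), (z 0,
      z 2))].getD c 0, (z 3, z 0)), ?_, fun i => ?_⟩
    · simp [mem_regionLabels, trefoil, trefoilCode, Agree, endLabels, Corners.source,
      Corners.target,
        Visit.fromRight]
    · fin_cases i <;> simp [backLeft, backRight, frontLeft, frontRight, z]
  · rintro ⟨s, e⟩ hx
    simp only [mem_regionLabels, trefoil, trefoilCode, Agree, endLabels, Corners.source,
      Corners.target,
      Visit.fromRight, Bool.true_beq, Bool.false_beq, Bool.not_true, if_true,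
      Bool.false_eq_true, if_false, and_true] at hx
    simp [regionForm, trefoil, trefoilCode, crossingSum, Visit.fromRight, Visit.sign,
      Corners.form, Fin.sum_univ_succ, backLeft, backRight, frontLeft, frontRight]
    generalize s 0 = x0 at *
    generalize s 1 = x1 at *
    generalize s 2 = x2 at *
    clear s
    obtain ⟨e, e'⟩ := e
    obtain ⟨⟨a0, b0⟩, ⟨c0, d0⟩⟩ := x0
    obtain ⟨⟨a1, b1⟩, ⟨c1, d1⟩⟩ := x1
    obtain ⟨⟨a2, b2⟩, ⟨c2, d2⟩⟩ := x2
    simp only [Prod.mk.injEq] at hx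
    obtain ⟨hx, hx'⟩ := hx
    simp only [and_assoc] at hx
    casesm* _ ∧ _
    subst_vars
    ring
  · simp [crossingSum, trefoil, trefoilCode, Visit.fromRight, Visit.sign, Fin.sum_univ_succ]

/-- The diagram is alternating, so each colour is definite: seven regions give six negative squares,
five regions give four positive ones, and the writhe is `-6`. In both colours the absolute values of
the coefficients multiply to the determinant `37`. -/
theorem hasRegionSig_tenSix : tenSix.HasRegionSig (-8) := by
  refine ⟨Fin 10, inferInstance, ![-2, -(3 / 2), -(4 / 3), -(5 / 4), 7, -2, 17 / 7, 27 / 17,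
    37 / 27, -(37 / 10)],
    ![frontLeft 0 - (1 / 2 : ℝ) • frontLeft 1 - (1 / 2 : ℝ) • backRight 0,
      frontLeft 1 - (2 / 3 : ℝ) • frontLeft 2 - (1 / 3 : ℝ) • backRight 0,
      frontLeft 2 - (3 / 4 : ℝ) • frontLeft 3 - (1 / 4 : ℝ) • backRight 0,
      frontLeft 3 - (1 / 5 : ℝ) • backRight 0 - (4 / 5 : ℝ) • frontLeft 4,
      backLeft 0 - (2 / 7 : ℝ) • frontLeft 5 - (5 / 7 : ℝ) • frontRight 0,
      backLeft 5 - (1 / 2 : ℝ) • backRight 0 - (1 / 2 : ℝ) • frontLeft 4,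
      frontLeft 5 - (10 / 17 : ℝ) • frontRight 0 - (7 / 17 : ℝ) • frontRight 8,
      frontRight 0 - (17 / 27 : ℝ) • backLeft 7 - (10 / 27 : ℝ) • frontRight 8,
      backLeft 7 - frontRight 8,
      backRight 0 - frontLeft 4],
    ?_, fun y => ?_, ?_, ?_⟩
  · intro i
    fin_cases i <;> norm_num
  -- Again the triangular system is solved with one label of each colour set to zero.
  · let z : Fin 12 → ℝ := ![y 0 + 1 / 2 * y 1 + 1 / 3 * y 2 + 1 / 4 * y 3 + 4 / 5 * y 9,
    y 1 + 2 / 3 * y 2 + 1 / 2 * y 3 + 3 / 5 * y 9, y 2 + 3 / 4 * y 3 + 2 / 5 * y 9,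
    y 3 + 1 / 5 * y 9, y 4 + 2 / 7 * y 6 + 15 / 17 * y 7 + 5 / 9 * y 8, y 5 + 1 / 2 * y 9,
    y 6 + 10 / 17 * y 7 + 10 / 27 * y 8, y 7 + 17 / 27 * y 8, y 8, y 9, 0, 0]
    refine ⟨(fun c => [((z 4, z 9), (z 0, z 7)), ((z 4, z 0), (z 1, z 7)), ((z 4, z 1), (z 2,
      z 7)), ((z 4, z 2), (z 3, z 7)), ((z 4, z 3), (z 10, z 7)), ((z 5, z 4), (z 6, z 10)),
      ((z 5, z 6), (z 4, z 9)), ((z 8, z 10), (z 9, z 7)), ((z 8, z 9), (z 10, z 11)), ((z 6,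
      z 10), (z 9, z 11))].getD c 0, (z 9, z 7)), ?_, fun i => ?_⟩
    · simp [mem_regionLabels, tenSix, tenSixCode, Agree, endLabels, Corners.source, Corners.target,
        Visit.fromRight]
    · fin_cases i <;> simp [backLeft, backRight, frontLeft, frontRight, z] <;> ring
  · rintro ⟨s, e⟩ hx
    simp only [mem_regionLabels, tenSix, tenSixCode, Agree, endLabels, Corners.source,
      Corners.target,
      Visit.fromRight, Bool.true_beq, Bool.false_beq, Bool.not_true, Bool.not_false, if_true,
      Bool.false_eq_true, if_false, and_true] at hx
    simp [regionForm, tenSix, tenSixCode, crossingSum, Visit.fromRight, Visit.sign, Corners.form,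
      Fin.sum_univ_succ, backLeft, backRight, frontLeft, frontRight]
    generalize s 0 = x0 at *
    generalize s 1 = x1 at *
    generalize s 2 = x2 at *
    generalize s 3 = x3 at *
    generalize s 4 = x4 at *
    generalize s 5 = x5 at *
    generalize s 6 = x6 at *
    generalize s 7 = x7 at *
    generalize s 8 = x8 at *
    generalize s 9 = x9 at *
    clear s
    obtain ⟨e, e'⟩ := e
    obtain ⟨⟨a0, b0⟩, ⟨c0, d0⟩⟩ := x0
    obtain ⟨⟨a1, b1⟩, ⟨c1, d1⟩⟩ := x1
    obtain ⟨⟨a2, b2⟩, ⟨c2, d2⟩⟩ := x2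
    obtain ⟨⟨a3, b3⟩, ⟨c3, d3⟩⟩ := x3
    obtain ⟨⟨a4, b4⟩, ⟨c4, d4⟩⟩ := x4
    obtain ⟨⟨a5, b5⟩, ⟨c5, d5⟩⟩ := x5
    obtain ⟨⟨a6, b6⟩, ⟨c6, d6⟩⟩ := x6
    obtain ⟨⟨a7, b7⟩, ⟨c7, d7⟩⟩ := x7
    obtain ⟨⟨a8, b8⟩, ⟨c8, d8⟩⟩ := x8
    obtain ⟨⟨a9, b9⟩, ⟨c9, d9⟩⟩ := x9
    simp only [Prod.mk.injEq] at hx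
    obtain ⟨hx, hx'⟩ := hx
    simp only [and_assoc] at hx
    -- The equations along the edges identify all corners of the same region. After substitution the
    -- diagonalisation is a polynomial identity.
    casesm* _ ∧ _
    subst_vars
    ring
  · simp [crossingSum, tenSix, tenSixCode, Visit.fromRight, Visit.sign, Fin.sum_univ_succ]

end KnotDiagram

/-! ### The unknotting numbers of the summands. -/

namespace KnotDiagram

/-- The hypothesis is `k ≤ ⌈|τ| / 4⌉` without division. -/
theorem HasRegionSig.le_unknottingNumber {D : KnotDiagram} {τ : ℤ} (hτ : D.HasRegionSig τ) {k : ℕ}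
    (hk : 4 * (k : ℤ) < |τ| + 4) : (k : ℕ∞) ≤ D.unknottingNumber :=
  KnotDiagram.le_unknottingNumber fun m hm h => by
    have := hτ.abs_le_of_unknotsIn h
    omega

theorem unknottingNumber_trefoil : trefoil.unknottingNumber = 1 :=
  le_antisymm (unknottingNumber_le unknotsIn_trefoil)
    (hasRegionSig_trefoil.le_unknottingNumber (k := 1) (by norm_num))

theorem unknottingNumber_tenSix :
    tenSix.unknottingNumber = 2 ∨ tenSix.unknottingNumber = 3 := by
  have h1 : tenSix.unknottingNumber ≤ (3 : ℕ) := unknottingNumber_le unknotsIn_tenSix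
  have h2 : ((2 : ℕ) : ℕ∞) ≤ tenSix.unknottingNumber :=
    hasRegionSig_tenSix.le_unknottingNumber (by norm_num)
  obtain ⟨n, hn⟩ := ENat.ne_top_iff_exists.1 (ne_top_of_le_ne_top (ENat.natCast_ne_top 3) h1)
  rw [← hn] at h1 h2 ⊢
  norm_cast at h1 h2 ⊢
  omega

end KnotDiagram

/-! ### The Seifert signature in coordinates. -/

open QuadraticMap QuadraticForm in
/-- The difference of the two indices of inertia is the signature. -/
theorem HasSig.sigPos_sub_sigNeg {M : Type*} [AddCommGroup M] [Module ℝ M] [FiniteDimensional ℝ M]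
    {Q : QuadraticForm ℝ M} {σ : ℤ} (h : HasSig ⊤ (fun x => Q x) σ) :
    (sigPos Q : ℤ) - sigNeg Q = σ := by
  classical
  obtain ⟨w, ⟨e⟩⟩ := Q.equivalent_weightedSumSquares
  rw [sigPos_of_equiv_weightedSumSquares ⟨e⟩, sigNeg_of_equiv_weightedSumSquares ⟨e⟩]
  -- The zero weights are dropped, because `HasSig` admits only nonzero coefficients.
  refine HasSig.unique ⟨{i // w i ≠ 0}, inferInstance, fun i => w i.1,
    fun i => (LinearMap.proj i.1).comp e.toLinearEquiv.toLinearMap, fun i => i.2, fun y => ?_,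
    fun x _ => ?_, ?_⟩ h
  · refine ⟨e.toLinearEquiv.symm fun i => if hi : w i ≠ 0 then y ⟨i, hi⟩ else 0, trivial, fun i => ?_⟩
    simp [i.2]
  · have h1 : Q x = ∑ i, w i * (e.toLinearEquiv x i) ^ 2 := by
      rw [← e.map_app x, weightedSumSquares_apply]
      simp [pow_two]
    have h2 := Finset.sum_subtype (p := fun i => w i ≠ 0) (F := inferInstance)
      (Finset.univ.filter fun i => w i ≠ 0) (by simp) fun i => w i * (e.toLinearEquiv x i) ^ 2
    rw [h1, ← Finset.sum_filter_of_ne (p := fun i => w i ≠ 0), h2]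
    · rfl
    · rintro i - hi h0
      simp [h0] at hi
  · rw [sum_sign]
    congr 2
    · rw [Set.ncard_eq_toFinset_card', Set.toFinset_card, Fintype.card_congr
        (Equiv.subtypeSubtypeEquivSubtype fun h : (0 : ℝ) < w _ => h.ne')]
      rfl
    · rw [Set.ncard_eq_toFinset_card', Set.toFinset_card]
      exact Fintype.card_congr ((Equiv.subtypeEquivRight fun i => neg_pos).trans
        (Equiv.subtypeSubtypeEquivSubtype fun h : w _ < 0 => h.ne))

/-- The index of the visit before the one with index `i`, in a closed list of `n` visits. -/
def prevIndex (n i : ℕ) : ℕ := (i + n - 1) % n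

/-- The crossings in a list of visits: the index of the upper and of the lower visit, and whether the
crossing is positive. -/
def crossingList (L : List Visit) : List (ℕ × ℕ × Bool) :=
  (L.filter Visit.upper).map fun v => (L.idxOf v, L.idxOf v.opp, v.positive)

/-- The cycles of the projection, as functions of the indices of the edges. -/
def indexCycles (L : List Visit) : Submodule ℝ (ℕ → ℝ) where
  carrier := {x | (∀ i, L.length ≤ i → x i = 0) ∧ ∀ c ∈ crossingList L,
    x (prevIndex L.length c.1) + x (prevIndex L.length c.2.1) = x c.1 + x c.2.1}
  zero_mem' := by simp
  add_mem' := by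
    rintro x y ⟨hx, hx'⟩ ⟨hy, hy'⟩
    refine ⟨fun i hi => by simp [hx i hi, hy i hi], fun c hc => ?_⟩
    simp only [Pi.add_apply]
    linarith [hx' c hc, hy' c hc]
  smul_mem' := by
    rintro r x ⟨hx, hx'⟩
    refine ⟨fun i hi => by simp [hx i hi], fun c hc => ?_⟩
    simp only [Pi.smul_apply, smul_eq_mul, ← mul_add, hx' c hc]

/-- The symmetrized Seifert form in terms of the indices of the edges. -/
def indexForm (L : List Visit) (x : ℕ → ℝ) : ℝ :=
  ((crossingList L).map fun c => 2 * if c.2.2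
    then (x (prevIndex L.length c.1) - x c.2.1) * x (prevIndex L.length c.2.1)
    else (x (prevIndex L.length c.2.1) - x c.1) * x c.2.1).sum

namespace GaussCode

variable (C : GaussCode)

/-- A cycle as a function of the indices of the edges. -/
def indexMap : C.Cycles →ₗ[ℝ] ℕ → ℝ where
  toFun f i := if h : i < C.visits.length then f.1 ⟨C.visits[i], List.getElem_mem h⟩ else 0
  map_add' f g := by
    ext i
    simp only [Pi.add_apply]
    split_ifs <;> simp
  map_smul' r f := by
    ext i
    simp only [Pi.smul_apply]
    split_ifs <;> simp

theorem indexMap_idxOf (f : C.Cycles) (v : C.Point) :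
    C.indexMap f (C.visits.idxOf v.1) = f.1 v := by
  have h := List.idxOf_lt_length_of_mem v.2
  simp only [indexMap, LinearMap.coe_mk, AddHom.coe_mk, h, dif_pos, List.getElem_idxOf]

theorem prev_eq_getElem (v : C.Point) : ∃ h : prevIndex C.visits.length (C.visits.idxOf v.1) <
    C.visits.length, C.prev v = ⟨C.visits[prevIndex C.visits.length (C.visits.idxOf v.1)],
      List.getElem_mem h⟩ := by
  have hi := List.idxOf_lt_length_of_mem v.2
  have h : prevIndex C.visits.length (C.visits.idxOf v.1) < C.visits.length :=
    Nat.mod_lt _ (by omega)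
  have e : v = ⟨C.visits[C.visits.idxOf v.1], List.getElem_mem hi⟩ :=
    Subtype.ext (List.getElem_idxOf hi).symm
  exact ⟨h, Subtype.ext ((congrArg (fun w => (C.prev w).1) e).trans (C.prev_getElem _ hi))⟩

theorem indexMap_prev (f : C.Cycles) (v : C.Point) :
    C.indexMap f (prevIndex C.visits.length (C.visits.idxOf v.1)) = f.1 (C.prev v) := by
  obtain ⟨h, e⟩ := C.prev_eq_getElem v
  rw [e]
  exact dif_pos h

theorem indexMap_mem (f : C.Cycles) : C.indexMap f ∈ indexCycles C.visits := by
  refine ⟨fun i hi => dif_neg (by omega), fun c hc => ?_⟩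
  obtain ⟨v, hv, rfl⟩ := List.mem_map.1 hc
  have hv := (List.mem_filter.1 hv).1
  have h1 := C.indexMap_idxOf f ⟨v, hv⟩
  have h2 := C.indexMap_idxOf f (C.opp ⟨v, hv⟩)
  have h3 := C.indexMap_prev f ⟨v, hv⟩
  have h4 := C.indexMap_prev f (C.opp ⟨v, hv⟩)
  simp only [opp] at h1 h2 h3 h4
  simp only [h1, h2, h3, h4]
  exact f.2 ⟨v, hv⟩

/-- `crossingList` has one entry per crossing. The conservation law is symmetric in the two visits,
so its validity at the upper visits is enough. -/
theorem exists_indexMap_eq {x : ℕ → ℝ} (hx : x ∈ indexCycles C.visits) :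
    ∃ f, C.indexMap f = x := by
  obtain ⟨h0, hx⟩ := hx
  have hprev : ∀ v : C.Point, C.visits.idxOf (C.prev v).1 =
      prevIndex C.visits.length (C.visits.idxOf v.1) := fun v => by
    obtain ⟨h, e⟩ := C.prev_eq_getElem v
    rw [e]
    exact List.Nodup.idxOf_getElem C.nodup _ h
  have hup : ∀ v : C.Point, v.1.upper = true → x (C.visits.idxOf (C.prev v).1) +
      x (C.visits.idxOf (C.prev (C.opp v)).1) = x (C.visits.idxOf v.1) +
      x (C.visits.idxOf (C.opp v).1) := fun v hv => by
    rw [hprev, hprev]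
    exact hx _ (List.mem_map.2 ⟨v.1, List.mem_filter.2 ⟨v.2, hv⟩, rfl⟩)
  refine ⟨⟨fun v => x (C.visits.idxOf v.1), fun v => ?_⟩, ?_⟩
  · by_cases hv : v.1.upper = true
    · exact hup v hv
    · have := hup (C.opp v) (by simpa [opp, Visit.opp] using hv)
      rw [opp_opp] at this
      linarith
  · ext i
    simp only [indexMap, LinearMap.coe_mk, AddHom.coe_mk]
    split_ifs with h
    · rw [List.Nodup.idxOf_getElem C.nodup _ h]
    · exact (h0 i (by omega)).symm

/-- The sum over the points becomes a sum over a list that can be evaluated. The factor `2` in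
`indexForm` comes from the symmetrisation. -/
theorem indexForm_indexMap (f : C.Cycles) :
    indexForm C.visits (C.indexMap f) = C.seifertForm f f + C.seifertForm f f := by
  obtain ⟨G, hG⟩ : ∃ G : Visit → ℝ, ∀ v, G v = if v.upper then (if v.positive
    then (C.indexMap f (prevIndex C.visits.length (C.visits.idxOf v)) -
      C.indexMap f (C.visits.idxOf v.opp)) *
        C.indexMap f (prevIndex C.visits.length (C.visits.idxOf v.opp))
    else (C.indexMap f (prevIndex C.visits.length (C.visits.idxOf v.opp)) -
      C.indexMap f (C.visits.idxOf v)) * C.indexMap f (C.visits.idxOf v.opp)) else 0 :=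
    ⟨_, fun v => rfl⟩
  have h1 : C.seifertForm f f = ∑ v : C.Point, G v.1 := by
    simp only [seifertForm, LinearMap.sum_apply]
    refine Finset.sum_congr rfl fun v _ => ?_
    rw [hG, show v.1.opp = (C.opp v).1 from rfl, C.indexMap_idxOf, C.indexMap_idxOf,
      C.indexMap_prev, C.indexMap_prev]
    by_cases hv : v.1.upper = true
    · by_cases hp : v.1.positive = true <;> simp [hv, hp, jump, lowerRight, flow]
    · simp [hv]
  have h2 : ∑ v : C.Point, G v.1 = (C.visits.map G).sum := by
    classical
    rw [← Fin.sum_univ_fun_getElem, ← (C.nodup.getEquiv C.visits).sum_comp]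
    rfl
  have h3 : ∀ L : List Visit, (L.map G).sum = ((L.filter Visit.upper).map G).sum := by
    intro L
    induction L with
    | nil => rfl
    | cons v L ih =>
      by_cases hv : v.upper = true
      · simp [hv, ih]
      · rw [List.filter_cons_of_neg (by simpa using hv), List.map_cons, List.sum_cons, ih, hG,
          if_neg hv, zero_add]
  rw [h1, h2, h3, ← two_mul, ← List.sum_map_mul_left, indexForm, crossingList, List.map_map]
  congr 1
  refine List.map_congr_left fun v hv => ?_
  rw [hG, if_pos (List.mem_filter.1 hv).2]
  rfl

end GaussCode

theorem KnotDiagram.signature_eq {D : KnotDiagram} {σ : ℤ}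
    (h : HasSig (indexCycles D.visits) (indexForm D.visits) σ) : D.signature = σ := by
  refine HasSig.sigPos_sub_sigNeg (h.of_surjective D.indexMap (fun y hy => ?_)
    fun f _ => ⟨D.indexMap_mem f, ?_⟩)
  · obtain ⟨f, rfl⟩ := D.exists_indexMap_eq hy
    exact ⟨f, trivial, rfl⟩
  · rw [D.indexForm_indexMap]
    rfl

/-! ### The signatures of the connected sums. -/

namespace KnotDiagram

/-- The cycles have dimension `26 - 13 + 1 = 14`. Eight squares occur, in accordance with the genera
one and three of the summands; the remaining six dimensions form the radical. -/
theorem signature_trefoil_connectedSum_tenSix :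
    (trefoil.connectedSum tenSix).signature = 2 := by
  have hL : crossingList (trefoil.connectedSum tenSix).visits =
      [(0, 3, true), (2, 5, true), (4, 1, true), (6, 13, false), (8, 15, false), (10, 17, false),
       (12, 21, true), (14, 7, false), (16, 9, false), (18, 25, false), (20, 23, false),
       (22, 11, true), (24, 19, false)] := by
    decide +kernel
  have hn : (trefoil.connectedSum tenSix).visits.length = 26 := rfl
  let p : ℕ → (ℕ → ℝ) →ₗ[ℝ] ℝ := LinearMap.proj
  refine signature_eq ⟨Fin 8, inferInstance, ![2, -(5 / 2), -(12 / 5), 7 / 4, 6 / 7, 5 / 6,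
    16 / 5, -(37 / 16)],
    ![p 25 + (1 / 2 : ℝ) • p 0 + p 1 - (1 / 2 : ℝ) • p 2 - (1 / 2 : ℝ) • p 6 - p 7 - p 8 - p 9
        - (1 / 2 : ℝ) • p 10 + (2 : ℝ) • p 12,
      p 0 + (4 / 5 : ℝ) • p 1 - p 2 - (1 / 5 : ℝ) • p 6 - (2 / 5 : ℝ) • p 7 - (2 / 5 : ℝ) • p 8
        - (2 / 5 : ℝ) • p 9 - (1 / 5 : ℝ) • p 10 + (4 / 5 : ℝ) • p 12,
      p 1 - (1 / 4 : ℝ) • p 6 - (1 / 2 : ℝ) • p 7 - (1 / 2 : ℝ) • p 8 - (1 / 2 : ℝ) • p 9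
        - (1 / 4 : ℝ) • p 10 + p 12,
      p 6 + (2 / 7 : ℝ) • p 7 - (2 / 7 : ℝ) • p 8 - (2 / 7 : ℝ) • p 9 - (1 / 7 : ℝ) • p 10
        - (4 / 7 : ℝ) • p 12,
      p 7 + (1 / 6 : ℝ) • p 8 - p 9 - (1 / 2 : ℝ) • p 10 + (1 / 3 : ℝ) • p 12,
      p 8 - (3 / 5 : ℝ) • p 10 - (2 / 5 : ℝ) • p 12,
      p 10 - (21 / 16 : ℝ) • p 12 + (5 / 16 : ℝ) • p 20,
      p 12 - p 20],
    ?_, fun y => ?_, fun x hx => ?_, ?_⟩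
  · intro i
    fin_cases i <;> norm_num
  -- The fourteen entries are the flows on the edges `25`, `0`, `1`, `2`, `6` to `12`, `18`, `19`,
  -- `20`. The eight pivots come from back substitution in the triangular forms, and the six others
  -- are set to zero.
  · let z : Fin 14 → ℝ := ![y 0 - 1 / 2 * y 1 - 3 / 5 * y 2 + 1 / 4 * y 3 + 3 / 7 * y 4
    + 1 / 2 * y 5 + 4 / 5 * y 6 + 1 / 4 * y 7,
      y 1 - 4 / 5 * y 2,
      y 2 + 1 / 4 * y 3 + 3 / 7 * y 4 + 1 / 2 * y 5 + 4 / 5 * y 6 + 1 / 4 * y 7, 0,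
      y 3 - 2 / 7 * y 4 + 1 / 3 * y 5 + 1 / 5 * y 6 + 17 / 16 * y 7,
      y 4 - 1 / 6 * y 5 + 2 / 5 * y 6 + 1 / 8 * y 7, y 5 + 3 / 5 * y 6 + 19 / 16 * y 7, 0,
      y 6 + 21 / 16 * y 7, 0, y 7, 0, 0, 0]
    let x : List ℝ := [z 1, z 2, 0, z 0 - z 1, z 0 - z 2, z 0, z 4, z 5, z 6, 0, z 8, 0, z 10,
      z 0 - z 4 + z 10,
      z 0 - z 5 + z 10, z 0 - z 6 + z 10, z 0 + z 10, z 0 - z 8 + z 10, 0, 0, 0, -z 10,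
      z 8 - z 10, z 8 - z 10, z 8 - z 10, z 0]
    refine ⟨fun k => x.getD k 0, ⟨fun k hk => List.getD_eq_default _ _ hk, ?_⟩, fun i => ?_⟩
    · rw [hL, hn]
      simp only [List.forall_mem_cons, prevIndex]
      simp [x]
      and_intros <;> ring
    · fin_cases i <;> simp [p, x, z] <;> ring
  · have h := hx.2
    rw [hL, hn] at h
    simp [prevIndex] at h
    obtain ⟨h0, h1, h2, h3, h4, h5, h6, h7, h8, h9, h10, h11, h12⟩ := h
    -- Twelve independent conservation laws express the other flows by the fourteen free ones. The
    -- order of elimination is such that each equation has a single new unknown.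
    have e3 : x 3 = x 25 + x 2 - x 0 := by linarith only [h0]
    have e4 : x 4 = x 0 + x 3 - x 1 := by linarith only [h2]
    have e5 : x 5 = x 1 + x 4 - x 2 := by linarith only [h1]
    have e13 : x 13 = x 5 + x 12 - x 6 := by linarith only [h3]
    have e14 : x 14 = x 6 + x 13 - x 7 := by linarith only [h7]
    have e15 : x 15 = x 7 + x 14 - x 8 := by linarith only [h4]
    have e16 : x 16 = x 8 + x 15 - x 9 := by linarith only [h8]
    have e17 : x 17 = x 9 + x 16 - x 10 := by linarith only [h5]
    have e21 : x 21 = x 11 + x 20 - x 12 := by linarith only [h6]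
    have e22 : x 22 = x 10 + x 21 - x 11 := by linarith only [h11]
    have e23 : x 23 = x 19 + x 22 - x 20 := by linarith only [h10]
    have e24 : x 24 = x 18 + x 23 - x 19 := by linarith only [h12]
    rw [indexForm, hL, hn]
    simp [prevIndex, Fin.sum_univ_succ, p]
    simp only [e3, e4, e5, e13, e14, e15, e16, e17, e21, e22, e23, e24]
    ring
  · simp [Fin.sum_univ_succ]

theorem signature_trefoil_connectedSum_mirror_tenSix :
    (trefoil.connectedSum tenSix.mirror).signature = -6 := by
  have hL : crossingList (trefoil.connectedSum tenSix.mirror).visits =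
      [(0, 3, true), (2, 5, true), (4, 1, true), (7, 14, true), (9, 16, true), (11, 22, false),
       (13, 6, true), (15, 8, true), (17, 10, true), (19, 24, true), (21, 12, false),
       (23, 20, true), (25, 18, true)] := by
    decide +kernel
  have hn : (trefoil.connectedSum tenSix.mirror).visits.length = 26 := rfl
  let p : ℕ → (ℕ → ℝ) →ₗ[ℝ] ℝ := LinearMap.proj
  refine signature_eq ⟨Fin 8, inferInstance, ![-6, -(11 / 6), -(12 / 11), -(7 / 4), -(6 / 7),
    -(5 / 6), -(16 / 5), 37 / 16],
    ![p 25 - (1 / 6 : ℝ) • p 0 - (1 / 3 : ℝ) • p 1 + (1 / 6 : ℝ) • p 2 - (1 / 6 : ℝ) • p 6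
        - (1 / 3 : ℝ) • p 7 - (1 / 3 : ℝ) • p 8 - (1 / 3 : ℝ) • p 9 - (1 / 6 : ℝ) • p 10
        + (2 / 3 : ℝ) • p 12,
      p 0 + (4 / 11 : ℝ) • p 1 - p 2 - (1 / 11 : ℝ) • p 6 - (2 / 11 : ℝ) • p 7
        - (2 / 11 : ℝ) • p 8 - (2 / 11 : ℝ) • p 9 - (1 / 11 : ℝ) • p 10 + (4 / 11 : ℝ) • p 12,
      p 1 - (1 / 4 : ℝ) • p 6 - (1 / 2 : ℝ) • p 7 - (1 / 2 : ℝ) • p 8 - (1 / 2 : ℝ) • p 9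
        - (1 / 4 : ℝ) • p 10 + p 12,
      p 6 + (2 / 7 : ℝ) • p 7 - (2 / 7 : ℝ) • p 8 - (2 / 7 : ℝ) • p 9 - (1 / 7 : ℝ) • p 10
        - (4 / 7 : ℝ) • p 12,
      p 7 + (1 / 6 : ℝ) • p 8 - p 9 - (1 / 2 : ℝ) • p 10 + (1 / 3 : ℝ) • p 12,
      p 8 - (3 / 5 : ℝ) • p 10 - (2 / 5 : ℝ) • p 12,
      p 10 - (11 / 16 : ℝ) • p 12 - (5 / 16 : ℝ) • p 20,
      p 12 - p 20],
    ?_, fun y => ?_, fun x hx => ?_, ?_⟩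
  · intro i
    fin_cases i <;> norm_num
  -- The same free edges and pivots as for the first sum; only the coefficients of the triangular
  -- system differ.
  · let z : Fin 14 → ℝ := ![y 0 + 1 / 6 * y 1 + 3 / 11 * y 2 + 1 / 4 * y 3 + 3 / 7 * y 4
    + 1 / 2 * y 5 + 4 / 5 * y 6 - 1 / 4 * y 7,
      y 1 - 4 / 11 * y 2,
      y 2 + 1 / 4 * y 3 + 3 / 7 * y 4 + 1 / 2 * y 5 + 4 / 5 * y 6 - 1 / 4 * y 7, 0,
      y 3 - 2 / 7 * y 4 + 1 / 3 * y 5 + 1 / 5 * y 6 + 15 / 16 * y 7,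
      y 4 - 1 / 6 * y 5 + 2 / 5 * y 6 - 1 / 8 * y 7, y 5 + 3 / 5 * y 6 + 13 / 16 * y 7, 0,
      y 6 + 11 / 16 * y 7, 0, y 7, 0, 0, 0]
    let x : List ℝ := [z 1, z 2, 0, z 0 - z 1, z 0 - z 2, z 0, z 4, z 5, z 6, 0, z 8, 0, z 10,
      z 0 - z 4 + z 10,
      z 0 - z 5 + z 10, z 0 - z 6 + z 10, z 0 + z 10, z 0 - z 8 + z 10, 0, 0, 0, -z 10,
      z 8 - z 10, z 8 - z 10, z 8 - z 10, z 0]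
    refine ⟨fun k => x.getD k 0, ⟨fun k hk => List.getD_eq_default _ _ hk, ?_⟩, fun i => ?_⟩
    · rw [hL, hn]
      simp only [List.forall_mem_cons, prevIndex]
      simp [x]
      and_intros <;> ring
    · fin_cases i <;> simp [p, x, z] <;> ring
  · have h := hx.2
    rw [hL, hn] at h
    simp [prevIndex] at h
    obtain ⟨h0, h1, h2, h3, h4, h5, h6, h7, h8, h9, h10, h11, h12⟩ := h
    have e3 : x 3 = x 25 + x 2 - x 0 := by linarith only [h0]
    have e4 : x 4 = x 0 + x 3 - x 1 := by linarith only [h2]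
    have e5 : x 5 = x 1 + x 4 - x 2 := by linarith only [h1]
    have e13 : x 13 = x 5 + x 12 - x 6 := by linarith only [h6]
    have e14 : x 14 = x 6 + x 13 - x 7 := by linarith only [h3]
    have e15 : x 15 = x 7 + x 14 - x 8 := by linarith only [h7]
    have e16 : x 16 = x 8 + x 15 - x 9 := by linarith only [h4]
    have e17 : x 17 = x 9 + x 16 - x 10 := by linarith only [h8]
    have e21 : x 21 = x 11 + x 20 - x 12 := by linarith only [h10]
    have e22 : x 22 = x 10 + x 21 - x 11 := by linarith only [h5]
    have e23 : x 23 = x 19 + x 22 - x 20 := by linarith only [h11]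
    have e24 : x 24 = x 18 + x 23 - x 19 := by linarith only [h9]
    rw [indexForm, hL, hn]
    simp [prevIndex, Fin.sum_univ_succ, p]
    simp only [e3, e4, e5, e13, e14, e15, e16, e17, e21, e22, e23, e24]
    ring
  · simp [Fin.sum_univ_succ]

theorem signature_mirror_trefoil_connectedSum_tenSix :
    (trefoil.mirror.connectedSum tenSix).signature = 6 := by
  have hL : crossingList (trefoil.mirror.connectedSum tenSix).visits =
      [(1, 4, false), (3, 0, false), (5, 2, false), (6, 13, false), (8, 15, false),
       (10, 17, false), (12, 21, true), (14, 7, false), (16, 9, false), (18, 25, false),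
       (20, 23, false), (22, 11, true), (24, 19, false)] := by
    decide +kernel
  have hn : (trefoil.mirror.connectedSum tenSix).visits.length = 26 := rfl
  let p : ℕ → (ℕ → ℝ) →ₗ[ℝ] ℝ := LinearMap.proj
  refine signature_eq ⟨Fin 8, inferInstance, ![6, 11 / 6, 12 / 11, 7 / 4, 6 / 7, 5 / 6, 16 / 5,
    -(37 / 16)],
    ![p 25 - (1 / 6 : ℝ) • p 0 - (1 / 3 : ℝ) • p 1 + (1 / 6 : ℝ) • p 2 - (1 / 6 : ℝ) • p 6
        - (1 / 3 : ℝ) • p 7 - (1 / 3 : ℝ) • p 8 - (1 / 3 : ℝ) • p 9 - (1 / 6 : ℝ) • p 10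
        + (2 / 3 : ℝ) • p 12,
      p 0 + (4 / 11 : ℝ) • p 1 - p 2 - (1 / 11 : ℝ) • p 6 - (2 / 11 : ℝ) • p 7
        - (2 / 11 : ℝ) • p 8 - (2 / 11 : ℝ) • p 9 - (1 / 11 : ℝ) • p 10 + (4 / 11 : ℝ) • p 12,
      p 1 - (1 / 4 : ℝ) • p 6 - (1 / 2 : ℝ) • p 7 - (1 / 2 : ℝ) • p 8 - (1 / 2 : ℝ) • p 9
        - (1 / 4 : ℝ) • p 10 + p 12,
      p 6 + (2 / 7 : ℝ) • p 7 - (2 / 7 : ℝ) • p 8 - (2 / 7 : ℝ) • p 9 - (1 / 7 : ℝ) • p 10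
        - (4 / 7 : ℝ) • p 12,
      p 7 + (1 / 6 : ℝ) • p 8 - p 9 - (1 / 2 : ℝ) • p 10 + (1 / 3 : ℝ) • p 12,
      p 8 - (3 / 5 : ℝ) • p 10 - (2 / 5 : ℝ) • p 12,
      p 10 - (21 / 16 : ℝ) • p 12 + (5 / 16 : ℝ) • p 20,
      p 12 - p 20],
    ?_, fun y => ?_, fun x hx => ?_, ?_⟩
  · intro i
    fin_cases i <;> norm_num
  -- Back substitution with the same eight pivots.
  · let z : Fin 14 → ℝ := ![y 0 + 1 / 6 * y 1 + 3 / 11 * y 2 + 1 / 4 * y 3 + 3 / 7 * y 4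
    + 1 / 2 * y 5 + 4 / 5 * y 6 + 1 / 4 * y 7,
      y 1 - 4 / 11 * y 2,
      y 2 + 1 / 4 * y 3 + 3 / 7 * y 4 + 1 / 2 * y 5 + 4 / 5 * y 6 + 1 / 4 * y 7, 0,
      y 3 - 2 / 7 * y 4 + 1 / 3 * y 5 + 1 / 5 * y 6 + 17 / 16 * y 7,
      y 4 - 1 / 6 * y 5 + 2 / 5 * y 6 + 1 / 8 * y 7, y 5 + 3 / 5 * y 6 + 19 / 16 * y 7, 0,
      y 6 + 21 / 16 * y 7, 0, y 7, 0, 0, 0]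
    let x : List ℝ := [z 1, z 2, 0, z 0 - z 1, z 0 - z 2, z 0, z 4, z 5, z 6, 0, z 8, 0, z 10,
      z 0 - z 4 + z 10,
      z 0 - z 5 + z 10, z 0 - z 6 + z 10, z 0 + z 10, z 0 - z 8 + z 10, 0, 0, 0, -z 10,
      z 8 - z 10, z 8 - z 10, z 8 - z 10, z 0]
    refine ⟨fun k => x.getD k 0, ⟨fun k hk => List.getD_eq_default _ _ hk, ?_⟩, fun i => ?_⟩
    · rw [hL, hn]
      simp only [List.forall_mem_cons, prevIndex]
      simp [x]
      and_intros <;> ring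
    · fin_cases i <;> simp [p, x, z] <;> ring
  · have h := hx.2
    rw [hL, hn] at h
    simp [prevIndex] at h
    obtain ⟨h0, h1, h2, h3, h4, h5, h6, h7, h8, h9, h10, h11, h12⟩ := h
    have e3 : x 3 = x 25 + x 2 - x 0 := by linarith only [h1]
    have e4 : x 4 = x 0 + x 3 - x 1 := by linarith only [h0]
    have e5 : x 5 = x 1 + x 4 - x 2 := by linarith only [h2]
    have e13 : x 13 = x 5 + x 12 - x 6 := by linarith only [h3]
    have e14 : x 14 = x 6 + x 13 - x 7 := by linarith only [h7]
    have e15 : x 15 = x 7 + x 14 - x 8 := by linarith only [h4]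
    have e16 : x 16 = x 8 + x 15 - x 9 := by linarith only [h8]
    have e17 : x 17 = x 9 + x 16 - x 10 := by linarith only [h5]
    have e21 : x 21 = x 11 + x 20 - x 12 := by linarith only [h6]
    have e22 : x 22 = x 10 + x 21 - x 11 := by linarith only [h11]
    have e23 : x 23 = x 19 + x 22 - x 20 := by linarith only [h10]
    have e24 : x 24 = x 18 + x 23 - x 19 := by linarith only [h12]
    rw [indexForm, hL, hn]
    simp [prevIndex, Fin.sum_univ_succ, p]
    simp only [e3, e4, e5, e13, e14, e15, e16, e17, e21, e22, e23, e24]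
    ring
  · simp [Fin.sum_univ_succ]

end KnotDiagram

/-- The knots `3_1` and `10_6`, in either of their two mirror images `K₁` and `K₂`, have unknotting
numbers `1` and `2` or `3`. For some choice of the mirror images, the signature of the connected
sum `K₁ # K₂` is `±2`, and for each such choice `K₁ # K₂` has unknotting number at most `3`. -/
theorem theorem1p3 :
    (∃ K₁ K₂ : KnotDiagram,
      (K₁ = KnotDiagram.trefoil ∨ K₁ = KnotDiagram.trefoil.mirror) ∧
      (K₂ = KnotDiagram.tenSix ∨ K₂ = KnotDiagram.tenSix.mirror) ∧
      |(K₁.connectedSum K₂).signature| = 2) ∧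
    ∀ K₁ K₂ : KnotDiagram,
      (K₁ = KnotDiagram.trefoil ∨ K₁ = KnotDiagram.trefoil.mirror) →
      (K₂ = KnotDiagram.tenSix ∨ K₂ = KnotDiagram.tenSix.mirror) →
      K₁.unknottingNumber = 1 ∧
      (K₂.unknottingNumber = 2 ∨ K₂.unknottingNumber = 3) ∧
      (|(K₁.connectedSum K₂).signature| = 2 →
        (K₁.connectedSum K₂).unknottingNumber ≤ 3) := by
  refine ⟨⟨_, _, .inl rfl, .inl rfl, ?_⟩, ?_⟩
  · rw [KnotDiagram.signature_trefoil_connectedSum_tenSix]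
    norm_num
  rintro K₁ K₂ h₁ h₂
  refine ⟨?_, ?_, ?_⟩
  · rcases h₁ with rfl | rfl
    · exact KnotDiagram.unknottingNumber_trefoil
    · rw [KnotDiagram.unknottingNumber_mirror, KnotDiagram.unknottingNumber_trefoil]
  · rcases h₂ with rfl | rfl
    · exact KnotDiagram.unknottingNumber_tenSix
    · rw [KnotDiagram.unknottingNumber_mirror]
      exact KnotDiagram.unknottingNumber_tenSix
  · have hle := KnotDiagram.unknottingNumber_le
      KnotDiagram.unknotsIn_trefoil_connectedSum_tenSix
    -- Equal choices give the sum treated explicitly or its mirror image, and the bound holds. In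
    -- the mixed cases the signature is `-6` or `6`, contrary to the assumption.
    rcases h₁ with rfl | rfl <;> rcases h₂ with rfl | rfl <;> intro h
    · exact hle
    · rw [KnotDiagram.signature_trefoil_connectedSum_mirror_tenSix] at h
      norm_num at h
    · rw [KnotDiagram.signature_mirror_trefoil_connectedSum_tenSix] at h
      norm_num at h
    · rw [KnotDiagram.connectedSum_mirror, KnotDiagram.unknottingNumber_mirror]
      exact hle
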